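/- Let $(N,J,h)$ be a connected locally Hermitian symmetric space, i.e. a connected (finite-dimensional) Kähler manifold whose curvature tensor is parallel, $\nabla R=0$, where $\nabla$ is the Levi-Civita connection and $R(X,Y)=\nabla_X\nabla_Y-\nabla_Y\nabla_X-\nabla_{[X,Y]}$. Let $\alpha,\beta\in\mathbb R$. For maps $u(x,t)$ with $x\in S^1=\mathbb R/2\pi\mathbb Z$, let $\nabla_x$ be the covariant derivative along $x\mapsto u(x,t)$, and consider the Cauchy problem $$u_t=\alpha J\nabla_x u_x+\beta\Bigl(\nabla_x^2u_x+\tfrac12R(u_x,Ju_x)Ju_x\Bigr),\qquad u(x,0)=u_0(x). \tag{1.15}$$ For a smooth map $v:S^1\to N$ put $E_1(v)=\frac12\int_{S^1}|v_x|^2dx$ and $$E_4(v)=2\int_{S^1}|\nabla_x^2v_x|^2dx-3\int_{S^1}\langle\nabla_xv_x,R(\nabla_xv_x,v_x)v_x\rangle dx-5\int_{S^1}\langle\nabla_xv_x,R(\nabla_xv_x,Jv_x)Jv_x\rangle dx .$$ Lemma 3.6. For all real $A,B$ there are constants $C,K>0$, depending only on $N$ (with its structure $J,h$), $\alpha$,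 $\beta$, $A$ and $B$, such that the following holds. Let $u:S^1\times[0,T)\to N$ be a smooth solution of (1.15) with $E_1(u_0)\le A$. Then at every time $t\in(0,T)$ with $\|\nabla_xu_x(\cdot,t)\|_{L^2}\le B$ the function $t\mapsto E_4(u(\cdot,t))$ is differentiable and $$\frac{dE_4}{dt}\le C\,(E_4+K).$$ -/

import Mathlib

open Set
open scoped Manifold ContDiff Topology

noncomputable section

namespace SchrodingerAiry

/-- A complex manifold is in particular a real smooth manifold (with the same charts). -/
instance isManifold_real {E : Type*} [NormedAddCommGroup E] [NormedSpace ℂ E]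
    {N : Type*} [TopologicalSpace N] [ChartedSpace E N] [IsManifold 𝓘(ℂ, E) ω N] :
    IsManifold 𝓘(ℝ, E) ∞ N := by
  refine isManifold_of_contDiffOn _ _ _ fun e e' he he' => ?_
  have h := (contDiffGroupoid ω 𝓘(ℂ, E)).compatible he he'
  have h2 : ContDiffOn ℂ ω (e.symm ≫ₕ e') (e.symm ≫ₕ e').source := by
    simpa [contDiffPregroupoid] using (mem_groupoid_of_pregroupoid.1 h).1
  simpa using (h2.restrict_scalars ℝ).of_le le_top

variable {E : Type*} [NormedAddCommGroup E] [NormedSpace ℂ E]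
variable {N : Type*} [TopologicalSpace N] [ChartedSpace E N] [IsManifold 𝓘(ℂ, E) ω N]

/-- The real tangent space of `N` at `q`. -/
abbrev Tan (E : Type*) [NormedAddCommGroup E] [NormedSpace ℂ E]
    {N : Type*} [TopologicalSpace N] [ChartedSpace E N] (q : N) : Type _ :=
  TangentSpace 𝓘(ℝ, E) q

/-- Smooth Riemannian metrics on the complex manifold `N`. -/
abbrev Metric (E : Type*) [NormedAddCommGroup E] [NormedSpace ℂ E]
    (N : Type*) [TopologicalSpace N] [ChartedSpace E N] [IsManifold 𝓘(ℂ, E) ω N] : Type _ :=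
  Bundle.ContMDiffRiemannianMetric 𝓘(ℝ, E) ∞ E (fun q : N => Tan E q)

/-- The complex structure `J` of `N`. In Mathlib the tangent space at `q` is `E`, read in the
preferred holomorphic chart at `q`, where `J` is multiplication by `i`. Since the
transition maps are holomorphic, `J` is multiplication by `i` in every chart. -/
def J {q : N} (v : Tan E q) : Tan E q :=
  let e : E := v
  (Complex.I • e : E)

/-! ### Local coordinates. Every chart is one of the charts `extChartAt 𝓘(ℝ, E) p`. -/

/-- The components, in the chart at `p`, of a tangent vector at `q`. For `q = p` this is
the identity of `E`. -/
def components (p : N) {q : N} (v : Tan E q) : E :=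
  mfderiv 𝓘(ℝ, E) 𝓘(ℝ, E) (extChartAt 𝓘(ℝ, E) p) q v

/-- The coordinate vector `∑ wⁱ ∂ᵢ` of the chart at `p`, at the point with coordinates `y`. -/
def coordVector (p : N) (y : E) : E →L[ℝ] Tan E ((extChartAt 𝓘(ℝ, E) p).symm y) :=
  mfderiv 𝓘(ℝ, E) 𝓘(ℝ, E) (extChartAt 𝓘(ℝ, E) p).symm y

/-- The metric coefficients in the chart at `p`: `metricCoeff h p y v w = h_{ij}(y) vⁱ wʲ`. -/
def metricCoeff (h : Metric E N) (p : N) (y : E) : E →L[ℝ] E →L[ℝ] ℝ :=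
  let G : E →L[ℝ] E →L[ℝ] ℝ := h.inner ((extChartAt 𝓘(ℝ, E) p).symm y)
  let e : E →L[ℝ] E := coordVector p y
  G.bilinearComp e e

/-- The linear form `z ↦ ½ (∂_v h(w, z) + ∂_w h(v, z) - ∂_z h(v, w))`, i.e. the Christoffel
symbols of the first kind. -/
def christoffelFirst (h : Metric E N) (p : N) (y : E) (v w : E) : E →L[ℝ] ℝ :=
  (1 / 2 : ℝ) • (fderiv ℝ (metricCoeff h p) y v w + fderiv ℝ (metricCoeff h p) y w v
    - ((fderiv ℝ (metricCoeff h p) y).flip v).flip w)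

/-- The Christoffel symbols `Γ^k_{ij} vⁱ wʲ` of the Levi-Civita connection in the chart at `p`:
the first kind symbols with the index raised by the inverse of the metric. -/
def christoffel (h : Metric E N) (p : N) (y : E) (v w : E) : E :=
  (metricCoeff h p y).inverse (christoffelFirst h p y v w)

/-- The Riemann curvature operator `R(v, w) z` in the chart at `p`, with the convention
`R(X, Y) = ∇_X ∇_Y - ∇_Y ∇_X - ∇_{[X, Y]}`. -/
def curvatureCoeff (h : Metric E N) (p : N) (y : E) (v w z : E) : E :=
  fderiv ℝ (fun y' => christoffel h p y' w z) y v
    - fderiv ℝ (fun y' => christoffel h p y' v z) y w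
    + christoffel h p y v (christoffel h p y w z)
    - christoffel h p y w (christoffel h p y v z)

/-- The covariant derivative `(∇_x R)(v, w) z` of the curvature tensor in the chart at `p`. -/
def covDerivCurvatureCoeff (h : Metric E N) (p : N) (y : E) (x v w z : E) : E :=
  fderiv ℝ (fun y' => curvatureCoeff h p y' v w z) y x
    + christoffel h p y x (curvatureCoeff h p y v w z)
    - curvatureCoeff h p y (christoffel h p y x v) w z
    - curvatureCoeff h p y v (christoffel h p y x w) z
    - curvatureCoeff h p y v w (christoffel h p y x z)

/-- The fundamental form `ω(X, Y) = h(J X, Y)` in the chart at `p`. -/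
def fundamentalFormCoeff (h : Metric E N) (p : N) (y : E) (v w : E) : ℝ :=
  metricCoeff h p y (Complex.I • v) w

/-! ### Kähler manifolds and locally Hermitian symmetric spaces -/

/-- `(N, J, h)` is Kähler: `J` is an isometry of `h` and the fundamental form is closed
(it is then symplectic). -/
structure IsKahler (h : Metric E N) : Prop where
  isometry_J : ∀ (q : N) (v w : Tan E q), h.inner q (J v) (J w) = h.inner q v w
  closed : ∀ (p : N), ∀ y ∈ (extChartAt 𝓘(ℝ, E) p).target, ∀ v₁ v₂ v₃ : E,
    fderiv ℝ (fun y' => fundamentalFormCoeff h p y' v₂ v₃) y v₁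
      + fderiv ℝ (fun y' => fundamentalFormCoeff h p y' v₃ v₁) y v₂
      + fderiv ℝ (fun y' => fundamentalFormCoeff h p y' v₁ v₂) y v₃ = 0

/-- `(N, J, h)` is a locally Hermitian symmetric space: it is Kähler and `∇R = 0`. -/
structure IsLocallyHermitianSymmetric (h : Metric E N) : Prop extends IsKahler h where
  parallel_curvature : ∀ (p : N), ∀ y ∈ (extChartAt 𝓘(ℝ, E) p).target, ∀ x v w z : E,
    covDerivCurvatureCoeff h p y x v w z = 0

/-- The Riemann curvature operator `R(v, w) z` on the tangent space at `q`. -/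
def curvature (h : Metric E N) {q : N} (v w z : Tan E q) : Tan E q :=
  (curvatureCoeff h q (extChartAt 𝓘(ℝ, E) q q) v w z : E)

/-! ### Calculus along curves -/

/-- The velocity vector of a curve. -/
def velocity (γ : ℝ → N) (s : ℝ) : Tan E (γ s) :=
  mfderiv 𝓘(ℝ, ℝ) 𝓘(ℝ, E) γ s (1 : ℝ)

/-- The covariant derivative at `s` of a vector field `V` along the curve `γ`, i.e. for the
pull-back of the Levi-Civita connection: `dVᵏ/ds + Γᵏᵢⱼ (dγⁱ/ds) Vʲ` in the chart at `γ s`. -/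
def covDeriv (h : Metric E N) (γ : ℝ → N) (V : ∀ s, Tan E (γ s)) (s : ℝ) : Tan E (γ s) :=
  (deriv (fun σ => components (γ s) (V σ)) s
    + christoffel h (γ s) (extChartAt 𝓘(ℝ, E) (γ s) (γ s)) (velocity γ s) (V s) : E)

/-! ### Maps from the circle `S¹ = ℝ / 2πℤ`, with `x ∈ ℝ` the angle -/

/-- The map `v : S¹ → N` as a `2π`-periodic function of the angle. -/
def lift (v : Circle → N) (x : ℝ) : N := v (Circle.exp x)

/-- `v_x`. -/
def dx (v : Circle → N) (x : ℝ) : Tan E (lift v x) := velocity (lift v) x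

/-- `∇_x v_x`. -/
def dxx (h : Metric E N) (v : Circle → N) (x : ℝ) : Tan E (lift v x) :=
  covDeriv h (lift v) (dx v) x

/-- `∇_x² v_x`. -/
def dxxx (h : Metric E N) (v : Circle → N) (x : ℝ) : Tan E (lift v x) :=
  covDeriv h (lift v) (dxx h v) x

/-- The energy `E₁(v) = ½ ∫ |v_x|² dx`. -/
def energyOne (h : Metric E N) (v : Circle → N) : ℝ :=
  (1 / 2) * ∫ x in (0 : ℝ)..2 * Real.pi, h.inner (lift v x) (dx v x) (dx v x)

/-- The norm `‖∇_x v_x‖_{L²}`. -/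
def normDxx (h : Metric E N) (v : Circle → N) : ℝ :=
  Real.sqrt (∫ x in (0 : ℝ)..2 * Real.pi, h.inner (lift v x) (dxx h v x) (dxx h v x))

/-- The functional `E₄(v)`. -/
def energyFour (h : Metric E N) (v : Circle → N) : ℝ :=
  2 * (∫ x in (0 : ℝ)..2 * Real.pi, h.inner (lift v x) (dxxx h v x) (dxxx h v x))
  - 3 * (∫ x in (0 : ℝ)..2 * Real.pi,
      h.inner (lift v x) (dxx h v x) (curvature h (dxx h v x) (dx v x) (dx v x)))
  - 5 * (∫ x in (0 : ℝ)..2 * Real.pi,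
      h.inner (lift v x) (dxx h v x) (curvature h (dxx h v x) (J (dx v x)) (J (dx v x))))

/-- `u : S¹ × [0, T) → N`, `(x, t) ↦ u t x`, is a smooth solution of the Cauchy problem
`u_t = α J ∇_x u_x + β (∇_x² u_x + ½ R(u_x, J u_x) J u_x)`, `u(·, 0) = u₀`.
(The values of `u` for `t ∉ [0, T)` are irrelevant.) -/
structure IsSmoothSolution (h : Metric E N) (α β T : ℝ) (u₀ : Circle → N)
    (u : ℝ → Circle → N) : Prop where
  smooth : ContMDiffOn ((𝓡 1).prod 𝓘(ℝ, ℝ)) 𝓘(ℝ, E) ∞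
    (fun z : Circle × ℝ => u z.2 z.1) (univ ×ˢ Ico 0 T)
  initial : u 0 = u₀
  flow : ∀ t ∈ Ioo 0 T, ∀ x : ℝ,
    (velocity (fun τ => u τ (Circle.exp x)) t : Tan E (lift (u t) x)) =
      α • J (dxx h (u t) x)
        + β • (dxxx h (u t) x
          + (1 / 2 : ℝ) • curvature h (dx (u t) x) (J (dx (u t) x)) (J (dx (u t) x)))

end SchrodingerAiry

end

set_option maxSynthPendingDepth 3
set_option linter.unusedSectionVars false

noncomputable section

/-! Write c = u_x, b = ∇_x u_x, a = ∇_x² u_x, d = ∇_x³ u_x. Differentiate 2∫|a|² along the flow and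
integrate by parts. The terms of highest order are x-derivatives of periodic functions or vanish
because ⟨Jd, d⟩ = 0. The curvature terms linear in d can also be integrated by parts. They leave
terms in a, b, c, of which only those of type β|a|²|b||c| are too large: the supremum of |b| grows
like (1 + ∫|a|²)^(1/4), so they would give superlinear growth. The two curvature integrals in E₄
produce terms of the same type, and with the weights 3 and 5 these cancel exactly. This is
`IsFlowOn.exact_energyFour_time_sub_rest`.

Two structural facts turn the cancellation into a polynomial identity. Since ∇R = 0, differentiating
a curvature term only differentiates its arguments. Since the metric is Kähler, the whole curvature
is recovered from the form S(X,Z;Y,W) = ½⟨R(X,Y)Z + R(X,JY)JZ, W⟩ (`curvForm`), which is symmetric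
in X, Z, symmetric in Y, W, and invariant under exchange of the two pairs. The nonlinear term of the
equation is S(c,c;c,·).

It remains to estimate. The bounds on ∫|c|² and ∫|b|² bound c in the supremum norm. The remainder is
then at most a constant times 1 + |a|² + |b|⁴ + |a||b|³ (`IsFlowOn.exists_abs_energyFourRest_le`),
and one-dimensional interpolation bounds the integral of this linearly in 1 + ∫|a|²
(`integral_lowerOrder_le`). The curvature part of E₄ is quadratic in b and c, so E₄ ≥ 2∫|a|² −
const, and the inequality closes (`IsFlowOn.exists_energyFour_growth`).

The constants are uniform for two reasons. N need not be compact, but parallel transport preserves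
R, so a curvature bound at one point holds on all of a connected N (`exists_curvature_bound`). And
E₁ is conserved, so its bound at time 0 persists (`IsSmoothSolution.energyOne_eq`). -/

namespace SchrodingerAiry

/-! ### Riemannian geometry in one coordinate domain: Christoffel symbols and the symmetries of the
curvature. -/

section LocalGeometry

variable {V : Type*} [NormedAddCommGroup V] [NormedSpace ℝ V]

/-- A smooth Riemannian metric on the open subset `U` of a vector space. -/
structure IsMetricOn (G : V → V →L[ℝ] V →L[ℝ] ℝ) (U : Set V) : Prop where
  isOpen : IsOpen U
  contDiffOn : ContDiffOn ℝ ∞ G U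
  symm : ∀ y ∈ U, ∀ v w, G y v w = G y w v
  pos : ∀ y ∈ U, ∀ v, v ≠ 0 → 0 < G y v v

lemma two_le_smooth : minSmoothness ℝ 2 ≤ ∞ := by
  simp only [minSmoothness_of_isRCLikeNormedField]
  exact WithTop.coe_le_coe.2 le_top

/-- `(flipOuter T) v w z = T z v w`. -/
def flipOuter (T : V →L[ℝ] V →L[ℝ] V →L[ℝ] ℝ) : V →L[ℝ] V →L[ℝ] V →L[ℝ] ℝ :=
  (ContinuousLinearMap.flipₗᵢ ℝ V V ℝ).toContinuousLinearEquiv.toContinuousLinearMap ∘L T.flip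

/-- The Christoffel symbols of the first kind of `G`. -/
def chrFirst (G : V → V →L[ℝ] V →L[ℝ] ℝ) (y : V) : V →L[ℝ] V →L[ℝ] V →L[ℝ] ℝ :=
  (1 / 2 : ℝ) • (fderiv ℝ G y + (fderiv ℝ G y).flip - flipOuter (fderiv ℝ G y))

lemma chrFirst_apply (G : V → V →L[ℝ] V →L[ℝ] ℝ) (y v w z : V) :
    chrFirst G y v w z =
      1 / 2 * (fderiv ℝ G y v w z + fderiv ℝ G y w v z - fderiv ℝ G y z v w) := rfl

/-- The Christoffel symbols of the second kind of `G`. -/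
def chr (G : V → V →L[ℝ] V →L[ℝ] ℝ) (y : V) : V →L[ℝ] V →L[ℝ] V :=
  (ContinuousLinearMap.compL ℝ V (V →L[ℝ] ℝ) V (G y).inverse) ∘L (chrFirst G y)

lemma chr_apply (G : V → V →L[ℝ] V →L[ℝ] ℝ) (y v w : V) :
    chr G y v w = (G y).inverse (chrFirst G y v w) := rfl

/-- The quadratic part `v, w, z ↦ Γ(v, Γ(w, z))` of the curvature. -/
def chrSq (Γ : V →L[ℝ] V →L[ℝ] V) : V →L[ℝ] V →L[ℝ] V →L[ℝ] V :=
  (ContinuousLinearMap.compL ℝ V V V).bilinearComp Γ Γ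

/-- The curvature operator of `G`. -/
def cur (G : V → V →L[ℝ] V →L[ℝ] ℝ) (y : V) : V →L[ℝ] V →L[ℝ] V →L[ℝ] V :=
  (fderiv ℝ (chr G) y + chrSq (chr G y)) - (fderiv ℝ (chr G) y + chrSq (chr G y)).flip

lemma cur_apply (G : V → V →L[ℝ] V →L[ℝ] ℝ) (y v w z : V) :
    cur G y v w z = fderiv ℝ (chr G) y v w z + chr G y v (chr G y w z)
      - (fderiv ℝ (chr G) y w v z + chr G y w (chr G y v z)) := rfl

lemma cur_antisymm (G : V → V →L[ℝ] V →L[ℝ] ℝ) (y v w z : V) :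
    cur G y v w z = - cur G y w v z := by
  simp only [cur_apply]; abel

namespace IsMetricOn

variable {G : V → V →L[ℝ] V →L[ℝ] ℝ} {U : Set V} {y : V}

lemma contDiffAt (hG : IsMetricOn G U) (hy : y ∈ U) : ContDiffAt ℝ ∞ G y :=
  hG.contDiffOn.contDiffAt (hG.isOpen.mem_nhds hy)

lemma eq_of_forall (hG : IsMetricOn G U) (hy : y ∈ U) {v w : V} (H : ∀ z, G y v z = G y w z) :
    v = w := by
  by_contra hne
  have := hG.pos y hy (v - w) (sub_ne_zero.2 hne)
  rw [map_sub (G y), sub_apply, H, sub_self] at this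
  exact lt_irrefl _ this

lemma fderiv_symm (hG : IsMetricOn G U) (hy : y ∈ U) (x v w : V) :
    fderiv ℝ G y x v w = fderiv ℝ G y x w v := by
  have hd : DifferentiableAt ℝ G y := (hG.contDiffAt hy).differentiableAt (by simp)
  have key : ∀ a b : V, fderiv ℝ (fun y' => G y' a b) y x = fderiv ℝ G y x a b := by
    intro a b
    have h1 := ((hd.hasFDerivAt.clm_apply (hasFDerivAt_const a y)).clm_apply
      (hasFDerivAt_const b y)).fderiv
    rw [h1]; simp
  rw [← key, ← key]
  have : (fun y' => G y' v w) =ᶠ[𝓝 y] fun y' => G y' w v := by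
    filter_upwards [hG.isOpen.mem_nhds hy] with y' hy' using hG.symm y' hy' v w
  rw [this.fderiv_eq]

lemma chrFirst_symm (hG : IsMetricOn G U) (hy : y ∈ U) (v w : V) :
    chrFirst G y v w = chrFirst G y w v := by
  ext z
  rw [chrFirst_apply, chrFirst_apply, hG.fderiv_symm hy z v w]; ring

lemma chr_symm (hG : IsMetricOn G U) (hy : y ∈ U) (v w : V) : chr G y v w = chr G y w v := by
  rw [chr_apply, chr_apply, hG.chrFirst_symm hy]

variable [FiniteDimensional ℝ V]

/-- Definiteness gives injectivity, and finite dimension does the rest. Without it the `inverse` in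
`chr` could be the default value 0, and both `metric_chr` and the smoothness of the symbols would be
lost. -/
lemma isInvertible (hG : IsMetricOn G U) (hy : y ∈ U) : (G y).IsInvertible := by
  have hinj : Function.Injective ((G y : V →L[ℝ] V →L[ℝ] ℝ) : V →ₗ[ℝ] V →L[ℝ] ℝ) := by
    intro v w hvw
    exact hG.eq_of_forall hy fun z => by
      have : G y v = G y w := hvw
      rw [this]
  have hdim : Module.finrank ℝ V = Module.finrank ℝ (V →L[ℝ] ℝ) := by
    rw [← (LinearMap.toContinuousLinearMap : (V →ₗ[ℝ] ℝ) ≃ₗ[ℝ] _).finrank_eq]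
    exact (Subspace.dual_finrank_eq (K := ℝ) (V := V)).symm
  refine ⟨(LinearEquiv.ofInjectiveOfFinrankEq _ hinj hdim).toContinuousLinearEquiv, ?_⟩
  ext v w
  rfl

lemma metric_chr (hG : IsMetricOn G U) (hy : y ∈ U) (v w z : V) :
    G y (chr G y v w) z = chrFirst G y v w z := by
  obtain ⟨e, he⟩ := hG.isInvertible hy
  rw [chr_apply, ← he, ContinuousLinearMap.inverse_equiv]
  simp

/-- Compatibility of the Levi-Civita connection with the metric. -/
lemma fderiv_eq (hG : IsMetricOn G U) (hy : y ∈ U) (x v w : V) :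
    fderiv ℝ G y x v w = G y (chr G y x v) w + G y v (chr G y x w) := by
  rw [hG.symm y hy v, hG.metric_chr hy, hG.metric_chr hy, chrFirst_apply, chrFirst_apply,
    hG.fderiv_symm hy x w v, hG.fderiv_symm hy w x v, hG.fderiv_symm hy v x w]
  ring

lemma contDiffAt_chr (hG : IsMetricOn G U) (hy : y ∈ U) : ContDiffAt ℝ ∞ (chr G) y := by
  have hd : ContDiffAt ℝ ∞ (fderiv ℝ G) y := (hG.contDiffAt hy).fderiv_right (by simp)
  have h1 : ContDiffAt ℝ ∞ (chrFirst G) y := by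
    have hflip : ContDiffAt ℝ ∞ (fun y => (fderiv ℝ G y).flip) y :=
      ((ContinuousLinearMap.flipₗᵢ ℝ V V
        (V →L[ℝ] ℝ)).toContinuousLinearEquiv.contDiff.contDiffAt).comp
        y hd
    exact ((hd.add hflip).sub (contDiffAt_const.clm_comp hflip)).const_smul (1 / 2 : ℝ)
  have h2 : ContDiffAt ℝ ∞ (fun y => (G y).inverse) y := by
    have := FiniteDimensional.complete ℝ V
    exact (hG.isInvertible hy).contDiffAt_map_inverse.comp y (hG.contDiffAt hy)
  exact ((ContinuousLinearMap.compL ℝ V (V →L[ℝ] ℝ) V).contDiff.contDiffAt.comp y h2).clm_comp h1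

lemma contDiffAt_cur (hG : IsMetricOn G U) (hy : y ∈ U) : ContDiffAt ℝ ∞ (cur G) y := by
  have hc := hG.contDiffAt_chr hy
  have hd : ContDiffAt ℝ ∞ (fderiv ℝ (chr G)) y := hc.fderiv_right (by simp)
  have hF : ContDiff ℝ ∞ (fun T : V →L[ℝ] V →L[ℝ] V →L[ℝ] V => T.flip) :=
    (ContinuousLinearMap.flipₗᵢ ℝ V V (V →L[ℝ] V)).toContinuousLinearEquiv.contDiff
  have hs : ContDiffAt ℝ ∞ (fun y => chrSq (chr G y)) y := by
    have h1 : ContDiffAt ℝ ∞ (fun y => (ContinuousLinearMap.compL ℝ V V V) ∘L (chr G y)) y :=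
      contDiffAt_const.clm_comp hc
    have h2 := (ContinuousLinearMap.flipₗᵢ ℝ V (V →L[ℝ] V)
      (V →L[ℝ] V)).toContinuousLinearEquiv.contDiff.contDiffAt.comp y h1
    have h3 := (h2 : ContDiffAt ℝ ∞ (fun y => ((ContinuousLinearMap.compL ℝ V V V) ∘L
      (chr G y)).flip) y).clm_comp hc
    exact hF.contDiffAt.comp y h3
  exact (hd.add hs).sub (hF.contDiffAt.comp y (hd.add hs))

lemma fderiv_chr_symm (hG : IsMetricOn G U) (hy : y ∈ U) (x v w : V) :
    fderiv ℝ (chr G) y x v w = fderiv ℝ (chr G) y x w v := by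
  have hd : DifferentiableAt ℝ (chr G) y := (hG.contDiffAt_chr hy).differentiableAt (by simp)
  have key : ∀ a b : V, fderiv ℝ (fun y' => chr G y' a b) y x = fderiv ℝ (chr G) y x a b := by
    intro a b
    have h1 := ((hd.hasFDerivAt.clm_apply (hasFDerivAt_const a y)).clm_apply
      (hasFDerivAt_const b y)).fderiv
    rw [h1]; simp
  rw [← key, ← key]
  have : (fun y' => chr G y' v w) =ᶠ[𝓝 y] fun y' => chr G y' w v := by
    filter_upwards [hG.isOpen.mem_nhds hy] with y' hy' using hG.chr_symm hy' v w
  rw [this.fderiv_eq]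

/-- The first Bianchi identity. -/
lemma bianchi (hG : IsMetricOn G U) (hy : y ∈ U) (u v w : V) :
    cur G y u v w + cur G y v w u + cur G y w u v = 0 := by
  simp only [cur_apply]
  rw [hG.fderiv_chr_symm hy u v w, hG.fderiv_chr_symm hy v u w, hG.fderiv_chr_symm hy w v u,
    hG.chr_symm hy v w, hG.chr_symm hy u w, hG.chr_symm hy v u]
  abel

/-- Differentiate the compatibility equation once more. The second derivative of G(w, z) is
symmetric in the two directions, and its antisymmetrisation expressed through the Christoffel
symbols is ⟨R(u,v)w, z⟩ + ⟨w, R(u,v)z⟩. -/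
lemma metric_cur_skew (hG : IsMetricOn G U) (hy : y ∈ U) (u v w z : V) :
    G y (cur G y u v w) z = - G y (cur G y u v z) w := by
  have hd : DifferentiableAt ℝ (chr G) y := (hG.contDiffAt_chr hy).differentiableAt (by simp)
  have hg : DifferentiableAt ℝ G y := (hG.contDiffAt hy).differentiableAt (by simp)
  have hdg : DifferentiableAt ℝ (fderiv ℝ G) y :=
    ((hG.contDiffAt hy).fderiv_right (m := ∞) (by simp)).differentiableAt (by simp)
  have hs : IsSymmSndFDerivAt ℝ G y := (hG.contDiffAt hy).isSymmSndFDerivAt two_le_smooth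
  have key : ∀ a b : V, fderiv ℝ (fderiv ℝ G) y a b w z =
      G y (fderiv ℝ (chr G) y a b w) z + fderiv ℝ G y a (chr G y b w) z
      + (G y w (fderiv ℝ (chr G) y a b z) + fderiv ℝ G y a w (chr G y b z)) := by
    intro a b
    have h1 := ((hdg.hasFDerivAt.clm_apply (hasFDerivAt_const b y)).clm_apply
      (hasFDerivAt_const w y)).clm_apply (hasFDerivAt_const z y)
    have hc : ∀ c, HasFDerivAt (fun y' => chr G y' b c) _ y := fun c =>
      ((hd.hasFDerivAt.clm_apply (hasFDerivAt_const b y)).clm_apply (hasFDerivAt_const c y))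
    have h2 := ((hg.hasFDerivAt.clm_apply (hc w)).clm_apply (hasFDerivAt_const z y)).add
      ((hg.hasFDerivAt.clm_apply (hasFDerivAt_const w y)).clm_apply (hc z))
    have he : (fun y' => fderiv ℝ G y' b w z) =ᶠ[𝓝 y]
        fun y' => G y' (chr G y' b w) z + G y' w (chr G y' b z) := by
      filter_upwards [hG.isOpen.mem_nhds hy] with y' hy' using hG.fderiv_eq hy' b w z
    have h3 := congrArg (fun L : V →L[ℝ] ℝ => L a) (h1.unique (h2.congr_of_eventuallyEq he))
    simpa using h3
  have e1 := key u v
  have e2 := key v u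
  have e3 : fderiv ℝ (fderiv ℝ G) y u v w z = fderiv ℝ (fderiv ℝ G) y v u w z := by
    rw [hs.eq u v]
  rw [hG.fderiv_eq hy, hG.fderiv_eq hy] at e1 e2
  rw [hG.symm y hy (cur G y u v z) w]
  simp only [cur_apply, map_sub, map_add, sub_apply,
    add_apply]
  linarith

/-- The pair symmetry of the curvature tensor. -/
lemma metric_cur_pair (hG : IsMetricOn G U) (hy : y ∈ U) (u v w z : V) :
    G y (cur G y u v w) z = G y (cur G y w z u) v := by
  have B : ∀ a b c d : V, G y (cur G y a b c) d + G y (cur G y b c a) d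
      + G y (cur G y c a b) d = 0 := by
    intro a b c d
    have := congrArg (fun t => G y t d) (hG.bianchi hy a b c)
    simpa using this
  have A : ∀ a b c d : V, G y (cur G y a b c) d = - G y (cur G y b a c) d := by
    intro a b c d
    rw [cur_antisymm, map_neg, neg_apply]
  have S := hG.metric_cur_skew hy
  -- The octahedron argument: the Bianchi identities for the four cyclic rotations of u, v, w, z are
  -- combined, using antisymmetry in the first pair and in the last pair.
  have b1 := B u v w z
  have b2 := B v w z u
  have b3 := B w z u v
  have b4 := B z u v w
  have s1 := S v w z u
  have s2 := S w z v u
  have s3 := S z v w u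
  have s4 := S z u w v
  have s5 := S u w z v
  have s6 := S u v z w
  have a1 := A w z v u
  have a2 := A v w u z
  have a3 := A u w v z
  have a4 := A z v w u
  have a5 := A u w z v
  have a6 := A z u w v
  have a7 := A v z u w
  have a8 := A z v u w
  have s7 := S v z u w
  have s8 := S z u v w
  linarith

/-- Compatibility along curves: differentiating the scalar product of two fields along a map. -/
lemma hasFDerivAt_inner {P : Type*} [NormedAddCommGroup P] [NormedSpace ℝ P]
    (hG : IsMetricOn G U) {f X Y : P → V} {z : P}
    (hz : f z ∈ U) (hf : DifferentiableAt ℝ f z) (hX : DifferentiableAt ℝ X z)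
    (hY : DifferentiableAt ℝ Y z) (e : P) :
    fderiv ℝ (fun z => G (f z) (X z) (Y z)) z e =
      G (f z) (fderiv ℝ X z e + chr G (f z) (fderiv ℝ f z e) (X z)) (Y z)
      + G (f z) (X z) (fderiv ℝ Y z e + chr G (f z) (fderiv ℝ f z e) (Y z)) := by
  have hg : DifferentiableAt ℝ G (f z) := (hG.contDiffAt hz).differentiableAt (by simp)
  have h1 := ((hg.hasFDerivAt.comp z hf.hasFDerivAt).clm_apply hX.hasFDerivAt).clm_apply
    hY.hasFDerivAt
  have h2 := congrArg (fun L : P →L[ℝ] ℝ => L e) h1.fderiv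
  refine Eq.trans h2 ?_
  simp [hG.fderiv_eq hz]
  ring

end IsMetricOn

end LocalGeometry

/-! ### Covariant differentiation of fields along maps, and its behaviour under isometries. -/

section LocalFields

variable {V : Type*} [NormedAddCommGroup V] [NormedSpace ℝ V]
variable {P : Type*} [NormedAddCommGroup P] [NormedSpace ℝ P]

/-- The covariant derivative in the direction `e` of a vector field `X` along `f`. -/
def cov (G : V → V →L[ℝ] V →L[ℝ] ℝ) (f X : P → V) (e : P) (z : P) : V :=
  fderiv ℝ X z e + chr G (f z) (fderiv ℝ f z e) (X z)

lemma cov_congr {G : V → V →L[ℝ] V →L[ℝ] ℝ} {f f' X X' : P → V} {z : P} (hf : f =ᶠ[𝓝 z] f')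
    (hX : X =ᶠ[𝓝 z] X') (e : P) : cov G f X e z = cov G f' X' e z := by
  simp only [cov, hf.fderiv_eq, hX.fderiv_eq, hf.eq_of_nhds, hX.eq_of_nhds]

/-- `φ` is a smooth local isometry from `(U, G)` to `(U', G')`. -/
structure IsIsometryOn (φ : V → V) (G : V → V →L[ℝ] V →L[ℝ] ℝ) (U : Set V)
    (G' : V → V →L[ℝ] V →L[ℝ] ℝ) (U' : Set V) : Prop where
  metric : IsMetricOn G U
  metric' : IsMetricOn G' U'
  contDiffOn : ContDiffOn ℝ ∞ φ U
  mapsTo : MapsTo φ U U'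
  isometry : ∀ y ∈ U, ∀ v w, G y v w = G' (φ y) (fderiv ℝ φ y v) (fderiv ℝ φ y w)
  surjective : ∀ y ∈ U, Function.Surjective (fderiv ℝ φ y)

lemma fderiv_apply_field {W W' : Type*} [NormedAddCommGroup W] [NormedSpace ℝ W]
    [NormedAddCommGroup W'] [NormedSpace ℝ W'] {A : P → W →L[ℝ] W'} {X : P → W} {z : P}
    (hA : DifferentiableAt ℝ A z) (hX : DifferentiableAt ℝ X z) (e : P) :
    fderiv ℝ (fun z => A z (X z)) z e = fderiv ℝ A z e (X z) + A z (fderiv ℝ X z e) := by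
  rw [(hA.hasFDerivAt.clm_apply hX.hasFDerivAt).fderiv]
  simp [add_comm]

namespace IsIsometryOn

variable {φ : V → V} {G G' : V → V →L[ℝ] V →L[ℝ] ℝ} {U U' : Set V} {y : V}

lemma contDiffAt (hφ : IsIsometryOn φ G U G' U') (hy : y ∈ U) : ContDiffAt ℝ ∞ φ y :=
  hφ.contDiffOn.contDiffAt (hφ.metric.isOpen.mem_nhds hy)

lemma differentiableAt_fderiv (hφ : IsIsometryOn φ G U G' U') (hy : y ∈ U) :
    DifferentiableAt ℝ (fderiv ℝ φ) y :=
  ((hφ.contDiffAt hy).fderiv_right (m := ∞) (by simp)).differentiableAt (by simp)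

/-- This is the derivative of the isometry equation. In the alternating sum defining the symbols of
the first kind the second derivatives of φ cancel, except for the φ''(v, w) that appears in
`fderiv_chr`. -/
lemma fderiv_metric (hφ : IsIsometryOn φ G U G' U') (hy : y ∈ U) (x v w : V) :
    fderiv ℝ G y x v w =
      fderiv ℝ G' (φ y) (fderiv ℝ φ y x) (fderiv ℝ φ y v) (fderiv ℝ φ y w)
      + G' (φ y) (fderiv ℝ (fderiv ℝ φ) y x v) (fderiv ℝ φ y w)
      + G' (φ y) (fderiv ℝ φ y v) (fderiv ℝ (fderiv ℝ φ) y x w) := by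
  have hg : DifferentiableAt ℝ G y := (hφ.metric.contDiffAt hy).differentiableAt (by simp)
  have hg' : DifferentiableAt ℝ G' (φ y) :=
    (hφ.metric'.contDiffAt (hφ.mapsTo hy)).differentiableAt (by simp)
  have hp : DifferentiableAt ℝ φ y := (hφ.contDiffAt hy).differentiableAt (by simp)
  have hdp := hφ.differentiableAt_fderiv hy
  have h1 := (hg.hasFDerivAt.clm_apply (hasFDerivAt_const v y)).clm_apply (hasFDerivAt_const w y)
  have hc : ∀ c, HasFDerivAt (fun y' => fderiv ℝ φ y' c) _ y := fun c =>
    hdp.hasFDerivAt.clm_apply (hasFDerivAt_const c y)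
  have h2 := ((hg'.hasFDerivAt.comp y hp.hasFDerivAt).clm_apply (hc v)).clm_apply (hc w)
  have he : (fun y' => G y' v w) =ᶠ[𝓝 y]
      fun y' => G' (φ y') (fderiv ℝ φ y' v) (fderiv ℝ φ y' w) := by
    filter_upwards [hφ.metric.isOpen.mem_nhds hy] with y' hy' using hφ.isometry y' hy' v w
  have h3 := congrArg (fun L : V →L[ℝ] ℝ => L x) (h1.unique (h2.congr_of_eventuallyEq he))
  simp at h3
  rw [h3]; ring

/-- The transformation law of the Christoffel symbols. -/
lemma fderiv_chr [FiniteDimensional ℝ V] (hφ : IsIsometryOn φ G U G' U') (hy : y ∈ U) (v w : V) :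
    fderiv ℝ φ y (chr G y v w) =
      chr G' (φ y) (fderiv ℝ φ y v) (fderiv ℝ φ y w) + fderiv ℝ (fderiv ℝ φ) y v w := by
  refine hφ.metric'.eq_of_forall (hφ.mapsTo hy) fun z' => ?_
  obtain ⟨z, rfl⟩ := hφ.surjective y hy z'
  have hs : IsSymmSndFDerivAt ℝ φ y := (hφ.contDiffAt hy).isSymmSndFDerivAt two_le_smooth
  rw [← hφ.isometry y hy, hφ.metric.metric_chr hy, map_add, add_apply,
    hφ.metric'.metric_chr (hφ.mapsTo hy), chrFirst_apply, chrFirst_apply, hφ.fderiv_metric hy,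
    hφ.fderiv_metric hy, hφ.fderiv_metric hy, hs.eq w v, hs.eq z v, hs.eq z w,
    hφ.metric'.symm _ (hφ.mapsTo hy) (fderiv ℝ (fderiv ℝ φ) y v z),
    hφ.metric'.symm _ (hφ.mapsTo hy) (fderiv ℝ φ y v)]
  rw [hφ.metric'.symm _ (hφ.mapsTo hy) (fderiv ℝ φ y w)]
  ring

/-- The covariant derivative is invariant under isometries. -/
lemma cov_comp [FiniteDimensional ℝ V] (hφ : IsIsometryOn φ G U G' U') {f X : P → V} {z : P}
    (hz : f z ∈ U)
    (hf : DifferentiableAt ℝ f z) (hX : DifferentiableAt ℝ X z) (e : P) :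
    cov G' (fun z => φ (f z)) (fun z => fderiv ℝ φ (f z) (X z)) e z =
      fderiv ℝ φ (f z) (cov G f X e z) := by
  have hp : DifferentiableAt ℝ φ (f z) := (hφ.contDiffAt hz).differentiableAt (by simp)
  have hdp := hφ.differentiableAt_fderiv hz
  have h1 : fderiv ℝ (fun z => φ (f z)) z e = fderiv ℝ φ (f z) (fderiv ℝ f z e) := by
    have := (hp.hasFDerivAt.comp z hf.hasFDerivAt).fderiv
    exact congrArg (fun L : P →L[ℝ] V => L e) this
  have h2 : fderiv ℝ (fun z => fderiv ℝ φ (f z)) z e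
      = fderiv ℝ (fderiv ℝ φ) (f z) (fderiv ℝ f z e) := by
    have := (hdp.hasFDerivAt.comp z hf.hasFDerivAt).fderiv
    exact congrArg (fun L : P →L[ℝ] V →L[ℝ] V => L e) this
  rw [cov, cov, fderiv_apply_field (A := fun z => fderiv ℝ φ (f z)) (hdp.comp z hf) hX, h1, h2,
    map_add, hφ.fderiv_chr hz]
  abel

end IsIsometryOn

namespace IsMetricOn

variable {G : V → V →L[ℝ] V →L[ℝ] ℝ} {U : Set V} {y : V}

lemma contDiffAt_cov [FiniteDimensional ℝ V] (hG : IsMetricOn G U) {f X : P → V} {z : P}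
    (hz : f z ∈ U)
    (hf : ContDiffAt ℝ ∞ f z) (hX : ContDiffAt ℝ ∞ X z) (e : P) :
    ContDiffAt ℝ ∞ (cov G f X e) z :=
  ((hX.fderiv_right (m := ∞) (by simp)).clm_apply contDiffAt_const).add
    ((((hG.contDiffAt_chr hz).comp z hf).clm_apply
      ((hf.fderiv_right (m := ∞) (by simp)).clm_apply contDiffAt_const)).clm_apply hX)

/-- The Levi-Civita connection is torsion free. -/
lemma cov_fderiv_comm (hG : IsMetricOn G U) {f : P → V} {z : P} (hz : f z ∈ U)
    (hf : ContDiffAt ℝ ∞ f z) (e e' : P) :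
    cov G f (fun z => fderiv ℝ f z e') e z = cov G f (fun z => fderiv ℝ f z e) e' z := by
  have hd : DifferentiableAt ℝ (fderiv ℝ f) z :=
    (hf.fderiv_right (m := ∞) (by simp)).differentiableAt (by simp)
  have hs : IsSymmSndFDerivAt ℝ f z := hf.isSymmSndFDerivAt two_le_smooth
  have h : ∀ a b : P, fderiv ℝ (fun z => fderiv ℝ f z a) z b = fderiv ℝ (fderiv ℝ f) z b a := by
    intro a b
    rw [fderiv_apply_field hd (differentiableAt_const a)]
    simp
  rw [cov, cov, hG.chr_symm hz, h, h, hs.eq e e']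

/-- The Ricci identity: the curvature is the commutator of covariant derivatives. -/
lemma cov_cov_sub [FiniteDimensional ℝ V] (hG : IsMetricOn G U) {f X : P → V} {z : P}
    (hz : f z ∈ U)
    (hf : ContDiffAt ℝ ∞ f z) (hX : ContDiffAt ℝ ∞ X z) (e e' : P) :
    cov G f (cov G f X e') e z - cov G f (cov G f X e) e' z =
      cur G (f z) (fderiv ℝ f z e) (fderiv ℝ f z e') (X z) := by
  have hc : DifferentiableAt ℝ (chr G) (f z) := (hG.contDiffAt_chr hz).differentiableAt (by simp)
  have hf1 : DifferentiableAt ℝ f z := hf.differentiableAt (by simp)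
  have hX1 : DifferentiableAt ℝ X z := hX.differentiableAt (by simp)
  have hd : DifferentiableAt ℝ (fderiv ℝ f) z :=
    (hf.fderiv_right (m := ∞) (by simp)).differentiableAt (by simp)
  have hdX : DifferentiableAt ℝ (fderiv ℝ X) z :=
    (hX.fderiv_right (m := ∞) (by simp)).differentiableAt (by simp)
  have hs : IsSymmSndFDerivAt ℝ f z := hf.isSymmSndFDerivAt two_le_smooth
  have hsX : IsSymmSndFDerivAt ℝ X z := hX.isSymmSndFDerivAt two_le_smooth
  have key : ∀ a b : P, fderiv ℝ (cov G f X b) z a =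
      fderiv ℝ (fderiv ℝ X) z a b
      + (fderiv ℝ (chr G) (f z) (fderiv ℝ f z a) (fderiv ℝ f z b) (X z)
        + chr G (f z) (fderiv ℝ (fderiv ℝ f) z a b) (X z)
        + chr G (f z) (fderiv ℝ f z b) (fderiv ℝ X z a)) := by
    intro a b
    have h1 := hdX.hasFDerivAt.clm_apply (hasFDerivAt_const b z)
    have h2 := ((hc.hasFDerivAt.comp z hf1.hasFDerivAt).clm_apply
      (hd.hasFDerivAt.clm_apply (hasFDerivAt_const b z))).clm_apply hX1.hasFDerivAt
    have h3 := congrArg (fun L : P →L[ℝ] V => L a) (h1.add h2).fderiv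
    refine Eq.trans h3 ?_
    simp
    abel
  have hcov : ∀ a : P, cov G f X a z = fderiv ℝ X z a + chr G (f z) (fderiv ℝ f z a) (X z) :=
    fun _ => rfl
  have hcov2 : ∀ a b : P, cov G f (cov G f X b) a z = fderiv ℝ (cov G f X b) z a
      + chr G (f z) (fderiv ℝ f z a) (cov G f X b z) := fun _ _ => rfl
  rw [hcov2, hcov2, key, key, hcov, hcov, cur_apply, hs.eq e' e, hsX.eq e' e]
  simp only [map_add]
  abel

end IsMetricOn

/-- The curvature is invariant under isometries. -/
lemma IsIsometryOn.fderiv_cur [FiniteDimensional ℝ V] {φ : V → V}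
    {G G' : V → V →L[ℝ] V →L[ℝ] ℝ} {U U' : Set V} {y : V}
    (hφ : IsIsometryOn φ G U G' U') (hy : y ∈ U) (v w z : V) :
    fderiv ℝ φ y (cur G y v w z) =
      cur G' (φ y) (fderiv ℝ φ y v) (fderiv ℝ φ y w) (fderiv ℝ φ y z) := by
  -- The curvature is read off from the Ricci identity for the constant field z along an affine
  -- surface tangent to v and w. Its naturality then follows from that of `cov`, and third
  -- derivatives of φ never appear.
  let f : ℝ × ℝ → V := fun s => y + (s.1 • v + s.2 • w)
  have hf : ContDiff ℝ ∞ f := by fun_prop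
  have hf0 : f 0 = y := by simp [f]
  have hfU : ∀ᶠ s in 𝓝 (0 : ℝ × ℝ), f s ∈ U :=
    hf.continuous.continuousAt.preimage_mem_nhds (by
      rw [hf0]; exact hφ.metric.isOpen.mem_nhds hy)
  have hD : ∀ a : ℝ × ℝ, fderiv ℝ f 0 a = a.1 • v + a.2 • w := by
    intro a
    have h1 : HasFDerivAt f (((ContinuousLinearMap.fst ℝ ℝ ℝ).smulRight v)
        + ((ContinuousLinearMap.snd ℝ ℝ ℝ).smulRight w)) 0 := by
      refine HasFDerivAt.const_add y ?_
      exact (((ContinuousLinearMap.fst ℝ ℝ ℝ).smulRight v)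
        + ((ContinuousLinearMap.snd ℝ ℝ ℝ).smulRight w)).hasFDerivAt
    rw [h1.fderiv]; simp
  let X : ℝ × ℝ → V := fun _ => z
  have hX : ContDiff ℝ ∞ X := contDiff_const
  let f' : ℝ × ℝ → V := fun s => φ (f s)
  let X' : ℝ × ℝ → V := fun s => fderiv ℝ φ (f s) (X s)
  have hf' : ContDiffAt ℝ ∞ f' 0 := (hφ.contDiffAt (by rwa [hf0])).comp 0 hf.contDiffAt
  have hX' : ContDiffAt ℝ ∞ X' 0 :=
    (((hφ.contDiffAt (show f 0 ∈ U by rwa [hf0])).fderiv_right (m := ∞) (by simp)).comp 0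
      hf.contDiffAt).clm_apply hX.contDiffAt
  have h1 : ∀ a : ℝ × ℝ, cov G' f' X' a =ᶠ[𝓝 0] fun s => fderiv ℝ φ (f s) (cov G f X a s) := by
    intro a
    filter_upwards [hfU] with s hs using hφ.cov_comp hs
      (hf.contDiffAt.differentiableAt (by simp)) (hX.contDiffAt.differentiableAt (by simp)) a
  have h2 : ∀ a b : ℝ × ℝ, cov G' f' (cov G' f' X' a) b 0
      = fderiv ℝ φ (f 0) (cov G f (cov G f X a) b 0) := by
    intro a b
    rw [cov_congr Filter.EventuallyEq.rfl (h1 a)]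
    have hs : f 0 ∈ U := by rwa [hf0]
    exact hφ.cov_comp hs (hf.contDiffAt.differentiableAt (by simp))
      ((hφ.metric.contDiffAt_cov hs hf.contDiffAt hX.contDiffAt a).differentiableAt (by simp)) b
  have hfd : ∀ a : ℝ × ℝ, fderiv ℝ f' 0 a = fderiv ℝ φ (f 0) (fderiv ℝ f 0 a) := by
    intro a
    have h3 := (((hφ.contDiffAt (show f 0 ∈ U by rwa [hf0])).differentiableAt
      (by simp)).hasFDerivAt.comp 0 (hf.contDiffAt.differentiableAt (by simp)).hasFDerivAt).fderiv
    exact congrArg (fun L : ℝ × ℝ →L[ℝ] V => L a) h3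
  have hA := hφ.metric.cov_cov_sub (f := f) (X := X) (z := 0) (by rwa [hf0]) hf.contDiffAt
    hX.contDiffAt (1, 0) (0, 1)
  have hB := hφ.metric'.cov_cov_sub (f := f') (X := X') (z := 0)
    (hφ.mapsTo (by rwa [hf0])) hf' hX' (1, 0) (0, 1)
  rw [h2, h2, ← map_sub, hA] at hB
  simp only [hfd, hD, f', X', X, hf0] at hB
  simpa using hB

/-! ### Kähler metrics in holomorphic coordinates, where J is a constant linear map. -/

section Kaehler

variable {G : V → V →L[ℝ] V →L[ℝ] ℝ} {U : Set V} {y : V} {I : V →L[ℝ] V}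

/-- The complex structure of a Kähler manifold is parallel. -/
lemma IsMetricOn.chr_complex [FiniteDimensional ℝ V] (hG : IsMetricOn G U) (hI : ∀ v, I (I v) = -v)
    (hiso : ∀ y ∈ U, ∀ v w, G y (I v) (I w) = G y v w)
    (hclosed : ∀ y ∈ U, ∀ v₁ v₂ v₃, fderiv ℝ G y v₁ (I v₂) v₃ + fderiv ℝ G y v₂ (I v₃) v₁
      + fderiv ℝ G y v₃ (I v₁) v₂ = 0) (hy : y ∈ U) (v w : V) :
    chr G y v (I w) = I (chr G y v w) := by
  have hskew : ∀ a b, G y (I a) b = - G y a (I b) := by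
    intro a b
    rw [← hiso y hy a (I b), hI, map_neg, neg_neg]
  have hdiso : ∀ x a b, fderiv ℝ G y x (I a) b = - fderiv ℝ G y x a (I b) := by
    intro x a b
    have hd : DifferentiableAt ℝ G y := (hG.contDiffAt hy).differentiableAt (by simp)
    have key : ∀ a b : V, HasFDerivAt (fun y' => G y' a b) _ y := fun a b =>
      (hd.hasFDerivAt.clm_apply (hasFDerivAt_const a y)).clm_apply (hasFDerivAt_const b y)
    have he : (fun y' => G y' (I a) b) =ᶠ[𝓝 y] fun y' => - G y' a (I b) := by
      filter_upwards [hG.isOpen.mem_nhds hy] with y' hy'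
      rw [← hiso y' hy' a (I b), hI, map_neg, neg_neg]
    have h := congrArg (fun L : V →L[ℝ] ℝ => L x)
      ((key (I a) b).unique ((key a (I b)).neg.congr_of_eventuallyEq he))
    simpa using h
  refine hG.eq_of_forall hy fun z => ?_
  -- Closedness is used on (v, w, z) and on (v, Jw, Jz). Their combination is the classical
  -- expression of ⟨(∇_v J)w, z⟩ through dω; no Nijenhuis term occurs because J is constant in these
  -- coordinates.
  have c1 := hclosed y hy v w z
  have c2 := hclosed y hy v (I w) (I z)
  have s := hG.fderiv_symm hy
  rw [hskew, hG.metric_chr hy, hG.metric_chr hy, chrFirst_apply, chrFirst_apply]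
  simp only [hI, map_neg, neg_apply] at c2
  have d1 := hdiso v w z
  have e1 := s z v (I w)
  have e2 := hdiso z v w
  have e3 := s w v (I z)
  have e4 := hdiso w z v
  have e5 := s (I w) v z
  have e6 := hdiso (I z) v (I w)
  rw [hI, map_neg] at e6
  have e7 := s (I z) v w
  linarith

lemma IsMetricOn.cur_complex [FiniteDimensional ℝ V] (hG : IsMetricOn G U)
    (hch : ∀ y ∈ U, ∀ v w, chr G y v (I w) = I (chr G y v w)) (hy : y ∈ U) (u v w : V) :
    cur G y u v (I w) = I (cur G y u v w) := by
  have hd : DifferentiableAt ℝ (chr G) y := (hG.contDiffAt_chr hy).differentiableAt (by simp)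
  have key : ∀ a b, fderiv ℝ (chr G) y a b (I w) = I (fderiv ℝ (chr G) y a b w) := by
    intro a b
    have hk : ∀ c : V, HasFDerivAt (fun y' => chr G y' b c) _ y := fun c =>
      (hd.hasFDerivAt.clm_apply (hasFDerivAt_const b y)).clm_apply (hasFDerivAt_const c y)
    have he : (fun y' => chr G y' b (I w)) =ᶠ[𝓝 y] fun y' => I (chr G y' b w) := by
      filter_upwards [hG.isOpen.mem_nhds hy] with y' hy' using hch y' hy' b w
    have h := congrArg (fun L : V →L[ℝ] V => L a)
      ((hk (I w)).unique ((I.hasFDerivAt.comp y (hk w)).congr_of_eventuallyEq he))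
    simpa using h
  simp only [cur_apply, key, hch y hy, map_add, map_sub]

lemma IsMetricOn.cov_complex (hch : ∀ y ∈ U, ∀ v w, chr G y v (I w) = I (chr G y v w))
    {f X : P → V} {z : P}
    (hz : f z ∈ U) (hX : DifferentiableAt ℝ X z) (e : P) :
    cov G f (fun z => I (X z)) e z = I (cov G f X e z) := by
  have : fderiv ℝ (fun z => I (X z)) z e = I (fderiv ℝ X z e) := by
    have := (I.hasFDerivAt.comp z hX.hasFDerivAt).fderiv
    exact congrArg (fun L : P →L[ℝ] V => L e) this
  rw [cov, cov, this, hch _ hz, map_add]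

end Kaehler

/-- Covariant derivatives of the curvature of a locally symmetric space. -/
lemma IsMetricOn.cov_cur [FiniteDimensional ℝ V] {G : V → V →L[ℝ] V →L[ℝ] ℝ} {U : Set V}
    (hG : IsMetricOn G U)
    (hpar : ∀ y ∈ U, ∀ x v w z, fderiv ℝ (cur G) y x v w z + chr G y x (cur G y v w z)
      - cur G y (chr G y x v) w z - cur G y v (chr G y x w) z - cur G y v w (chr G y x z) = 0)
    {f X Y Z : P → V} {z : P} (hz : f z ∈ U) (hf : DifferentiableAt ℝ f z)
    (hX : DifferentiableAt ℝ X z) (hY : DifferentiableAt ℝ Y z) (hZ : DifferentiableAt ℝ Z z)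
    (e : P) :
    cov G f (fun z => cur G (f z) (X z) (Y z) (Z z)) e z =
      cur G (f z) (cov G f X e z) (Y z) (Z z) + cur G (f z) (X z) (cov G f Y e z) (Z z)
        + cur G (f z) (X z) (Y z) (cov G f Z e z) := by
  have hR : DifferentiableAt ℝ (cur G) (f z) := (hG.contDiffAt_cur hz).differentiableAt (by simp)
  have h1 := (((hR.hasFDerivAt.comp z hf.hasFDerivAt).clm_apply hX.hasFDerivAt).clm_apply
    hY.hasFDerivAt).clm_apply hZ.hasFDerivAt
  have h2 : fderiv ℝ (fun z => cur G (f z) (X z) (Y z) (Z z)) z e =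
      fderiv ℝ (cur G) (f z) (fderiv ℝ f z e) (X z) (Y z) (Z z)
      + cur G (f z) (fderiv ℝ X z e) (Y z) (Z z) + cur G (f z) (X z) (fderiv ℝ Y z e) (Z z)
      + cur G (f z) (X z) (Y z) (fderiv ℝ Z z e) := by
    refine Eq.trans (congrArg (fun L : P →L[ℝ] V => L e) h1.fderiv) ?_
    simp
    abel
  have h3 := hpar _ hz (fderiv ℝ f z e) (X z) (Y z) (Z z)
  have h4 : fderiv ℝ (cur G) (f z) (fderiv ℝ f z e) (X z) (Y z) (Z z) =
      cur G (f z) (chr G (f z) (fderiv ℝ f z e) (X z)) (Y z) (Z z)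
      + cur G (f z) (X z) (chr G (f z) (fderiv ℝ f z e) (Y z)) (Z z)
      + cur G (f z) (X z) (Y z) (chr G (f z) (fderiv ℝ f z e) (Z z))
      - chr G (f z) (fderiv ℝ f z e) (cur G (f z) (X z) (Y z) (Z z)) := by
    rw [← sub_eq_zero, ← h3]; abel
  simp only [cov]
  rw [h2, h4]
  simp only [map_add, add_apply]
  abel

end LocalFields

/-! ### From coordinates to the manifold: transition maps are holomorphic isometries. -/

section Charts

variable (E : Type*) [NormedAddCommGroup E] [NormedSpace ℂ E]
variable {N : Type*} [TopologicalSpace N] [ChartedSpace E N]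

/-- The preferred real chart at `p`. -/
abbrev rchart (p : N) : PartialEquiv N E := extChartAt 𝓘(ℝ, E) p

/-- The derivative of the chart at `p`, as a map from the tangent space at `q`. -/
def chartDeriv (p q : N) : E →L[ℝ] E :=
  (mfderiv 𝓘(ℝ, E) 𝓘(ℝ, E) (rchart E p) q :)

/-- `coordVector` as a map between model spaces. -/
def coordVec (p : N) (y : E) : E →L[ℝ] E := coordVector p y

/-- The metric on the model space given by the tangent space at `q`. -/
def metricAt {E : Type*} [NormedAddCommGroup E] [NormedSpace ℂ E] [ChartedSpace E N]
    [IsManifold 𝓘(ℂ, E) ω N] (h : Metric E N) (q : N) : E →L[ℝ] E →L[ℝ] ℝ := h.inner q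

/-- The coordinate change from the chart at `p` to the chart at `p'`. -/
def transition (p p' : N) (y : E) : E := rchart E p' ((rchart E p).symm y)

/-- The domain of the coordinate change. -/
def overlap (p p' : N) : Set E := (rchart E p).target ∩ (rchart E p).symm ⁻¹' (rchart E p').source

variable {E}

lemma isOpen_overlap (p p' : N) : IsOpen (overlap E p p') :=
  (continuousOn_extChartAt_symm p).isOpen_inter_preimage (isOpen_extChartAt_target p)
    (isOpen_extChartAt_source p')

lemma rchart_mem_overlap {p p' q : N} (h : q ∈ (rchart E p).source)
    (h' : q ∈ (rchart E p').source) : rchart E p q ∈ overlap E p p' :=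
  ⟨(rchart E p).map_source h, by rw [mem_preimage, (rchart E p).left_inv h]; exact h'⟩

lemma transition_rchart {p p' q : N} (h : q ∈ (rchart E p).source) :
    transition E p p' (rchart E p q) = rchart E p' q := by
  rw [transition, (rchart E p).left_inv h]

lemma mapsTo_transition (p p' : N) : MapsTo (transition E p p') (overlap E p p')
    (rchart E p').target := fun _ hy => (rchart E p').map_source hy.2

variable [IsManifold 𝓘(ℂ, E) ω N]

lemma contDiffOn_transition (p p' : N) :
    ContDiffOn ℝ ∞ (transition E p p') (overlap E p p') := by
  have h := contDiffOn_ext_coord_change (I := 𝓘(ℝ, E)) (n := ∞) p' p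
  rw [PartialEquiv.trans_source, PartialEquiv.symm_source] at h
  exact h

lemma mdifferentiableAt_rchart {p q : N} (h : q ∈ (rchart E p).source) :
    MDifferentiableAt 𝓘(ℝ, E) 𝓘(ℝ, E) (rchart E p) q :=
  mdifferentiableAt_extChartAt (by rwa [← extChartAt_source 𝓘(ℝ, E)])

lemma chartDeriv_eq_transition {p p' q : N} (h : q ∈ (rchart E p).source)
    (h' : q ∈ (rchart E p').source) (v : E) :
    chartDeriv E p' q v = fderiv ℝ (transition E p p') (rchart E p q) (chartDeriv E p q v) := by
  have hd : DifferentiableAt ℝ (transition E p p') (rchart E p q) :=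
    ((contDiffOn_transition p p').contDiffAt
      ((isOpen_overlap p p').mem_nhds (rchart_mem_overlap h h'))).differentiableAt (by simp)
  have h1 : HasMFDerivAt 𝓘(ℝ, E) 𝓘(ℝ, E) (transition E p p' ∘ rchart E p) q
      ((fderiv ℝ (transition E p p') (rchart E p q)).comp (chartDeriv E p q)) :=
    hd.hasFDerivAt.hasMFDerivAt.comp q (mdifferentiableAt_rchart h).hasMFDerivAt
  have h2 : rchart E p' =ᶠ[𝓝 q] transition E p p' ∘ rchart E p := by
    filter_upwards [(isOpen_extChartAt_source (I := 𝓘(ℝ, E)) p).mem_nhds h] with q' hq'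
    exact (transition_rchart hq').symm
  have h3 := (h1.congr_of_eventuallyEq h2).mfderiv
  exact congrArg (fun L : E →L[ℝ] E => L v) h3

/-- The tangent space at p is the model space read through the preferred chart at p, so a vector
coincides with its components in that chart. -/
lemma chartDeriv_self (p : N) (v : E) : chartDeriv E p p v = v := by
  have h := mfderiv_chartAt_eq_tangentCoordChange (I := 𝓘(ℝ, E)) (x := p) (y := p)
    (mem_chart_source E p)
  have h1 : chartDeriv E p p = tangentCoordChange 𝓘(ℝ, E) p p p := h
  rw [h1]
  exact tangentCoordChange_self (mem_extChartAt_source p)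

lemma fderiv_transition_chartDeriv {p q : N} (h : q ∈ (rchart E p).source) (v : E) :
    fderiv ℝ (transition E p q) (rchart E p q) (chartDeriv E p q v) = v := by
  rw [← chartDeriv_eq_transition h (mem_extChartAt_source q), chartDeriv_self]

lemma chartDeriv_eq_fderiv {p q : N} (h : q ∈ (rchart E p).source) (v : E) :
    chartDeriv E p q v = fderiv ℝ (transition E q p) (rchart E q q) v := by
  rw [chartDeriv_eq_transition (mem_extChartAt_source q) h, chartDeriv_self]

lemma chartDeriv_injective {p q : N} (h : q ∈ (rchart E p).source) :
    Function.Injective (chartDeriv E p q) := fun v w hvw => by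
  rw [← fderiv_transition_chartDeriv h v, hvw, fderiv_transition_chartDeriv h]

lemma chartDeriv_surjective {p q : N} (h : q ∈ (rchart E p).source) :
    Function.Surjective (chartDeriv E p q) := fun v => by
  refine ⟨fderiv ℝ (transition E p q) (rchart E p q) v, ?_⟩
  have hq := mem_extChartAt_source (I := 𝓘(ℝ, E)) q
  have hd : HasFDerivAt (transition E p q) _ (rchart E p q) :=
    (((contDiffOn_transition p q).contDiffAt
      ((isOpen_overlap p q).mem_nhds (rchart_mem_overlap h hq))).differentiableAt
        (by simp)).hasFDerivAt
  have hd' : HasFDerivAt (transition E q p) _ (transition E p q (rchart E p q)) :=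
    (((contDiffOn_transition q p).contDiffAt
      ((isOpen_overlap q p).mem_nhds (by
        rw [transition_rchart h]; exact rchart_mem_overlap hq h))).differentiableAt
        (by simp)).hasFDerivAt
  have h1 := hd'.comp _ hd
  have h2 : transition E q p ∘ transition E p q =ᶠ[𝓝 (rchart E p q)] id := by
    filter_upwards [(isOpen_overlap p q).mem_nhds (rchart_mem_overlap h hq)] with y hy
    simp only [Function.comp, transition, id]
    rw [(rchart E q).left_inv hy.2, (rchart E p).right_inv hy.1]
  have h3 := h1.unique ((hasFDerivAt_id _).congr_of_eventuallyEq h2)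
  rw [chartDeriv_eq_fderiv h]
  have h4 := congrArg (fun L : E →L[ℝ] E => L v) h3
  rwa [transition_rchart h] at h4

/-- Coordinate changes of a complex manifold are holomorphic. -/
lemma fderiv_transition_I {p p' : N} {y : E} (hy : y ∈ overlap E p p') (v : E) :
    fderiv ℝ (transition E p p') y (Complex.I • v)
      = Complex.I • fderiv ℝ (transition E p p') y v := by
  have h := contDiffOn_ext_coord_change (I := 𝓘(ℂ, E)) (n := ω) p' p
  rw [PartialEquiv.trans_source, PartialEquiv.symm_source] at h
  have h' : ContDiffOn ℂ ω (transition E p p') (overlap E p p') := h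
  have hd : DifferentiableAt ℂ (transition E p p') y :=
    (h'.contDiffAt ((isOpen_overlap p p').mem_nhds hy)).differentiableAt (by simp)
  have h2 := (hd.hasFDerivAt.restrictScalars ℝ).fderiv
  rw [h2]
  simp

lemma chartDeriv_I {p q : N} (h : q ∈ (rchart E p).source) (v : E) :
    chartDeriv E p q (Complex.I • v) = Complex.I • chartDeriv E p q v := by
  rw [chartDeriv_eq_fderiv h, chartDeriv_eq_fderiv h,
    fderiv_transition_I (rchart_mem_overlap (mem_extChartAt_source q) h)]

lemma chartDeriv_coordVec {p : N} {y : E} (hy : y ∈ (rchart E p).target) (v : E) :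
    chartDeriv E p ((rchart E p).symm y) (coordVec E p y v) = v := by
  have h := mfderiv_extChartAt_comp_mfderivWithin_extChartAt_symm (I := 𝓘(ℝ, E)) hy
  have h2 := congrArg (fun L : E →L[ℝ] E => L v) h
  rw [modelWithCornersSelf_coe, range_id, mfderivWithin_univ] at h2
  exact h2

lemma metricCoeff_eq_inner (h : Metric E N) {p : N} {y : E} (v w : E) :
    metricCoeff h p y v w
      = metricAt h ((rchart E p).symm y) (coordVec E p y v) (coordVec E p y w) :=
  rfl

/-- The metric in terms of its coefficients. -/
lemma inner_eq_metricCoeff (h : Metric E N) {p q : N} (hq : q ∈ (rchart E p).source) (v w : E) :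
    metricAt h q v w
      = metricCoeff h p (rchart E p q) (chartDeriv E p q v) (chartDeriv E p q w) := by
  have key : ∀ y ∈ (rchart E p).target, ∀ v w : E, metricAt h ((rchart E p).symm y) v w =
      metricCoeff h p y (chartDeriv E p ((rchart E p).symm y) v)
        (chartDeriv E p ((rchart E p).symm y) w) := by
    intro y hy v w
    have hinj := chartDeriv_injective (p := p) ((rchart E p).map_target hy)
    have e1 : ∀ v : E, coordVec E p y (chartDeriv E p ((rchart E p).symm y) v) = v := by
      intro v
      exact hinj (chartDeriv_coordVec hy _)
    rw [metricCoeff_eq_inner, e1, e1]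
  have h1 := key _ ((rchart E p).map_source hq) v w
  rwa [(rchart E p).left_inv hq] at h1

lemma christoffel_eq_chr (h : Metric E N) (p : N) (y v w : E) :
    christoffel h p y v w = chr (metricCoeff h p) y v w := rfl

/-- Multiplication by `i` as a real linear map. -/
def mulI (E : Type*) [NormedAddCommGroup E] [NormedSpace ℂ E] : E →L[ℝ] E :=
  ((Complex.I : ℂ) • ContinuousLinearMap.id ℂ E).restrictScalars ℝ

@[simp] lemma mulI_apply (v : E) : mulI E v = Complex.I • v := rfl

lemma mulI_mulI (v : E) : mulI E (mulI E v) = -v := by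
  simp [smul_smul]

variable [FiniteDimensional ℂ E]

/-- In finite dimension it is enough to evaluate on constant v, w. The coordinate fields are the
tangent map of the inverse chart applied to constant fields, hence smooth sections, and h is a
smooth section of the bundle of bilinear forms. -/
lemma contDiffOn_metricCoeff (h : Metric E N) (p : N) :
    ContDiffOn ℝ ∞ (metricCoeff h p) (rchart E p).target := by
  have : FiniteDimensional ℝ E := FiniteDimensional.complexToReal E
  have hU : IsOpen (rchart E p).target := isOpen_extChartAt_target p
  have hfield : ∀ v : E, ∀ y ∈ (rchart E p).target, ContMDiffAt 𝓘(ℝ, E) 𝓘(ℝ, E).tangent ∞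
      (fun y : E => (Bundle.TotalSpace.mk' E ((rchart E p).symm y) (coordVector p y v) :
        TangentBundle 𝓘(ℝ, E) N)) y := by
    intro v y hy
    have h1 := (contMDiffOn_extChartAt_symm (I := 𝓘(ℝ, E)) (n := ∞) p).contMDiffOn_tangentMapWithin
      (m := ∞) (by simp) hU.uniqueMDiffOn
    have h2 : ContMDiffAt 𝓘(ℝ, E) 𝓘(ℝ, E).tangent ∞
        (fun y : E => (Bundle.TotalSpace.mk' E y v : TangentBundle 𝓘(ℝ, E) E)) y :=
      contMDiffAt_vectorSpace_iff_contDiffAt.2 contDiffAt_const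
    have h3 : ContMDiffAt 𝓘(ℝ, E) 𝓘(ℝ, E).tangent ∞
        (fun y : E => tangentMapWithin 𝓘(ℝ, E) 𝓘(ℝ, E) (rchart E p).symm (rchart E p).target
          (Bundle.TotalSpace.mk' E y v : TangentBundle 𝓘(ℝ, E) E)) y := by
      have := (h1 (Bundle.TotalSpace.mk' E y v : TangentBundle 𝓘(ℝ, E) E) hy).comp y
        h2.contMDiffWithinAt (s := (rchart E p).target) (fun y' hy' => hy')
      exact this.contMDiffAt (hU.mem_nhds hy)
    refine h3.congr_of_eventuallyEq ?_
    filter_upwards [hU.mem_nhds hy] with y' hy'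
    simp only [tangentMapWithin, coordVector]
    rw [mfderivWithin_of_isOpen hU hy']
    rfl
  rw [contDiffOn_clm_apply]
  intro v
  rw [contDiffOn_clm_apply]
  intro w y hy
  have h4 : ContMDiffAt 𝓘(ℝ, E) (𝓘(ℝ, E).prod 𝓘(ℝ, ℝ)) ∞
      (fun y ↦ Bundle.TotalSpace.mk' ℝ (E := Bundle.Trivial N ℝ) ((rchart E p).symm y)
        (h.inner ((rchart E p).symm y) (coordVector p y v) (coordVector p y w))) y := by
    apply ContMDiffAt.clm_bundle_apply₂ (F₁ := E) (F₂ := E)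
    · exact h.contMDiff.contMDiffAt.comp y ((contMDiffOn_extChartAt_symm (I := 𝓘(ℝ, E)) (n := ∞)
        p).contMDiffAt (hU.mem_nhds hy))
    · exact hfield v y hy
    · exact hfield w y hy
  rw [Bundle.contMDiffAt_totalSpace] at h4
  have h5 : ContMDiffAt 𝓘(ℝ, E) 𝓘(ℝ, ℝ) ∞ (fun y => metricCoeff h p y v w) y := h4.2
  exact h5.contDiffAt.contDiffWithinAt

lemma isMetricOn_metricCoeff (h : Metric E N) (p : N) :
    IsMetricOn (metricCoeff h p) (rchart E p).target where
  isOpen := isOpen_extChartAt_target p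
  contDiffOn := contDiffOn_metricCoeff h p
  symm y _ v w := by
    rw [metricCoeff_eq_inner, metricCoeff_eq_inner]
    exact h.symm _ _ _
  pos y hy v hv := by
    rw [metricCoeff_eq_inner]
    refine h.pos _ _ fun h0 => hv ?_
    rw [← chartDeriv_coordVec hy v]
    have : coordVec E p y v = 0 := h0
    rw [this, map_zero]

lemma isMetricOn_metricCoeff_overlap (h : Metric E N) (p p' : N) :
    IsMetricOn (metricCoeff h p) (overlap E p p') where
  isOpen := isOpen_overlap p p'
  contDiffOn := (contDiffOn_metricCoeff h p).mono inter_subset_left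
  symm y hy := (isMetricOn_metricCoeff h p).symm y hy.1
  pos y hy := (isMetricOn_metricCoeff h p).pos y hy.1

/-- Through this lemma the naturality results above make connection and curvature independent of the
chart. -/
lemma isIsometryOn_transition (h : Metric E N) (p p' : N) :
    IsIsometryOn (transition E p p') (metricCoeff h p) (overlap E p p')
      (metricCoeff h p') (rchart E p').target where
  metric := isMetricOn_metricCoeff_overlap h p p'
  metric' := isMetricOn_metricCoeff h p'
  contDiffOn := contDiffOn_transition p p'
  mapsTo := mapsTo_transition p p'
  isometry y hy v w := by
    obtain ⟨hy1, hy2⟩ := hy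
    have hs := (rchart E p).map_target hy1
    have key : ∀ v : E, fderiv ℝ (transition E p p') y v =
        chartDeriv E p' ((rchart E p).symm y) (coordVec E p y v) := by
      intro v
      rw [chartDeriv_eq_transition hs hy2, (rchart E p).right_inv hy1, chartDeriv_coordVec hy1]
    rw [metricCoeff_eq_inner, key, key]
    exact inner_eq_metricCoeff h hy2 _ _
  surjective y hy v := by
    obtain ⟨hy1, hy2⟩ := hy
    have hs := (rchart E p).map_target hy1
    obtain ⟨w, rfl⟩ := chartDeriv_surjective (E := E) hy2 v
    refine ⟨chartDeriv E p ((rchart E p).symm y) w, ?_⟩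
    rw [chartDeriv_eq_transition hs hy2, (rchart E p).right_inv hy1]

/-- One side differentiates the symbols after the vectors are inserted, the other differentiates the
operator-valued symbols. They agree where the symbols are differentiable. -/
lemma curvatureCoeff_eq_cur (h : Metric E N) (p : N) {y : E} (hy : y ∈ (rchart E p).target)
    (v w z : E) : curvatureCoeff h p y v w z = cur (metricCoeff h p) y v w z := by
  have : FiniteDimensional ℝ E := FiniteDimensional.complexToReal E
  have hd : DifferentiableAt ℝ (chr (metricCoeff h p)) y :=
    ((isMetricOn_metricCoeff h p).contDiffAt_chr hy).differentiableAt (by simp)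
  have key : ∀ x a b : E, fderiv ℝ (fun y' => christoffel h p y' a b) y x
      = fderiv ℝ (chr (metricCoeff h p)) y x a b := by
    intro x a b
    have h1 := ((hd.hasFDerivAt.clm_apply (hasFDerivAt_const a y)).clm_apply
      (hasFDerivAt_const b y)).fderiv
    refine (congrArg (fun L : E →L[ℝ] E => L x) h1).trans ?_
    simp
  rw [curvatureCoeff, key, key, cur_apply]
  simp only [christoffel_eq_chr]
  abel

/-- `curvature` is computed in the preferred chart of its base point, which varies from point to
point. Tensoriality allows one fixed chart near a point, as differentiation requires. -/
lemma chartDeriv_curvature (h : Metric E N) {p q : N} (hq : q ∈ (rchart E p).source) (v w z : E) :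
    chartDeriv E p q (curvature (q := q) h v w z) = cur (metricCoeff h p) (rchart E p q)
      (chartDeriv E p q v) (chartDeriv E p q w) (chartDeriv E p q z) := by
  have : FiniteDimensional ℝ E := FiniteDimensional.complexToReal E
  have hqq := mem_extChartAt_source (I := 𝓘(ℝ, E)) q
  have h1 := (isIsometryOn_transition h q p).fderiv_cur (rchart_mem_overlap hqq hq) v w z
  rw [transition_rchart hqq] at h1
  simp only [← chartDeriv_eq_fderiv hq] at h1
  rw [← h1]
  exact congrArg _ (curvatureCoeff_eq_cur h q ((rchart E q).map_source hqq) v w z)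

lemma metricCoeff_I {h : Metric E N} (hK : IsKahler h) {p : N} {y : E}
    (hy : y ∈ (rchart E p).target) (v w : E) :
    metricCoeff h p y (Complex.I • v) (Complex.I • w) = metricCoeff h p y v w := by
  have key : ∀ v : E, coordVec E p y (Complex.I • v) = Complex.I • coordVec E p y v := by
    intro v
    have hs := (rchart E p).map_target hy
    refine chartDeriv_injective (p := p) hs ?_
    rw [chartDeriv_coordVec hy, chartDeriv_I hs, chartDeriv_coordVec hy]
  rw [metricCoeff_eq_inner, metricCoeff_eq_inner, key, key]
  exact hK.isometry_J _ _ _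

lemma chr_I {h : Metric E N} (hK : IsKahler h) {p : N} : ∀ y ∈ (rchart E p).target, ∀ v w : E,
    chr (metricCoeff h p) y v (mulI E w) = mulI E (chr (metricCoeff h p) y v w) := by
  have : FiniteDimensional ℝ E := FiniteDimensional.complexToReal E
  intro y hy v w
  have hG := isMetricOn_metricCoeff h p
  refine hG.chr_complex mulI_mulI (fun y hy v w => metricCoeff_I hK hy v w) ?_ hy v w
  intro y hy v₁ v₂ v₃
  have hd : DifferentiableAt ℝ (metricCoeff h p) y :=
    (hG.contDiffAt hy).differentiableAt (by simp)
  have key : ∀ x a b : E, fderiv ℝ (fun y' => fundamentalFormCoeff h p y' a b) y x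
      = fderiv ℝ (metricCoeff h p) y x (Complex.I • a) b := by
    intro x a b
    have h1 := ((hd.hasFDerivAt.clm_apply (hasFDerivAt_const (Complex.I • a) y)).clm_apply
      (hasFDerivAt_const b y)).fderiv
    refine (congrArg (fun L : E →L[ℝ] ℝ => L x) h1).trans ?_
    simp
  have h2 := hK.closed p y hy v₁ v₂ v₃
  rw [key, key, key] at h2
  exact h2

lemma cur_parallel {h : Metric E N} (hN : IsLocallyHermitianSymmetric h) (p : N) :
    ∀ y ∈ (rchart E p).target, ∀ x v w z : E,
      fderiv ℝ (cur (metricCoeff h p)) y x v w z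
      + chr (metricCoeff h p) y x (cur (metricCoeff h p) y v w z)
      - cur (metricCoeff h p) y (chr (metricCoeff h p) y x v) w z
      - cur (metricCoeff h p) y v (chr (metricCoeff h p) y x w) z
      - cur (metricCoeff h p) y v w (chr (metricCoeff h p) y x z) = 0 := by
  have : FiniteDimensional ℝ E := FiniteDimensional.complexToReal E
  intro y hy x v w z
  have hG := isMetricOn_metricCoeff h p
  have hd : DifferentiableAt ℝ (cur (metricCoeff h p)) y :=
    (hG.contDiffAt_cur hy).differentiableAt (by simp)
  have key : fderiv ℝ (fun y' => curvatureCoeff h p y' v w z) y x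
      = fderiv ℝ (cur (metricCoeff h p)) y x v w z := by
    have he : (fun y' => curvatureCoeff h p y' v w z) =ᶠ[𝓝 y]
        fun y' => cur (metricCoeff h p) y' v w z := by
      filter_upwards [hG.isOpen.mem_nhds hy] with y' hy' using curvatureCoeff_eq_cur h p hy' v w z
    have h1 := (((hd.hasFDerivAt.clm_apply (hasFDerivAt_const v y)).clm_apply
      (hasFDerivAt_const w y)).clm_apply (hasFDerivAt_const z y)).fderiv
    rw [he.fderiv_eq]
    refine (congrArg (fun L : E →L[ℝ] E => L x) h1).trans ?_
    simp
  have h2 := hN.parallel_curvature p y hy x v w z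
  rw [covDerivCurvatureCoeff, key] at h2
  simpa only [curvatureCoeff_eq_cur h p hy, christoffel_eq_chr] using h2

end Charts

/-! ### Parallel transport along short segments and the local constancy of curvature bounds. -/

section CurvatureBound

variable {V : Type*} [NormedAddCommGroup V] [NormedSpace ℝ V] [FiniteDimensional ℝ V]
variable {G : V → V →L[ℝ] V →L[ℝ] ℝ} {U : Set V} {y : V}

/-- The curvature of `G` at `y` is bounded by `√c`. -/
def CurvatureBoundAt (G : V → V →L[ℝ] V →L[ℝ] ℝ) (c : ℝ) (y : V) : Prop :=
  ∀ v w z, G y (cur G y v w z) (cur G y v w z) ≤ c * (G y v v * G y w w * G y z z)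

/-- Existence of parallel vector fields along short segments. -/
lemma IsMetricOn.exists_parallel (hG : IsMetricOn G U) (hy : y ∈ U) :
    ∃ ε > 0, Metric.ball y ε ⊆ U ∧ ∀ y₁ ∈ Metric.ball y ε, ∀ y₂ ∈ Metric.ball y ε, ∀ a : V,
      ∃ X : ℝ → V, X 0 = a ∧ ContinuousOn X (Icc 0 1) ∧ ∀ t ∈ Ioo (0 : ℝ) 1,
        HasDerivAt X (-(chr G (y₁ + t • (y₂ - y₁)) (y₂ - y₁) (X t))) t := by
  have hc : ContinuousAt (chr G) y := (hG.contDiffAt_chr hy).continuousAt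
  set C : ℝ := ‖chr G y‖ + 1 with hCdef
  have hC : 0 < C := by positivity
  have h1 : ∀ᶠ y' in 𝓝 y, ‖chr G y'‖ < C := hc.norm.eventually (gt_mem_nhds (by simp [hCdef]))
  obtain ⟨r, hr, hrU⟩ := Metric.mem_nhds_iff.1 (Filter.inter_mem (hG.isOpen.mem_nhds hy) h1)
  -- Two points of this ball are at distance at most 1/(2C), so the operator Γ(y₂ − y₁) of the
  -- transport equation has norm at most 1/2 along the segment.
  refine ⟨min r (1 / (4 * C)), lt_min hr (by positivity),
    (Metric.ball_subset_ball (min_le_left _ _)).trans (hrU.trans inter_subset_left), ?_⟩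
  intro y₁ hy₁ y₂ hy₂ a
  have hseg : ∀ t ∈ Icc (0 : ℝ) 1, y₁ + t • (y₂ - y₁) ∈ Metric.ball y r := by
    intro t ht
    exact (convex_ball y r).add_smul_sub_mem (Metric.ball_subset_ball (min_le_left _ _) hy₁)
      (Metric.ball_subset_ball (min_le_left _ _) hy₂) ht
  have hd : ‖y₂ - y₁‖ ≤ 1 / (2 * C) := by
    have e1 : dist y₂ y < 1 / (4 * C) := lt_of_lt_of_le hy₂ (min_le_right _ _)
    have e2 : dist y₁ y < 1 / (4 * C) := lt_of_lt_of_le hy₁ (min_le_right _ _)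
    rw [← dist_eq_norm]
    have e3 := dist_triangle_right y₂ y₁ y
    have e4 : 1 / (2 * C) = 1 / (4 * C) + 1 / (4 * C) := by field_simp; norm_num
    linarith
  have hop : ∀ t ∈ Icc (0 : ℝ) 1, ‖chr G (y₁ + t • (y₂ - y₁)) (y₂ - y₁)‖ ≤ 1 / 2 := by
    intro t ht
    have e1 : ‖chr G (y₁ + t • (y₂ - y₁))‖ < C := (hrU (hseg t ht)).2
    calc _ ≤ ‖chr G (y₁ + t • (y₂ - y₁))‖ * ‖y₂ - y₁‖ := ContinuousLinearMap.le_opNorm _ _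
      _ ≤ C * (1 / (2 * C)) := by gcongr
      _ = 1 / 2 := by field_simp
  -- On the ball of radius ‖a‖ about a, vectors have norm at most 2‖a‖ and the speed is at most ½ ·
  -- 2‖a‖ = ‖a‖. The solution therefore stays in the ball for the whole unit of time.
  have hPL : IsPicardLindelof (fun t x => -(chr G (y₁ + t • (y₂ - y₁)) (y₂ - y₁) x))
      (tmin := 0) (tmax := 1) ⟨0, by simp⟩ a ‖a‖₊ 0 ‖a‖₊ (1 / 2) := by
    refine ⟨?_, ?_, ?_, ?_⟩
    · intro t ht
      refine LipschitzOnWith.of_dist_le_mul fun x _ x' _ => ?_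
      rw [dist_eq_norm, dist_eq_norm, neg_sub_neg, ← map_sub, norm_sub_rev x x']
      refine (ContinuousLinearMap.le_opNorm _ _).trans ?_
      have := hop t ht
      gcongr
      simpa using this
    · intro x _ t ht
      have e1 : ContinuousAt (chr G) (y₁ + t • (y₂ - y₁)) :=
        (hG.contDiffAt_chr (hrU (hseg t ht)).1).continuousAt
      have e2 : ContinuousAt (fun t : ℝ => y₁ + t • (y₂ - y₁)) t := by fun_prop
      have e3 : ContinuousAt (fun t : ℝ => chr G (y₁ + t • (y₂ - y₁))) t :=
        ContinuousAt.comp (f := fun t : ℝ => y₁ + t • (y₂ - y₁)) e1 e2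
      exact ((e3.clm_apply continuousAt_const).clm_apply
        continuousAt_const).neg.continuousWithinAt
    · intro t ht x hx
      rw [norm_neg]
      refine (ContinuousLinearMap.le_opNorm _ _).trans ?_
      have e1 := hop t ht
      have e2 : ‖x‖ ≤ 2 * ‖a‖ := by
        have e3 : ‖x - a‖ ≤ ‖a‖ := by simpa [dist_eq_norm] using hx
        have e4 := norm_add_le (x - a) a
        rw [sub_add_cancel] at e4
        linarith
      calc _ ≤ 1 / 2 * (2 * ‖a‖) := by gcongr
        _ = _ := by simp
    · simp
  obtain ⟨X, hX0, hX⟩ := hPL.exists_eq_forall_mem_Icc_hasDerivWithinAt₀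
  exact ⟨X, hX0, fun t ht => (hX t ht).continuousWithinAt, fun t ht =>
    (hX t (Ioo_subset_Icc_self ht)).hasDerivAt (Icc_mem_nhds ht.1 ht.2)⟩

lemma eq_endpoints_of_deriv_eq_zero {F : ℝ → ℝ} (hF : ContinuousOn F (Icc 0 1))
    (hd : ∀ t ∈ Ioo (0 : ℝ) 1, DifferentiableAt ℝ F t) (h0 : ∀ t ∈ Ioo (0 : ℝ) 1, deriv F t = 0) :
    F 1 = F 0 := by
  obtain ⟨c, hc, h⟩ := exists_deriv_eq_slope F one_pos hF
    (fun t ht => (hd t ht).differentiableWithinAt)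
  rw [h0 c hc] at h
  linarith [show F 1 - F 0 = 0 by simpa using h.symm]

/-- In a locally symmetric space the bound on the curvature does not change locally. -/
lemma IsMetricOn.exists_curvatureBoundAt_of (hG : IsMetricOn G U)
    (hpar : ∀ y ∈ U, ∀ x v w z, fderiv ℝ (cur G) y x v w z + chr G y x (cur G y v w z)
      - cur G y (chr G y x v) w z - cur G y v (chr G y x w) z - cur G y v w (chr G y x z) = 0)
    (hy : y ∈ U) : ∃ ε > 0, Metric.ball y ε ⊆ U ∧ ∀ y₁ ∈ Metric.ball y ε,
      ∀ y₂ ∈ Metric.ball y ε, ∀ c, CurvatureBoundAt G c y₂ → CurvatureBoundAt G c y₁ := by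
  obtain ⟨ε, hε, hεU, hpt⟩ := hG.exists_parallel hy
  refine ⟨ε, hε, hεU, fun y₁ hy₁ y₂ hy₂ c hc v w z => ?_⟩
  obtain ⟨X, hX0, hXc, hX⟩ := hpt y₁ hy₁ y₂ hy₂ v
  obtain ⟨Y, hY0, hYc, hY⟩ := hpt y₁ hy₁ y₂ hy₂ w
  obtain ⟨Z, hZ0, hZc, hZ⟩ := hpt y₁ hy₁ y₂ hy₂ z
  set γ : ℝ → V := fun t => y₁ + t • (y₂ - y₁) with hγ
  have hγU : ∀ t ∈ Icc (0 : ℝ) 1, γ t ∈ U := fun t ht =>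
    hεU ((convex_ball y ε).add_smul_sub_mem hy₁ hy₂ ht)
  have hγd : ∀ t, HasDerivAt γ (y₂ - y₁) t := by
    intro t
    have := ((hasDerivAt_id t).smul_const (y₂ - y₁)).const_add y₁
    simpa [hγ] using this
  have hγc : Continuous γ := continuous_iff_continuousAt.2 fun t => (hγd t).continuousAt
  have hγ0 : γ 0 = y₁ := by simp [hγ]
  have hγ1 : γ 1 = y₂ := by simp [hγ]
  have hcov : ∀ X : ℝ → V, (∀ t ∈ Ioo (0 : ℝ) 1, HasDerivAt X (-(chr G (γ t) (y₂ - y₁) (X t))) t) →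
      ∀ t ∈ Ioo (0 : ℝ) 1, cov G γ X 1 t = 0 := by
    intro X hX t ht
    rw [cov, fderiv_apply_one_eq_deriv, fderiv_apply_one_eq_deriv, (hX t ht).deriv, (hγd t).deriv]
    simp
  -- Scalar products of parallel fields are constant along the segment.
  have hconst : ∀ A B : ℝ → V, ContinuousOn A (Icc 0 1) → ContinuousOn B (Icc 0 1) →
      (∀ t ∈ Ioo (0 : ℝ) 1, DifferentiableAt ℝ A t) →
      (∀ t ∈ Ioo (0 : ℝ) 1, DifferentiableAt ℝ B t) →
      (∀ t ∈ Ioo (0 : ℝ) 1, cov G γ A 1 t = 0) → (∀ t ∈ Ioo (0 : ℝ) 1, cov G γ B 1 t = 0) →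
      G y₂ (A 1) (B 1) = G y₁ (A 0) (B 0) := by
    intro A B hA hB hAd hBd hAc hBc
    rw [← hγ0, ← hγ1]
    refine eq_endpoints_of_deriv_eq_zero (F := fun t => G (γ t) (A t) (B t)) ?_ ?_ ?_
    · have : ContinuousOn (fun t => G (γ t)) (Icc 0 1) :=
        hG.contDiffOn.continuousOn.comp hγc.continuousOn hγU
      exact (this.clm_apply hA).clm_apply hB
    · intro t ht
      have hg : DifferentiableAt ℝ G (γ t) :=
        (hG.contDiffAt (hγU t (Ioo_subset_Icc_self ht))).differentiableAt (by simp)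
      exact ((hg.comp t (hγd t).differentiableAt).clm_apply (hAd t ht)).clm_apply (hBd t ht)
    · intro t ht
      have := hG.hasFDerivAt_inner (hγU t (Ioo_subset_Icc_self ht)) (hγd t).differentiableAt
        (hAd t ht) (hBd t ht) (1 : ℝ)
      rw [fderiv_apply_one_eq_deriv] at this
      rw [this]
      have e1 := hAc t ht
      have e2 := hBc t ht
      rw [cov] at e1 e2
      rw [e1, e2]; simp
  have hRc : ContinuousOn (fun t => cur G (γ t) (X t) (Y t) (Z t)) (Icc 0 1) := by
    have : ContinuousOn (fun t => cur G (γ t)) (Icc 0 1) := fun t ht =>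
      (ContinuousAt.comp (hG.contDiffAt_cur (hγU t ht)).continuousAt
        hγc.continuousAt).continuousWithinAt
    exact ((this.clm_apply hXc).clm_apply hYc).clm_apply hZc
  have hRd : ∀ t ∈ Ioo (0 : ℝ) 1,
      DifferentiableAt ℝ (fun t => cur G (γ t) (X t) (Y t) (Z t)) t := by
    intro t ht
    have hg : DifferentiableAt ℝ (cur G) (γ t) :=
      (hG.contDiffAt_cur (hγU t (Ioo_subset_Icc_self ht))).differentiableAt (by simp)
    exact (((hg.comp t (hγd t).differentiableAt).clm_apply (hX t ht).differentiableAt).clm_apply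
      (hY t ht).differentiableAt).clm_apply (hZ t ht).differentiableAt
  -- As ∇R = 0, the curvature of three parallel fields is again parallel. Both sides of the bound
  -- thus have the same values at the two ends.
  have hR : ∀ t ∈ Ioo (0 : ℝ) 1, cov G γ (fun t => cur G (γ t) (X t) (Y t) (Z t)) 1 t = 0 := by
    intro t ht
    rw [hG.cov_cur hpar (hγU t (Ioo_subset_Icc_self ht)) (hγd t).differentiableAt
      (hX t ht).differentiableAt (hY t ht).differentiableAt (hZ t ht).differentiableAt,
      hcov X hX t ht, hcov Y hY t ht, hcov Z hZ t ht]
    simp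
  have e0 := hconst _ _ hRc hRc hRd hRd hR hR
  have eX := hconst X X hXc hXc (fun t ht => (hX t ht).differentiableAt)
    (fun t ht => (hX t ht).differentiableAt) (hcov X hX) (hcov X hX)
  have eY := hconst Y Y hYc hYc (fun t ht => (hY t ht).differentiableAt)
    (fun t ht => (hY t ht).differentiableAt) (hcov Y hY) (hcov Y hY)
  have eZ := hconst Z Z hZc hZc (fun t ht => (hZ t ht).differentiableAt)
    (fun t ht => (hZ t ht).differentiableAt) (hcov Z hZ) (hcov Z hZ)
  simp only [hX0, hY0, hZ0, hγ0, hγ1] at e0 eX eY eZ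
  rw [← e0, ← eX, ← eY, ← eZ]
  exact hc _ _ _

/-- The constant is the minimum of the quadratic form on the compact unit sphere. The sphere is
empty when the space is trivial, which is treated separately. -/
lemma IsMetricOn.exists_norm_le (hG : IsMetricOn G U) (hy : y ∈ U) :
    ∃ m > 0, ∀ v, m * (‖v‖ * ‖v‖) ≤ G y v v := by
  have := FiniteDimensional.proper_real V
  have hcont : Continuous fun v => G y v v := by fun_prop
  obtain he | hne := (Metric.sphere (0 : V) 1).eq_empty_or_nonempty
  · refine ⟨1, one_pos, fun v => ?_⟩
    have hv : v = 0 := by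
      by_contra h0
      have : ‖v‖⁻¹ • v ∈ Metric.sphere (0 : V) 1 := by simp [norm_smul, h0]
      rw [he] at this
      exact this
    simp [hv]
  · obtain ⟨x, hx, hmin⟩ := (isCompact_sphere (0 : V) 1).exists_isMinOn hne hcont.continuousOn
    refine ⟨G y x x, hG.pos y hy x (fun h0 => by simp [h0] at hx), fun v => ?_⟩
    by_cases h0 : v = 0
    · simp [h0]
    have hn : ‖v‖ ≠ 0 := norm_ne_zero_iff.2 h0
    have h1 : G y x x ≤ G y (‖v‖⁻¹ • v) (‖v‖⁻¹ • v) := hmin (by simp [norm_smul, h0])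
    simp only [map_smul, smul_apply, smul_eq_mul] at h1
    calc _ ≤ (‖v‖⁻¹ * (‖v‖⁻¹ * G y v v)) * (‖v‖ * ‖v‖) := by gcongr
      _ = _ := by field_simp

lemma IsMetricOn.exists_curvatureBoundAt (hG : IsMetricOn G U) (hy : y ∈ U) :
    ∃ c > 0, CurvatureBoundAt G c y := by
  obtain ⟨m, hm, hmv⟩ := hG.exists_norm_le hy
  -- The factor m⁻³ converts the three squared coordinate norms into G, and the summand 1 keeps the
  -- constant positive in the flat case.
  refine ⟨(‖G y‖ * ‖cur G y‖ ^ 2 + 1) / m ^ 3, by positivity, fun v w z => ?_⟩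
  have h1 : ‖cur G y v w z‖ ≤ ‖cur G y‖ * ‖v‖ * ‖w‖ * ‖z‖ :=
    ((ContinuousLinearMap.le_opNorm₂ _ _ _).trans (by
      gcongr; exact ContinuousLinearMap.le_opNorm _ _))
  have h2 : G y (cur G y v w z) (cur G y v w z) ≤ ‖G y‖ * ‖cur G y v w z‖ * ‖cur G y v w z‖ :=
    (Real.le_norm_self _).trans (ContinuousLinearMap.le_opNorm₂ _ _ _)
  calc _ ≤ ‖G y‖ * ‖cur G y v w z‖ * ‖cur G y v w z‖ := h2
    _ ≤ ‖G y‖ * (‖cur G y‖ * ‖v‖ * ‖w‖ * ‖z‖) * (‖cur G y‖ * ‖v‖ * ‖w‖ * ‖z‖) := by gcongr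
    _ = (‖G y‖ * ‖cur G y‖ ^ 2) / m ^ 3 * ((m * (‖v‖ * ‖v‖)) * (m * (‖w‖ * ‖w‖))
          * (m * (‖z‖ * ‖z‖))) := by field_simp
    _ ≤ (‖G y‖ * ‖cur G y‖ ^ 2 + 1) / m ^ 3 * (G y v v * G y w w * G y z z) := by
        have hw : 0 ≤ G y w w := le_trans (by positivity) (hmv w)
        have hv : 0 ≤ G y v v := le_trans (by positivity) (hmv v)
        gcongr
        · linarith
        · exact hmv v
        · exact hmv w
        · exact hmv z

end CurvatureBound

/-! ### A global curvature bound by connectedness. -/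

section Global

variable {E : Type*} [NormedAddCommGroup E] [NormedSpace ℂ E] [FiniteDimensional ℂ E]
variable {N : Type*} [TopologicalSpace N] [ChartedSpace E N] [IsManifold 𝓘(ℂ, E) ω N]

/-- The curvature operator as an operator on the model space. -/
def curvatureAt (h : Metric E N) (q : N) (v w z : E) : E := curvature (q := q) h v w z

lemma curvatureAt_eq_cur (h : Metric E N) (q : N) (v w z : E) :
    curvatureAt h q v w z = cur (metricCoeff h q) (rchart E q q) v w z :=
  curvatureCoeff_eq_cur h q ((rchart E q).map_source (mem_extChartAt_source q)) v w z

lemma chartDeriv_curvatureAt (h : Metric E N) {p q : N} (hq : q ∈ (rchart E p).source)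
    (v w z : E) :
    chartDeriv E p q (curvatureAt h q v w z) = cur (metricCoeff h p) (rchart E p q)
      (chartDeriv E p q v) (chartDeriv E p q w) (chartDeriv E p q z) :=
  chartDeriv_curvature h hq v w z

lemma curvatureBoundAt_iff (h : Metric E N) {p q : N} (hq : q ∈ (rchart E p).source) (c : ℝ) :
    CurvatureBoundAt (metricCoeff h p) c (rchart E p q) ↔
      ∀ v w z : E, metricAt h q (curvatureAt h q v w z) (curvatureAt h q v w z)
        ≤ c * (metricAt h q v v * metricAt h q w w * metricAt h q z z) := by
  simp only [inner_eq_metricCoeff h hq, chartDeriv_curvatureAt h hq]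
  constructor
  · intro H v w z
    exact H _ _ _
  · intro H v w z
    obtain ⟨v, rfl⟩ := chartDeriv_surjective (E := E) hq v
    obtain ⟨w, rfl⟩ := chartDeriv_surjective (E := E) hq w
    obtain ⟨z, rfl⟩ := chartDeriv_surjective (E := E) hq z
    exact H v w z

/-- The curvature of a connected locally symmetric space is bounded. -/
theorem exists_curvature_bound [ConnectedSpace N] {h : Metric E N}
    (hN : IsLocallyHermitianSymmetric h) :
    ∃ c > 0, ∀ (q : N) (v w z : E),
      metricAt h q (curvatureAt h q v w z) (curvatureAt h q v w z)
        ≤ c * (metricAt h q v v * metricAt h q w w * metricAt h q z z) := by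
  have : FiniteDimensional ℝ E := FiniteDimensional.complexToReal E
  obtain ⟨q₀⟩ : Nonempty N := inferInstance
  have hs := fun q : N => mem_extChartAt_source (I := 𝓘(ℝ, E)) q
  obtain ⟨c, hc, hb⟩ := (isMetricOn_metricCoeff h q₀).exists_curvatureBoundAt
    ((rchart E q₀).map_source (hs q₀))
  refine ⟨c, hc, ?_⟩
  -- With the constant of the single point q₀ fixed, the set where it bounds the curvature is
  -- locally all or nothing, hence clopen. Neither compactness nor completeness enters.
  let S : Set N := {q | ∀ v w z : E,
      metricAt h q (curvatureAt h q v w z) (curvatureAt h q v w z)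
        ≤ c * (metricAt h q v v * metricAt h q w w * metricAt h q z z)}
  have hloc : ∀ q : N, ∃ W ∈ 𝓝 q, ∀ q₁ ∈ W, ∀ q₂ ∈ W, q₂ ∈ S → q₁ ∈ S := by
    intro q
    obtain ⟨ε, hε, -, H⟩ := (isMetricOn_metricCoeff h q).exists_curvatureBoundAt_of
      (cur_parallel hN q) ((rchart E q).map_source (hs q))
    refine ⟨(rchart E q).source ∩ (rchart E q) ⁻¹' (Metric.ball (rchart E q q) ε), ?_, ?_⟩
    · exact Filter.inter_mem (extChartAt_source_mem_nhds q)
        ((continuousAt_extChartAt q).preimage_mem_nhds (Metric.ball_mem_nhds _ hε))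
    · intro q₁ h₁ q₂ h₂ hq₂
      exact (curvatureBoundAt_iff h h₁.1 c).1
        (H _ h₁.2 _ h₂.2 c ((curvatureBoundAt_iff h h₂.1 c).2 hq₂))
  have hclopen : IsClopen S := by
    constructor
    · rw [← isOpen_compl_iff, isOpen_iff_mem_nhds]
      intro q hq
      obtain ⟨W, hW, H⟩ := hloc q
      filter_upwards [hW] with q' hq' hS
      exact hq (H q (mem_of_mem_nhds hW) q' hq' hS)
    · rw [isOpen_iff_mem_nhds]
      intro q hq
      obtain ⟨W, hW, H⟩ := hloc q
      filter_upwards [hW] with q' hq'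
      exact H q' hq' q (mem_of_mem_nhds hW) hq
  have huniv := hclopen.eq_univ ⟨q₀, (curvatureBoundAt_iff h (hs q₀) c).1 hb⟩
  intro q
  have : q ∈ S := by rw [huniv]; trivial
  exact this

end Global

/-! ### The pulled-back Levi-Civita connection for maps into the manifold. -/

section FieldsAlongMaps

variable {E : Type*} [NormedAddCommGroup E] [NormedSpace ℂ E]
variable {N : Type*} [TopologicalSpace N] [ChartedSpace E N]
variable {P : Type*} [NormedAddCommGroup P] [NormedSpace ℝ P]

/-- The map `w` in the chart at `p`. -/
def coordMap (E : Type*) [NormedAddCommGroup E] [NormedSpace ℂ E] [ChartedSpace E N]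
    (w : P → N) (p : N) (z : P) : E := rchart E p (w z)

/-- The vector field `X` along `w` in the chart at `p`. -/
def coordField (w : P → N) (X : P → E) (p : N) (z : P) : E := chartDeriv E p (w z) (X z)

/-- The map `w` is smooth on the open set `Ω`. -/
structure IsSmoothMapOn (E : Type*) [NormedAddCommGroup E] [NormedSpace ℂ E] [ChartedSpace E N]
    (w : P → N) (Ω : Set P) : Prop where
  isOpen : IsOpen Ω
  continuousAt : ∀ z ∈ Ω, ContinuousAt w z
  contDiffAt : ∀ z ∈ Ω, ContDiffAt ℝ ∞ (coordMap E w (w z)) z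

/-- The vector field `X` along `w` is smooth on `Ω`. -/
def IsSmoothFieldOn (w : P → N) (X : P → E) (Ω : Set P) : Prop :=
  ∀ z ∈ Ω, ContDiffAt ℝ ∞ (coordField w X (w z)) z

/-- The derivative of `w` in the direction `e`. -/
def vel (E : Type*) [NormedAddCommGroup E] [NormedSpace ℂ E] [ChartedSpace E N]
    (w : P → N) (e : P) (z : P) : E := fderiv ℝ (coordMap E w (w z)) z e

variable [IsManifold 𝓘(ℂ, E) ω N]

/-- The pulled back Levi-Civita connection: the covariant derivative of the field `X` along `w`
in the direction `e`. -/
def covD (h : Metric E N) (w : P → N) (e : P) (X : P → E) (z : P) : E :=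
  cov (metricCoeff h (w z)) (coordMap E w (w z)) (coordField w X (w z)) e z

lemma covD_congr {h : Metric E N} {w : P → N} {X Y : P → E} {z : P} (H : X =ᶠ[𝓝 z] Y) (e : P) :
    covD h w e X z = covD h w e Y z := by
  refine cov_congr Filter.EventuallyEq.rfl ?_ e
  filter_upwards [H] with z' hz'
  rw [coordField, coordField, hz']

section Periodic

variable {w : P → N} {T : P}

lemma vel_periodic (hw : ∀ z, w (z + T) = w z) (e z : P) : vel E w e (z + T) = vel E w e z := by
  rw [vel, hw, ← fderiv_comp_add_right, vel]
  congr 2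
  ext z'
  simp only [coordMap, hw]

lemma covD_periodic {h : Metric E N} {X : P → E} (hw : ∀ z, w (z + T) = w z)
    (hX : ∀ z, X (z + T) = X z) (e z : P) : covD h w e X (z + T) = covD h w e X z := by
  have h1 : (fun z' => coordMap E w (w z) (z' + T)) = coordMap E w (w z) := by
    ext z'; simp only [coordMap, hw]
  have h2 : (fun z' => coordField w X (w z) (z' + T)) = coordField w X (w z) := by
    ext z'; simp only [coordField, hw, hX]
  rw [covD, covD, cov, cov, hw, ← fderiv_comp_add_right, ← fderiv_comp_add_right, h1, h2]
  simp only [coordMap, coordField, hw, hX]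

end Periodic

variable {w : P → N} {Ω : Set P} {z : P} {X Y Z : P → E}

namespace IsSmoothMapOn

variable (hw : IsSmoothMapOn E w Ω)
include hw

lemma eventually_mem_source {p : N} (hz : z ∈ Ω) (hp : w z ∈ (rchart E p).source) :
    ∀ᶠ z' in 𝓝 z, z' ∈ Ω ∧ w z' ∈ (rchart E p).source :=
  (hw.isOpen.mem_nhds hz |> fun H => Filter.inter_mem H
    ((hw.continuousAt z hz).preimage_mem_nhds ((isOpen_extChartAt_source p).mem_nhds hp)))

lemma eventually_mem_source_self (hz : z ∈ Ω) :
    ∀ᶠ z' in 𝓝 z, z' ∈ Ω ∧ w z' ∈ (rchart E (w z)).source :=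
  hw.eventually_mem_source hz (mem_extChartAt_source _)

omit hw in
lemma coordField_eq_transition {p p' : N} (hp : w z ∈ (rchart E p).source)
    (hp' : w z ∈ (rchart E p').source) :
    coordField w X p' z = fderiv ℝ (transition E p p') (coordMap E w p z) (coordField w X p z) :=
  chartDeriv_eq_transition hp hp' _

lemma coordField_vel {p : N} (hz : z ∈ Ω) (hp : w z ∈ (rchart E p).source) (e : P) :
    coordField w (vel E w e) p z = fderiv ℝ (coordMap E w p) z e := by
  have hs := mem_extChartAt_source (I := 𝓘(ℝ, E)) (w z)
  have h1 : DifferentiableAt ℝ (transition E (w z) p) (coordMap E w (w z) z) :=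
    ((contDiffOn_transition (w z) p).contDiffAt
      ((isOpen_overlap _ _).mem_nhds (rchart_mem_overlap hs hp))).differentiableAt (by simp)
  have h2 := h1.hasFDerivAt.comp z ((hw.contDiffAt z hz).differentiableAt (by simp)).hasFDerivAt
  have h3 : coordMap E w p =ᶠ[𝓝 z] transition E (w z) p ∘ coordMap E w (w z) := by
    filter_upwards [hw.eventually_mem_source_self hz] with z' hz'
    exact (transition_rchart hz'.2).symm
  rw [h3.fderiv_eq, h2.fderiv, coordField, chartDeriv_eq_fderiv hp]
  rfl

lemma smooth_vel (e : P) : IsSmoothFieldOn w (vel E w e) Ω := by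
  intro z hz
  refine (((hw.contDiffAt z hz).fderiv_right (m := ∞) (by simp)).clm_apply
    (contDiffAt_const (c := e))).congr_of_eventuallyEq ?_
  filter_upwards [hw.eventually_mem_source_self hz] with z' hz'
  exact hw.coordField_vel hz'.1 hz'.2 e

variable [FiniteDimensional ℂ E] {h : Metric E N}

omit hw in
lemma coordField_self (X : P → E) (z : P) : coordField w X (w z) z = X z := chartDeriv_self _ _

/-- `covD` uses at each z the chart centred at w z. By invariance under transition maps any fixed
chart gives the same field, so covariant derivatives can be shown smooth and iterated. -/
lemma coordField_covD {p : N} (hz : z ∈ Ω) (hp : w z ∈ (rchart E p).source)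
    (hX : IsSmoothFieldOn w X Ω) (e : P) :
    coordField w (covD h w e X) p z
      = cov (metricCoeff h p) (coordMap E w p) (coordField w X p) e z := by
  have : FiniteDimensional ℝ E := FiniteDimensional.complexToReal E
  have hs := mem_extChartAt_source (I := 𝓘(ℝ, E)) (w z)
  have h1 := (isIsometryOn_transition h (w z) p).cov_comp (rchart_mem_overlap hs hp)
    (f := coordMap E w (w z)) ((hw.contDiffAt z hz).differentiableAt (by simp))
    ((hX z hz).differentiableAt (by simp)) e
  rw [coordField, chartDeriv_eq_fderiv hp]
  refine Eq.trans h1.symm (cov_congr ?_ ?_ e)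
  · filter_upwards [hw.eventually_mem_source_self hz] with z' hz'
    exact transition_rchart hz'.2
  · filter_upwards [hw.eventually_mem_source_self hz, hw.eventually_mem_source hz hp]
      with z' hz' hz''
    exact (coordField_eq_transition hz'.2 hz''.2).symm

lemma smooth_covD (hX : IsSmoothFieldOn w X Ω) (e : P) :
    IsSmoothFieldOn w (covD h w e X) Ω := by
  have : FiniteDimensional ℝ E := FiniteDimensional.complexToReal E
  intro z hz
  have hs := mem_extChartAt_source (I := 𝓘(ℝ, E)) (w z)
  refine ((isMetricOn_metricCoeff h (w z)).contDiffAt_cov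
    (f := coordMap E w (w z)) ((rchart E (w z)).map_source hs)
    (hw.contDiffAt z hz) (hX z hz) e).congr_of_eventuallyEq ?_
  filter_upwards [hw.eventually_mem_source_self hz] with z' hz'
  exact hw.coordField_covD hz'.1 hz'.2 hX e

lemma smooth_add (hX : IsSmoothFieldOn w X Ω) (hY : IsSmoothFieldOn w Y Ω) :
    IsSmoothFieldOn w (X + Y) Ω := fun z hz => by
  have : coordField w (X + Y) (w z) = coordField w X (w z) + coordField w Y (w z) := by
    ext; simp [coordField]
  rw [this]; exact (hX z hz).add (hY z hz)

lemma smooth_smul (c : ℝ) (hX : IsSmoothFieldOn w X Ω) : IsSmoothFieldOn w (c • X) Ω :=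
  fun z hz => by
  have : coordField w (c • X) (w z) = c • coordField w X (w z) := by
    ext; simp [coordField]
  rw [this]; exact (hX z hz).const_smul c

lemma covD_add (hX : IsSmoothFieldOn w X Ω) (hY : IsSmoothFieldOn w Y Ω) (hz : z ∈ Ω) (e : P) :
    covD h w e (X + Y) z = covD h w e X z + covD h w e Y z := by
  have : coordField w (X + Y) (w z) = coordField w X (w z) + coordField w Y (w z) := by
    ext; simp [coordField]
  rw [covD, covD, covD, cov, cov, cov, this, fderiv_add ((hX z hz).differentiableAt (by simp))
    ((hY z hz).differentiableAt (by simp))]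
  simp only [add_apply, Pi.add_apply, map_add]
  abel

lemma covD_smul (c : ℝ) (hX : IsSmoothFieldOn w X Ω) (hz : z ∈ Ω) (e : P) :
    covD h w e (c • X) z = c • covD h w e X z := by
  have : coordField w (c • X) (w z) = c • coordField w X (w z) := by
    ext; simp [coordField]
  rw [covD, covD, cov, cov, this, fderiv_const_smul ((hX z hz).differentiableAt (by simp))]
  simp only [smul_apply, Pi.smul_apply, map_smul, smul_add]

lemma metricAt_eq {p : N} (hp : w z ∈ (rchart E p).source) :
    metricAt h (w z) (X z) (Y z)
      = metricCoeff h p (coordMap E w p z) (coordField w X p z) (coordField w Y p z) :=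
  inner_eq_metricCoeff h hp _ _

lemma contDiffAt_inner (hX : IsSmoothFieldOn w X Ω) (hY : IsSmoothFieldOn w Y Ω) (hz : z ∈ Ω) :
    ContDiffAt ℝ ∞ (fun z => metricAt h (w z) (X z) (Y z)) z := by
  have : FiniteDimensional ℝ E := FiniteDimensional.complexToReal E
  have hs := mem_extChartAt_source (I := 𝓘(ℝ, E)) (w z)
  have h1 := (((isMetricOn_metricCoeff h (w z)).contDiffAt ((rchart E (w z)).map_source hs)).comp z
    (hw.contDiffAt z hz)).clm_apply (hX z hz) |>.clm_apply (hY z hz)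
  refine h1.congr_of_eventuallyEq ?_
  filter_upwards [hw.eventually_mem_source_self hz] with z' hz'
  exact hw.metricAt_eq hz'.2

/-- Compatibility with the metric. -/
lemma fderiv_inner (hX : IsSmoothFieldOn w X Ω) (hY : IsSmoothFieldOn w Y Ω) (hz : z ∈ Ω) (e : P) :
    fderiv ℝ (fun z => metricAt h (w z) (X z) (Y z)) z e =
      metricAt h (w z) (covD h w e X z) (Y z) + metricAt h (w z) (X z) (covD h w e Y z) := by
  have : FiniteDimensional ℝ E := FiniteDimensional.complexToReal E
  have hs := mem_extChartAt_source (I := 𝓘(ℝ, E)) (w z)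
  have h1 := (isMetricOn_metricCoeff h (w z)).hasFDerivAt_inner
    (f := coordMap E w (w z)) ((rchart E (w z)).map_source hs)
    ((hw.contDiffAt z hz).differentiableAt (by simp)) ((hX z hz).differentiableAt (by simp))
    ((hY z hz).differentiableAt (by simp)) e
  have h2 : (fun z => metricAt h (w z) (X z) (Y z)) =ᶠ[𝓝 z] fun z' =>
      metricCoeff h (w z) (coordMap E w (w z) z') (coordField w X (w z) z')
        (coordField w Y (w z) z') := by
    filter_upwards [hw.eventually_mem_source_self hz] with z' hz'
    exact hw.metricAt_eq hz'.2
  rw [h2.fderiv_eq]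
  refine h1.trans ?_
  rw [hw.metricAt_eq (Y := Y) hs, hw.metricAt_eq (X := X) hs, coordField_self, coordField_self,
    coordField_self, coordField_self]
  simp only [covD, cov, coordField_self]

lemma covD_vel_comm (hz : z ∈ Ω) (e e' : P) :
    covD h w e (vel E w e') z = covD h w e' (vel E w e) z := by
  have : FiniteDimensional ℝ E := FiniteDimensional.complexToReal E
  have hs := mem_extChartAt_source (I := 𝓘(ℝ, E)) (w z)
  have h1 := (isMetricOn_metricCoeff h (w z)).cov_fderiv_comm
    (f := coordMap E w (w z)) ((rchart E (w z)).map_source hs)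
    (hw.contDiffAt z hz) e e'
  have h2 : ∀ e, coordField w (vel E w e) (w z) =ᶠ[𝓝 z]
      fun z' => fderiv ℝ (coordMap E w (w z)) z' e := by
    intro e
    filter_upwards [hw.eventually_mem_source_self hz] with z' hz'
    exact hw.coordField_vel hz'.1 hz'.2 e
  rw [covD, covD, cov_congr Filter.EventuallyEq.rfl (h2 e'), cov_congr Filter.EventuallyEq.rfl
    (h2 e)]
  exact h1

lemma covD_covD_sub (hX : IsSmoothFieldOn w X Ω) (hz : z ∈ Ω) (e e' : P) :
    covD h w e (covD h w e' X) z - covD h w e' (covD h w e X) z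
      = curvatureAt h (w z) (vel E w e z) (vel E w e' z) (X z) := by
  have : FiniteDimensional ℝ E := FiniteDimensional.complexToReal E
  have hs := mem_extChartAt_source (I := 𝓘(ℝ, E)) (w z)
  have h1 := (isMetricOn_metricCoeff h (w z)).cov_cov_sub
    (f := coordMap E w (w z)) ((rchart E (w z)).map_source hs)
    (hw.contDiffAt z hz) (hX z hz) e e'
  have h2 : ∀ e, coordField w (covD h w e X) (w z) =ᶠ[𝓝 z]
      cov (metricCoeff h (w z)) (coordMap E w (w z)) (coordField w X (w z)) e := by
    intro e
    filter_upwards [hw.eventually_mem_source_self hz] with z' hz'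
    exact hw.coordField_covD hz'.1 hz'.2 hX e
  rw [covD, covD, cov_congr Filter.EventuallyEq.rfl (h2 e'), cov_congr Filter.EventuallyEq.rfl
    (h2 e), curvatureAt_eq_cur]
  rw [coordField_self] at h1
  exact h1

lemma eventually_coordField_curvature (hz : z ∈ Ω) :
    coordField w (fun z => curvatureAt h (w z) (X z) (Y z) (Z z)) (w z) =ᶠ[𝓝 z] fun z' =>
      cur (metricCoeff h (w z)) (coordMap E w (w z) z') (coordField w X (w z) z')
        (coordField w Y (w z) z') (coordField w Z (w z) z') := by
  filter_upwards [hw.eventually_mem_source_self hz] with z' hz'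
  exact chartDeriv_curvatureAt h hz'.2 _ _ _

lemma smooth_curvature (hX : IsSmoothFieldOn w X Ω) (hY : IsSmoothFieldOn w Y Ω)
    (hZ : IsSmoothFieldOn w Z Ω) :
    IsSmoothFieldOn w (fun z => curvatureAt h (w z) (X z) (Y z) (Z z)) Ω := by
  have : FiniteDimensional ℝ E := FiniteDimensional.complexToReal E
  intro z hz
  have hs := mem_extChartAt_source (I := 𝓘(ℝ, E)) (w z)
  have h1 := ((((isMetricOn_metricCoeff h (w z)).contDiffAt_cur
    ((rchart E (w z)).map_source hs)).comp z
    (hw.contDiffAt z hz)).clm_apply (hX z hz) |>.clm_apply (hY z hz)).clm_apply (hZ z hz)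
  exact h1.congr_of_eventuallyEq (hw.eventually_coordField_curvature hz)

/-- The curvature is parallel. -/
lemma covD_curvature (hN : IsLocallyHermitianSymmetric h) (hX : IsSmoothFieldOn w X Ω)
    (hY : IsSmoothFieldOn w Y Ω) (hZ : IsSmoothFieldOn w Z Ω) (hz : z ∈ Ω) (e : P) :
    covD h w e (fun z => curvatureAt h (w z) (X z) (Y z) (Z z)) z =
      curvatureAt h (w z) (covD h w e X z) (Y z) (Z z)
      + curvatureAt h (w z) (X z) (covD h w e Y z) (Z z)
      + curvatureAt h (w z) (X z) (Y z) (covD h w e Z z) := by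
  have : FiniteDimensional ℝ E := FiniteDimensional.complexToReal E
  have hs := mem_extChartAt_source (I := 𝓘(ℝ, E)) (w z)
  have h1 := (isMetricOn_metricCoeff h (w z)).cov_cur (cur_parallel hN (w z))
    ((rchart E (w z)).map_source hs) (f := coordMap E w (w z))
    ((hw.contDiffAt z hz).differentiableAt (by simp))
    ((hX z hz).differentiableAt (by simp)) ((hY z hz).differentiableAt (by simp))
    ((hZ z hz).differentiableAt (by simp)) e
  rw [covD, cov_congr Filter.EventuallyEq.rfl (hw.eventually_coordField_curvature hz)]
  simp only [coordField_self] at h1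
  simp only [curvatureAt_eq_cur]
  exact h1

lemma smooth_mulI (hX : IsSmoothFieldOn w X Ω) : IsSmoothFieldOn w (fun z => mulI E (X z)) Ω := by
  intro z hz
  refine ((mulI E).contDiff.contDiffAt.comp z (hX z hz)).congr_of_eventuallyEq ?_
  filter_upwards [hw.eventually_mem_source_self hz] with z' hz'
  exact chartDeriv_I hz'.2 _

lemma covD_mulI (hK : IsKahler h) (hX : IsSmoothFieldOn w X Ω) (hz : z ∈ Ω) (e : P) :
    covD h w e (fun z => mulI E (X z)) z = mulI E (covD h w e X z) := by
  have hs := mem_extChartAt_source (I := 𝓘(ℝ, E)) (w z)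
  have h2 : coordField w (fun z => mulI E (X z)) (w z) =ᶠ[𝓝 z]
      fun z' => mulI E (coordField w X (w z) z') := by
    filter_upwards [hw.eventually_mem_source_self hz] with z' hz'
    exact chartDeriv_I hz'.2 _
  rw [covD, cov_congr Filter.EventuallyEq.rfl h2]
  exact IsMetricOn.cov_complex (f := coordMap E w (w z)) (U := (rchart E (w z)).target) (chr_I hK)
    ((rchart E (w z)).map_source hs) ((hX z hz).differentiableAt (by simp)) e

end IsSmoothMapOn

end FieldsAlongMaps

/-! ### Curvature algebra of a Kähler manifold at one point, and the symmetric form of the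
curvature. -/

section PointwiseAlgebra

variable {E : Type*} [NormedAddCommGroup E] [NormedSpace ℂ E] [FiniteDimensional ℂ E]
variable {N : Type*} [TopologicalSpace N] [ChartedSpace E N] [IsManifold 𝓘(ℂ, E) ω N]
variable {h : Metric E N} {q : N}

lemma metricAt_symm (v w : E) : metricAt h q v w = metricAt h q w v := h.symm q v w

lemma metricAt_nonneg (v : E) : 0 ≤ metricAt h q v v := by
  by_cases hv : v = 0
  · simp [hv]
  · exact (h.pos q v hv).le

lemma metricAt_ext {v w : E} (H : ∀ z, metricAt h q v z = metricAt h q w z) : v = w := by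
  by_contra hne
  have h1 : 0 < metricAt h q (v - w) (v - w) := h.pos q _ (sub_ne_zero.2 hne)
  rw [map_sub (metricAt h q), sub_apply, H, sub_self] at h1
  exact lt_irrefl _ h1

lemma metricAt_mulI (hK : IsKahler h) (v w : E) :
    metricAt h q (mulI E v) (mulI E w) = metricAt h q v w := hK.isometry_J q v w

lemma metricAt_mulI_left (hK : IsKahler h) (v w : E) :
    metricAt h q (mulI E v) w = - metricAt h q v (mulI E w) := by
  rw [← metricAt_mulI hK v (mulI E w), mulI_mulI, map_neg, neg_neg]

lemma metricAt_mulI_self (hK : IsKahler h) (v : E) : metricAt h q (mulI E v) v = 0 := by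
  have h1 := metricAt_mulI_left (q := q) hK v v
  rw [metricAt_symm v] at h1
  linarith

lemma metricAt_eq_coeff (v w : E) :
    metricAt h q v w = metricCoeff h q (rchart E q q) v w := by
  rw [inner_eq_metricCoeff h (mem_extChartAt_source q), chartDeriv_self, chartDeriv_self]

lemma rchart_self_mem (q : N) : rchart E q q ∈ (rchart E q).target :=
  (rchart E q).map_source (mem_extChartAt_source q)

lemma curvatureAt_antisymm (v w z : E) : curvatureAt h q v w z = - curvatureAt h q w v z := by
  simp only [curvatureAt_eq_cur]
  exact cur_antisymm _ _ _ _ _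

lemma curvatureAt_bianchi (u v w : E) :
    curvatureAt h q u v w + curvatureAt h q v w u + curvatureAt h q w u v = 0 := by
  have : FiniteDimensional ℝ E := FiniteDimensional.complexToReal E
  simp only [curvatureAt_eq_cur]
  exact (isMetricOn_metricCoeff h q).bianchi (rchart_self_mem q) u v w

lemma metricAt_curvatureAt_skew (u v w z : E) :
    metricAt h q (curvatureAt h q u v w) z = - metricAt h q (curvatureAt h q u v z) w := by
  have : FiniteDimensional ℝ E := FiniteDimensional.complexToReal E
  simp only [curvatureAt_eq_cur, metricAt_eq_coeff]
  exact (isMetricOn_metricCoeff h q).metric_cur_skew (rchart_self_mem q) u v w z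

lemma metricAt_curvatureAt_pair (u v w z : E) :
    metricAt h q (curvatureAt h q u v w) z = metricAt h q (curvatureAt h q w z u) v := by
  have : FiniteDimensional ℝ E := FiniteDimensional.complexToReal E
  simp only [curvatureAt_eq_cur, metricAt_eq_coeff]
  exact (isMetricOn_metricCoeff h q).metric_cur_pair (rchart_self_mem q) u v w z

lemma curvatureAt_mulI (hK : IsKahler h) (u v w : E) :
    curvatureAt h q u v (mulI E w) = mulI E (curvatureAt h q u v w) := by
  have : FiniteDimensional ℝ E := FiniteDimensional.complexToReal E
  simp only [curvatureAt_eq_cur]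
  exact (isMetricOn_metricCoeff h q).cur_complex (chr_I hK) (rchart_self_mem q) u v w

/-- R(u, v) commutes with the isometry J, so the form is J-invariant in its last pair. Pair symmetry
moves this to the first pair. -/
lemma curvatureAt_mulI_mulI (hK : IsKahler h) (u v w : E) :
    curvatureAt h q (mulI E u) (mulI E v) w = curvatureAt h q u v w := by
  refine metricAt_ext (h := h) (q := q) fun z => ?_
  rw [metricAt_curvatureAt_pair, curvatureAt_mulI hK, metricAt_mulI hK, metricAt_curvatureAt_pair]

lemma curvatureAt_mulI_swap (hK : IsKahler h) (u v w : E) :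
    curvatureAt h q u (mulI E v) w = curvatureAt h q v (mulI E u) w := by
  rw [← curvatureAt_mulI_mulI hK u (mulI E v), mulI_mulI, curvatureAt_antisymm v]
  simp only [curvatureAt_eq_cur, map_neg, neg_apply]

/-- The operator `½ (R(X, Y) Z + R(X, J Y) J Z)`, symmetric in `X` and `Z`. -/
def curvSym (h : Metric E N) (q : N) (X Z Y : E) : E :=
  (1 / 2 : ℝ) • (curvatureAt h q X Y Z + curvatureAt h q X (mulI E Y) (mulI E Z))

/-- Add the Bianchi identity for X, Y, Z to J applied to the one for X, JY, Z: the two terms R(Z,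
X)Y cancel because J² = −1. -/
lemma curvSym_swap (hK : IsKahler h) (X Z Y : E) : curvSym h q X Z Y = curvSym h q Z X Y := by
  have h1 := curvatureAt_bianchi (h := h) (q := q) X Y Z
  have h2 := congrArg (mulI E) (curvatureAt_bianchi (h := h) (q := q) X (mulI E Y) Z)
  rw [map_add, map_add, ← curvatureAt_mulI hK, ← curvatureAt_mulI hK, ← curvatureAt_mulI hK,
    mulI_mulI, map_zero] at h2
  have e1 := curvatureAt_antisymm (h := h) (q := q) Y Z X
  have e2 := curvatureAt_antisymm (h := h) (q := q) (mulI E Y) Z (mulI E X)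
  have e3 : curvatureAt h q Z X (-Y) = - curvatureAt h q Z X Y := by
    simp only [curvatureAt_eq_cur, map_neg]
  rw [e1] at h1
  rw [e2, e3] at h2
  rw [curvSym, curvSym]
  congr 1
  rw [← sub_eq_zero, ← add_zero (0 : E)]
  nth_rewrite 1 [← h1]
  rw [← h2]
  abel

/-- Since R(Y, JX) = R(X, JY), the J-parts of the two symmetric operators coincide: their difference
is R(X,Y)Z and their sum, in the next lemma, R(X,JY)JZ. Every curvature term is thereby expressed
through one form with many symmetries. -/
lemma curvatureAt_eq_curvSym (hK : IsKahler h) (X Y Z : E) :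
    curvatureAt h q X Y Z = curvSym h q X Z Y - curvSym h q Y Z X := by
  rw [curvSym, curvSym, curvatureAt_mulI_swap hK Y X, curvatureAt_antisymm Y X]
  module

lemma curvatureAt_mulI_eq_curvSym (hK : IsKahler h) (X Y Z : E) :
    curvatureAt h q X (mulI E Y) (mulI E Z) = curvSym h q X Z Y + curvSym h q Y Z X := by
  rw [curvSym, curvSym, curvatureAt_mulI_swap hK Y X, curvatureAt_antisymm Y X]
  module

lemma metricAt_curvSym_pair (hK : IsKahler h) (X Z Y W : E) :
    metricAt h q (curvSym h q X Z Y) W = metricAt h q (curvSym h q Y W X) Z := by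
  have e1 : metricAt h q (curvatureAt h q X Y Z) W = metricAt h q (curvatureAt h q Y X W) Z := by
    rw [curvatureAt_antisymm Y X, map_neg, neg_apply, metricAt_curvatureAt_skew]
  have e2 : metricAt h q (curvatureAt h q X (mulI E Y) (mulI E Z)) W
      = metricAt h q (curvatureAt h q Y (mulI E X) (mulI E W)) Z := by
    rw [metricAt_curvatureAt_skew _ _ _ Z, curvatureAt_mulI_swap hK Y X, curvatureAt_mulI hK,
      metricAt_mulI_left hK, metricAt_curvatureAt_skew]
  simp only [curvSym, map_smul, smul_apply, map_add, add_apply, e1, e2]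

lemma metricAt_curvSym_swap (hK : IsKahler h) (X Z Y W : E) :
    metricAt h q (curvSym h q X Z Y) W = metricAt h q (curvSym h q X Z W) Y := by
  rw [metricAt_curvSym_pair hK, curvSym_swap hK, metricAt_curvSym_pair hK]

section Linear

variable (X X' Y Z : E) (c : ℝ)

lemma curvSym_add_left : curvSym h q (X + X') Z Y = curvSym h q X Z Y + curvSym h q X' Z Y := by
  simp only [curvSym, curvatureAt_eq_cur, map_add, add_apply]
  module

lemma curvSym_smul_left : curvSym h q (c • X) Z Y = c • curvSym h q X Z Y := by
  simp only [curvSym, curvatureAt_eq_cur, map_smul, smul_apply]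
  module

lemma curvSym_add_mid : curvSym h q Z (X + X') Y = curvSym h q Z X Y + curvSym h q Z X' Y := by
  simp only [curvSym, curvatureAt_eq_cur, map_add]
  module

lemma curvSym_smul_mid : curvSym h q Z (c • X) Y = c • curvSym h q Z X Y := by
  simp only [curvSym, curvatureAt_eq_cur, map_smul]
  module

lemma curvSym_add_right : curvSym h q Z Y (X + X') = curvSym h q Z Y X + curvSym h q Z Y X' := by
  simp only [curvSym, curvatureAt_eq_cur, map_add, add_apply]
  module

lemma curvSym_smul_right : curvSym h q Z Y (c • X) = c • curvSym h q Z Y X := by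
  simp only [curvSym, curvatureAt_eq_cur, map_smul, smul_apply]
  module

lemma curvatureAt_self : curvatureAt h q X X Y = 0 := by
  have := curvatureAt_antisymm (h := h) (q := q) X X Y
  have h2 : (2 : ℝ) • curvatureAt h q X X Y = 0 := by
    rw [two_smul]
    nth_rewrite 1 [this]
    exact neg_add_cancel _
  exact (smul_eq_zero.1 h2).resolve_left two_ne_zero

end Linear

/-- The norm of tangent vectors at `q`. -/
def normAt (h : Metric E N) (q : N) (v : E) : ℝ := Real.sqrt (metricAt h q v v)

lemma normAt_nonneg (v : E) : 0 ≤ normAt h q v := Real.sqrt_nonneg _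

lemma normAt_sq (v : E) : normAt h q v ^ 2 = metricAt h q v v := Real.sq_sqrt (metricAt_nonneg v)

lemma metricAt_sq_le (v w : E) :
    (metricAt h q v w) ^ 2 ≤ metricAt h q v v * metricAt h q w w := by
  let B : LinearMap.BilinForm ℝ E := LinearMap.mk₂ ℝ (fun v w => metricAt h q v w)
    (by intros; simp) (by intros; simp) (by intros; simp) (by intros; simp)
  exact LinearMap.BilinForm.apply_sq_le_of_symm B (fun x => metricAt_nonneg x)
    ⟨fun x y => metricAt_symm x y⟩ v w

lemma abs_metricAt_le (v w : E) : |metricAt h q v w| ≤ normAt h q v * normAt h q w := by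
  refine abs_le_of_sq_le_sq ?_ (mul_nonneg (normAt_nonneg v) (normAt_nonneg w))
  rw [mul_pow, normAt_sq, normAt_sq]
  exact metricAt_sq_le v w

lemma normAt_add_le (v w : E) : normAt h q (v + w) ≤ normAt h q v + normAt h q w := by
  refine abs_le_of_sq_le_sq' ?_ (add_nonneg (normAt_nonneg v) (normAt_nonneg w)) |>.2
  rw [normAt_sq, add_sq, normAt_sq, normAt_sq]
  have h1 := (abs_le.1 (abs_metricAt_le (h := h) (q := q) v w)).2
  have h2 := metricAt_symm (h := h) (q := q) v w
  simp only [map_add, add_apply]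
  linarith

lemma normAt_smul (c : ℝ) (v : E) : normAt h q (c • v) = |c| * normAt h q v := by
  rw [normAt, normAt]
  simp only [map_smul, smul_apply, smul_eq_mul]
  rw [← mul_assoc, Real.sqrt_mul (mul_self_nonneg c), Real.sqrt_mul_self_eq_abs]

lemma normAt_mulI (hK : IsKahler h) (v : E) : normAt h q (mulI E v) = normAt h q v := by
  rw [normAt, metricAt_mulI hK, normAt]

/-- The curvature of `h` is bounded by `M`. -/
def CurvatureBoundedBy (h : Metric E N) (M : ℝ) : Prop :=
  0 ≤ M ∧ ∀ (q : N) (v w z : E), normAt h q (curvatureAt h q v w z)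
    ≤ M * normAt h q v * normAt h q w * normAt h q z

lemma exists_curvatureBoundedBy [ConnectedSpace N] (hN : IsLocallyHermitianSymmetric h) :
    ∃ M, CurvatureBoundedBy h M := by
  obtain ⟨c, hc, H⟩ := exists_curvature_bound hN
  refine ⟨Real.sqrt c, Real.sqrt_nonneg c, fun q v w z => ?_⟩
  have h1 := Real.sqrt_le_sqrt (H q v w z)
  rw [Real.sqrt_mul hc.le, Real.sqrt_mul (mul_nonneg (metricAt_nonneg _) (metricAt_nonneg _)),
    Real.sqrt_mul (metricAt_nonneg _)] at h1
  simpa only [normAt, mul_assoc] using h1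

lemma CurvatureBoundedBy.curvSym_le {M : ℝ} (hM : CurvatureBoundedBy h M) (hK : IsKahler h)
    (X Z Y : E) :
    normAt h q (curvSym h q X Z Y) ≤ M * normAt h q X * normAt h q Z * normAt h q Y := by
  have h1 := hM.2 q X Y Z
  have h2 := hM.2 q X (mulI E Y) (mulI E Z)
  rw [normAt_mulI hK, normAt_mulI hK] at h2
  rw [curvSym, normAt_smul]
  have h3 := normAt_add_le (h := h) (q := q) (curvatureAt h q X Y Z)
    (curvatureAt h q X (mulI E Y) (mulI E Z))
  rw [abs_of_pos (by norm_num)]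
  nlinarith

end PointwiseAlgebra

/-! ### The Leibniz rule for the parallel operator `curvSym`. -/

section SymmetricFields

variable {E : Type*} [NormedAddCommGroup E] [NormedSpace ℂ E] [FiniteDimensional ℂ E]
variable {N : Type*} [TopologicalSpace N] [ChartedSpace E N] [IsManifold 𝓘(ℂ, E) ω N]
variable {P : Type*} [NormedAddCommGroup P] [NormedSpace ℝ P]
variable {h : Metric E N} {w : P → N} {Ω : Set P} {z : P} {X Y Z : P → E}

namespace IsSmoothMapOn

variable (hw : IsSmoothMapOn E w Ω)
include hw

lemma smooth_curvSym (hX : IsSmoothFieldOn w X Ω) (hZ : IsSmoothFieldOn w Z Ω)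
    (hY : IsSmoothFieldOn w Y Ω) :
    IsSmoothFieldOn w (fun z => curvSym h (w z) (X z) (Z z) (Y z)) Ω :=
  hw.smooth_smul (1 / 2) (hw.smooth_add (hw.smooth_curvature hX hY hZ)
    (hw.smooth_curvature hX (hw.smooth_mulI hY) (hw.smooth_mulI hZ)))

lemma covD_curvSym (hN : IsLocallyHermitianSymmetric h) (hX : IsSmoothFieldOn w X Ω)
    (hZ : IsSmoothFieldOn w Z Ω) (hY : IsSmoothFieldOn w Y Ω) (hz : z ∈ Ω) (e : P) :
    covD h w e (fun z => curvSym h (w z) (X z) (Z z) (Y z)) z =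
      curvSym h (w z) (covD h w e X z) (Z z) (Y z)
      + curvSym h (w z) (X z) (covD h w e Z z) (Y z)
      + curvSym h (w z) (X z) (Z z) (covD h w e Y z) := by
  have h1 := hw.smooth_curvature (h := h) hX hY hZ
  have h2 := hw.smooth_curvature (h := h) hX (hw.smooth_mulI hY) (hw.smooth_mulI hZ)
  have h3 := hw.covD_smul (h := h) (1 / 2) (hw.smooth_add h1 h2) hz e
  rw [hw.covD_add h1 h2 hz, hw.covD_curvature hN hX hY hZ hz,
    hw.covD_curvature hN hX (hw.smooth_mulI hY) (hw.smooth_mulI hZ) hz,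
    hw.covD_mulI hN.toIsKahler hY hz, hw.covD_mulI hN.toIsKahler hZ hz] at h3
  refine h3.trans ?_
  simp only [curvSym]
  module

end IsSmoothMapOn

end SymmetricFields

/-! ### Exact densities, whose integral over a period vanishes. -/

section Exact

/-- `f` is the `x`-derivative, on `Ω`, of a smooth function with period `τ`. -/
def IsExactOn (Ω : Set (ℝ × ℝ)) (τ : ℝ × ℝ) (f : ℝ × ℝ → ℝ) : Prop :=
  ∃ Φ : ℝ × ℝ → ℝ, (∀ z ∈ Ω, ContDiffAt ℝ ∞ Φ z) ∧ (∀ z, Φ (z + τ) = Φ z) ∧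
    ∀ z ∈ Ω, f z = fderiv ℝ Φ z (1, 0)

namespace IsExactOn

variable {Ω : Set (ℝ × ℝ)} {τ : ℝ × ℝ} {f g : ℝ × ℝ → ℝ}

lemma add (hf : IsExactOn Ω τ f) (hg : IsExactOn Ω τ g) : IsExactOn Ω τ (f + g) := by
  obtain ⟨Φ, h1, h2, h3⟩ := hf
  obtain ⟨Ψ, k1, k2, k3⟩ := hg
  refine ⟨Φ + Ψ, fun z hz => (h1 z hz).add (k1 z hz), fun z => by simp [h2, k2], fun z hz => ?_⟩
  rw [fderiv_add ((h1 z hz).differentiableAt (by simp)) ((k1 z hz).differentiableAt (by simp))]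
  simp [h3 z hz, k3 z hz]

lemma smul (c : ℝ) (hf : IsExactOn Ω τ f) : IsExactOn Ω τ (c • f) := by
  obtain ⟨Φ, h1, h2, h3⟩ := hf
  refine ⟨c • Φ, fun z hz => (h1 z hz).const_smul c, fun z => by simp [h2], fun z hz => ?_⟩
  rw [fderiv_const_smul ((h1 z hz).differentiableAt (by simp))]
  simp [h3 z hz]

lemma congr (hf : IsExactOn Ω τ f) (H : ∀ z ∈ Ω, g z = f z) : IsExactOn Ω τ g := by
  obtain ⟨Φ, h1, h2, h3⟩ := hf
  exact ⟨Φ, h1, h2, fun z hz => (H z hz).trans (h3 z hz)⟩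

end IsExactOn

end Exact

/-! ### The flow equation, its differentiated forms, and conservation of E₁. -/

section EnergyIdentity

variable {E : Type*} [NormedAddCommGroup E] [NormedSpace ℂ E] [FiniteDimensional ℂ E]
variable {N : Type*} [TopologicalSpace N] [ChartedSpace E N] [IsManifold 𝓘(ℂ, E) ω N]
variable {h : Metric E N} {w : ℝ × ℝ → N} {Ω : Set (ℝ × ℝ)} {τ : ℝ × ℝ}

/-- A field along `w` which is smooth on `Ω` and has period `τ`. -/
structure IsPeriodicField (w : ℝ × ℝ → N) (Ω : Set (ℝ × ℝ)) (τ : ℝ × ℝ) (X : ℝ × ℝ → E) :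
    Prop where
  smooth : IsSmoothFieldOn w X Ω
  periodic : ∀ z, X (z + τ) = X z

/-- The quadrilinear form `⟨½ (R(X, Y) Z + R(X, J Y) J Z), W⟩`. -/
def curvForm (h : Metric E N) (q : N) (X Z Y W : E) : ℝ := metricAt h q (curvSym h q X Z Y) W

lemma curvForm_swap_left (hK : IsKahler h) (q : N) (X Z Y W : E) :
    curvForm h q X Z Y W = curvForm h q Z X Y W := by
  rw [curvForm, curvSym_swap hK, curvForm]

lemma curvForm_swap_right (hK : IsKahler h) (q : N) (X Z Y W : E) :
    curvForm h q X Z Y W = curvForm h q X Z W Y := metricAt_curvSym_swap hK X Z Y W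

lemma curvForm_pair (hK : IsKahler h) (q : N) (X Z Y W : E) :
    curvForm h q X Z Y W = curvForm h q Y W X Z := metricAt_curvSym_pair hK X Z Y W

/-- A smooth periodic map, together with its smooth periodic vector fields. -/
structure IsPeriodicMap (E : Type*) [NormedAddCommGroup E] [NormedSpace ℂ E] [ChartedSpace E N]
    (w : ℝ × ℝ → N) (Ω : Set (ℝ × ℝ)) (τ : ℝ × ℝ) : Prop where
  smooth : IsSmoothMapOn E w Ω
  periodic : ∀ z, w (z + τ) = w z

namespace IsPeriodicMap

variable (hw : IsPeriodicMap E w Ω τ) {X Y Z W : ℝ × ℝ → E}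
include hw

lemma vel (e : ℝ × ℝ) : IsPeriodicField w Ω τ (vel E w e) :=
  ⟨hw.smooth.smooth_vel e, vel_periodic hw.periodic e⟩

lemma covD (hX : IsPeriodicField w Ω τ X) (e : ℝ × ℝ) : IsPeriodicField w Ω τ (covD h w e X) :=
  ⟨hw.smooth.smooth_covD hX.smooth e, covD_periodic hw.periodic hX.periodic e⟩

lemma add (hX : IsPeriodicField w Ω τ X) (hY : IsPeriodicField w Ω τ Y) :
    IsPeriodicField w Ω τ (X + Y) :=
  ⟨hw.smooth.smooth_add hX.smooth hY.smooth, fun z => by simp [hX.periodic, hY.periodic]⟩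

lemma smul (c : ℝ) (hX : IsPeriodicField w Ω τ X) : IsPeriodicField w Ω τ (c • X) :=
  ⟨hw.smooth.smooth_smul c hX.smooth, fun z => by simp [hX.periodic]⟩

lemma mulI (hX : IsPeriodicField w Ω τ X) : IsPeriodicField w Ω τ (fun z => mulI E (X z)) :=
  ⟨hw.smooth.smooth_mulI hX.smooth, fun z => by simp only [hX.periodic]⟩

lemma curvature (hX : IsPeriodicField w Ω τ X) (hY : IsPeriodicField w Ω τ Y)
    (hZ : IsPeriodicField w Ω τ Z) :
    IsPeriodicField w Ω τ (fun z => curvatureAt h (w z) (X z) (Y z) (Z z)) :=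
  ⟨hw.smooth.smooth_curvature hX.smooth hY.smooth hZ.smooth, fun z => by
    simp only [hX.periodic, hY.periodic, hZ.periodic, hw.periodic]⟩

lemma curvSym (hX : IsPeriodicField w Ω τ X) (hY : IsPeriodicField w Ω τ Y)
    (hZ : IsPeriodicField w Ω τ Z) :
    IsPeriodicField w Ω τ (fun z => curvSym h (w z) (X z) (Y z) (Z z)) :=
  ⟨hw.smooth.smooth_curvSym hX.smooth hY.smooth hZ.smooth, fun z => by
    simp only [hX.periodic, hY.periodic, hZ.periodic, hw.periodic]⟩

/-- Integration by parts as a statement about densities. The derivatives are supplied as X', Y', so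
that the density appears in the terms wanted where it is used; likewise in `exact_curvForm`. -/
lemma exact_inner {X' Y' : ℝ × ℝ → E} (hX : IsPeriodicField w Ω τ X)
    (hY : IsPeriodicField w Ω τ Y)
    (dX : ∀ z ∈ Ω, SchrodingerAiry.covD h w (1, 0) X z = X' z)
    (dY : ∀ z ∈ Ω, SchrodingerAiry.covD h w (1, 0) Y z = Y' z) :
    IsExactOn Ω τ (fun z => metricAt h (w z) (X' z) (Y z) + metricAt h (w z) (X z) (Y' z)) := by
  refine ⟨fun z => metricAt h (w z) (X z) (Y z),
    fun z hz => hw.smooth.contDiffAt_inner hX.smooth hY.smooth hz,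
    fun z => by simp only [hX.periodic, hY.periodic, hw.periodic], fun z hz => ?_⟩
  rw [hw.smooth.fderiv_inner hX.smooth hY.smooth hz, dX z hz, dY z hz]

lemma fderiv_curvForm (hN : IsLocallyHermitianSymmetric h) (hX : IsPeriodicField w Ω τ X)
    (hZ : IsPeriodicField w Ω τ Z) (hY : IsPeriodicField w Ω τ Y) (hW : IsPeriodicField w Ω τ W)
    {z : ℝ × ℝ} (hz : z ∈ Ω) (e : ℝ × ℝ) :
    fderiv ℝ (fun z => curvForm h (w z) (X z) (Z z) (Y z) (W z)) z e =
      curvForm h (w z) (SchrodingerAiry.covD h w e X z) (Z z) (Y z) (W z)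
      + curvForm h (w z) (X z) (SchrodingerAiry.covD h w e Z z) (Y z) (W z)
      + curvForm h (w z) (X z) (Z z) (SchrodingerAiry.covD h w e Y z) (W z)
      + curvForm h (w z) (X z) (Z z) (Y z) (SchrodingerAiry.covD h w e W z) := by
  have h1 := hw.smooth.fderiv_inner (h := h) (hw.curvSym (h := h) hX hZ hY).smooth
    hW.smooth hz e
  rw [hw.smooth.covD_curvSym hN hX.smooth hZ.smooth hY.smooth hz] at h1
  simp only [map_add, add_apply] at h1
  exact h1

lemma exact_curvForm {X' Y' Z' W' : ℝ × ℝ → E} (hN : IsLocallyHermitianSymmetric h)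
    (hX : IsPeriodicField w Ω τ X) (hZ : IsPeriodicField w Ω τ Z)
    (hY : IsPeriodicField w Ω τ Y) (hW : IsPeriodicField w Ω τ W)
    (dX : ∀ z ∈ Ω, SchrodingerAiry.covD h w (1, 0) X z = X' z)
    (dZ : ∀ z ∈ Ω, SchrodingerAiry.covD h w (1, 0) Z z = Z' z)
    (dY : ∀ z ∈ Ω, SchrodingerAiry.covD h w (1, 0) Y z = Y' z)
    (dW : ∀ z ∈ Ω, SchrodingerAiry.covD h w (1, 0) W z = W' z) :
    IsExactOn Ω τ (fun z => curvForm h (w z) (X' z) (Z z) (Y z) (W z)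
      + curvForm h (w z) (X z) (Z' z) (Y z) (W z) + curvForm h (w z) (X z) (Z z) (Y' z) (W z)
      + curvForm h (w z) (X z) (Z z) (Y z) (W' z)) := by
  refine ⟨fun z => curvForm h (w z) (X z) (Z z) (Y z) (W z),
    fun z hz => hw.smooth.contDiffAt_inner (hw.curvSym hX hZ hY).smooth hW.smooth hz,
    fun z => by simp only [hX.periodic, hY.periodic, hZ.periodic, hW.periodic, hw.periodic],
    fun z hz => ?_⟩
  rw [hw.fderiv_curvForm hN hX hZ hY hW hz, dX z hz, dY z hz, dZ z hz, dW z hz]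

end IsPeriodicMap

/-- The derivatives of `w` in the direction `x`: `jet h w k = ∇_x^k w_x`. -/
def jet (h : Metric E N) (w : ℝ × ℝ → N) : ℕ → ℝ × ℝ → E
  | 0 => vel E w (1, 0)
  | k + 1 => covD h w (1, 0) (jet h w k)

lemma IsPeriodicMap.jet (hw : IsPeriodicMap E w Ω τ) (k : ℕ) :
    IsPeriodicField w Ω τ (jet h w k) := by
  induction k with
  | zero => exact hw.vel _
  | succ k ih => exact hw.covD ih _

/-- The nonlinear term `½ R(w_x, J w_x) J w_x`. -/
def cubic (h : Metric E N) (w : ℝ × ℝ → N) (z : ℝ × ℝ) : E :=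
  curvSym h (w z) (jet h w 0 z) (jet h w 0 z) (jet h w 0 z)

/-- The part of the velocity of the flow of lower order. -/
def lowerVel (h : Metric E N) (α β : ℝ) (w : ℝ × ℝ → N) : ℝ × ℝ → E :=
  α • (fun z => mulI E (jet h w 1 z)) + β • cubic h w

/-- `w` solves the flow equation on `Ω`. -/
structure IsFlowOn (h : Metric E N) (α β : ℝ) (w : ℝ × ℝ → N) (Ω : Set (ℝ × ℝ)) (τ : ℝ × ℝ) :
    Prop extends IsPeriodicMap E w Ω τ where
  symmetric : IsLocallyHermitianSymmetric h
  flow : ∀ z ∈ Ω, vel E w (0, 1) z = β • jet h w 2 z + lowerVel h α β w z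

namespace IsFlowOn

variable {α β : ℝ} (hw : IsFlowOn h α β w Ω τ)
include hw

lemma periodicField_cubic : IsPeriodicField w Ω τ (cubic h w) :=
  hw.toIsPeriodicMap.curvSym (hw.jet 0) (hw.jet 0) (hw.jet 0)

lemma periodicField_lowerVel : IsPeriodicField w Ω τ (lowerVel h α β w) :=
  hw.toIsPeriodicMap.add (hw.toIsPeriodicMap.smul _ (hw.toIsPeriodicMap.mulI (hw.jet 1)))
    (hw.toIsPeriodicMap.smul _ hw.periodicField_cubic)

lemma covD_congr_on {X Y : ℝ × ℝ → E} (H : ∀ z ∈ Ω, X z = Y z) {z : ℝ × ℝ} (hz : z ∈ Ω)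
    (e : ℝ × ℝ) : covD h w e X z = covD h w e Y z :=
  covD_congr (by filter_upwards [hw.smooth.isOpen.mem_nhds hz] with z' hz' using H z' hz') e

/-- `∇_x` of the part of lower order of the velocity. -/
def dLowerVel (h : Metric E N) (α β : ℝ) (w : ℝ × ℝ → N) : ℝ × ℝ → E :=
  α • (fun z => mulI E (jet h w 2 z)) + β • covD h w (1, 0) (cubic h w)

lemma covD_lowerVel {z : ℝ × ℝ} (hz : z ∈ Ω) :
    covD h w (1, 0) (lowerVel h α β w) z = dLowerVel h α β w z := by
  have h1 := hw.toIsPeriodicMap.mulI (hw.jet (h := h) 1)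
  rw [lowerVel, hw.smooth.covD_add (hw.smooth.smooth_smul α h1.smooth)
    (hw.smooth.smooth_smul β hw.periodicField_cubic.smooth) hz, hw.smooth.covD_smul α h1.smooth hz,
    hw.smooth.covD_smul β hw.periodicField_cubic.smooth hz,
    hw.smooth.covD_mulI hw.symmetric.toIsKahler (hw.jet 1).smooth hz]
  rfl

lemma covD_covD_lowerVel {z : ℝ × ℝ} (hz : z ∈ Ω) :
    covD h w (1, 0) (covD h w (1, 0) (lowerVel h α β w)) z =
      α • mulI E (jet h w 3 z) + β • covD h w (1, 0) (covD h w (1, 0) (cubic h w)) z := by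
  have h1 := hw.toIsPeriodicMap.mulI (hw.jet (h := h) 2)
  have h2 := (hw.toIsPeriodicMap.covD (h := h) hw.periodicField_cubic (1, 0)).smooth
  rw [hw.covD_congr_on (fun z hz => hw.covD_lowerVel hz) hz]
  rw [dLowerVel, hw.smooth.covD_add (hw.smooth.smooth_smul α h1.smooth)
    (hw.smooth.smooth_smul β h2) hz, hw.smooth.covD_smul α h1.smooth hz,
    hw.smooth.covD_smul β h2 hz,
    hw.smooth.covD_mulI hw.symmetric.toIsKahler (hw.jet 2).smooth hz]
  rfl

lemma covD_vel {z : ℝ × ℝ} (hz : z ∈ Ω) :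
    covD h w (1, 0) (vel E w (0, 1)) z = β • jet h w 3 z + dLowerVel h α β w z := by
  rw [hw.covD_congr_on (Y := β • jet h w 2 + lowerVel h α β w) hw.flow hz,
    hw.smooth.covD_add (hw.smooth.smooth_smul β (hw.jet 2).smooth)
      hw.periodicField_lowerVel.smooth hz, hw.smooth.covD_smul β (hw.jet 2).smooth hz,
    hw.covD_lowerVel hz]
  rfl

lemma covD_covD_vel {z : ℝ × ℝ} (hz : z ∈ Ω) :
    covD h w (1, 0) (covD h w (1, 0) (vel E w (0, 1))) z = β • jet h w 4 z +
      (α • mulI E (jet h w 3 z) + β • covD h w (1, 0) (covD h w (1, 0) (cubic h w)) z) := by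
  have h1 := (hw.toIsPeriodicMap.covD (h := h) hw.periodicField_lowerVel (1, 0)).smooth
  rw [hw.covD_congr_on (Y := β • jet h w 3 + covD h w (1, 0) (lowerVel h α β w))
      (fun z hz => (hw.covD_vel hz).trans
        (congrArg (β • jet h w 3 z + ·) (hw.covD_lowerVel hz).symm)) hz,
    hw.smooth.covD_add (hw.smooth.smooth_smul β (hw.jet 3).smooth) h1 hz,
    hw.smooth.covD_smul β (hw.jet 3).smooth hz, hw.covD_covD_lowerVel hz]
  rfl

/-- `∇_t w_x = ∇_x w_t`. -/
lemma covD_time_jet_zero {z : ℝ × ℝ} (hz : z ∈ Ω) :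
    covD h w (0, 1) (jet h w 0) z = covD h w (1, 0) (vel E w (0, 1)) z :=
  hw.smooth.covD_vel_comm hz _ _

/-- The curvature term `R(w_t, w_x) w_x`. -/
def curvVel (h : Metric E N) (w : ℝ × ℝ → N) (z : ℝ × ℝ) : E :=
  curvatureAt h (w z) (vel E w (0, 1) z) (jet h w 0 z) (jet h w 0 z)

lemma periodicField_curvVel : IsPeriodicField w Ω τ (curvVel h w) :=
  hw.toIsPeriodicMap.curvature (hw.vel _) (hw.jet 0) (hw.jet 0)

/-- The Ricci identity: moving ∇_t past ∇_x costs R(w_t, w_x). -/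
lemma covD_time_jet_succ {k : ℕ} {z : ℝ × ℝ} (hz : z ∈ Ω) :
    covD h w (0, 1) (jet h w (k + 1)) z = covD h w (1, 0) (covD h w (0, 1) (jet h w k)) z
      + curvatureAt h (w z) (vel E w (0, 1) z) (jet h w 0 z) (jet h w k z) := by
  have h1 := hw.smooth.covD_covD_sub (h := h) (hw.jet (h := h) k).smooth hz (0, 1) (1, 0)
  rw [sub_eq_iff_eq_add'] at h1
  exact h1

lemma covD_time_jet_one {z : ℝ × ℝ} (hz : z ∈ Ω) :
    covD h w (0, 1) (jet h w 1) z = covD h w (1, 0) (covD h w (1, 0) (vel E w (0, 1))) z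
      + curvVel h w z := by
  rw [hw.covD_time_jet_succ hz, hw.covD_congr_on (fun z hz => hw.covD_time_jet_zero hz) hz]
  rfl

lemma covD_time_jet_two {z : ℝ × ℝ} (hz : z ∈ Ω) :
    covD h w (0, 1) (jet h w 2) z =
      covD h w (1, 0) (covD h w (1, 0) (covD h w (1, 0) (vel E w (0, 1)))) z
      + covD h w (1, 0) (curvVel h w) z
      + curvatureAt h (w z) (vel E w (0, 1) z) (jet h w 0 z) (jet h w 1 z) := by
  rw [hw.covD_time_jet_succ hz, hw.covD_congr_on (Y :=
    covD h w (1, 0) (covD h w (1, 0) (vel E w (0, 1))) + curvVel h w)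
    (fun z hz => hw.covD_time_jet_one hz) hz, hw.smooth.covD_add
    (hw.toIsPeriodicMap.covD (hw.toIsPeriodicMap.covD (hw.vel _) _) _).smooth
    hw.periodicField_curvVel.smooth hz]

lemma covD_cubic {z : ℝ × ℝ} (hz : z ∈ Ω) :
    covD h w (1, 0) (cubic h w) z =
      curvSym h (w z) (jet h w 1 z) (jet h w 0 z) (jet h w 0 z)
      + curvSym h (w z) (jet h w 0 z) (jet h w 1 z) (jet h w 0 z)
      + curvSym h (w z) (jet h w 0 z) (jet h w 0 z) (jet h w 1 z) :=
  hw.smooth.covD_curvSym hw.symmetric (hw.jet 0).smooth (hw.jet 0).smooth (hw.jet 0).smooth hz _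

lemma covD_covD_cubic {z : ℝ × ℝ} (hz : z ∈ Ω) :
    covD h w (1, 0) (covD h w (1, 0) (cubic h w)) z =
      (curvSym h (w z) (jet h w 2 z) (jet h w 0 z) (jet h w 0 z)
        + curvSym h (w z) (jet h w 1 z) (jet h w 1 z) (jet h w 0 z)
        + curvSym h (w z) (jet h w 1 z) (jet h w 0 z) (jet h w 1 z))
      + (curvSym h (w z) (jet h w 1 z) (jet h w 1 z) (jet h w 0 z)
        + curvSym h (w z) (jet h w 0 z) (jet h w 2 z) (jet h w 0 z)
        + curvSym h (w z) (jet h w 0 z) (jet h w 1 z) (jet h w 1 z))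
      + (curvSym h (w z) (jet h w 1 z) (jet h w 0 z) (jet h w 1 z)
        + curvSym h (w z) (jet h w 0 z) (jet h w 1 z) (jet h w 1 z)
        + curvSym h (w z) (jet h w 0 z) (jet h w 0 z) (jet h w 2 z)) := by
  have c : ∀ i j k : ℕ, IsPeriodicField w Ω τ
      (fun z => curvSym h (w z) (jet h w i z) (jet h w j z) (jet h w k z)) := fun i j k =>
    hw.toIsPeriodicMap.curvSym (hw.jet i) (hw.jet j) (hw.jet k)
  have d : ∀ i j k : ℕ, covD h w (1, 0)
      (fun z => curvSym h (w z) (jet h w i z) (jet h w j z) (jet h w k z)) z =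
      curvSym h (w z) (jet h w (i + 1) z) (jet h w j z) (jet h w k z)
      + curvSym h (w z) (jet h w i z) (jet h w (j + 1) z) (jet h w k z)
      + curvSym h (w z) (jet h w i z) (jet h w j z) (jet h w (k + 1) z) := fun i j k =>
    hw.smooth.covD_curvSym hw.symmetric (hw.jet i).smooth (hw.jet j).smooth (hw.jet k).smooth hz _
  rw [hw.covD_congr_on (Y :=
    ((fun z => curvSym h (w z) (jet h w 1 z) (jet h w 0 z) (jet h w 0 z))
      + fun z => curvSym h (w z) (jet h w 0 z) (jet h w 1 z) (jet h w 0 z))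
      + fun z => curvSym h (w z) (jet h w 0 z) (jet h w 0 z) (jet h w 1 z))
      (fun z hz => hw.covD_cubic hz) hz,
    hw.smooth.covD_add (hw.toIsPeriodicMap.add (c 1 0 0) (c 0 1 0)).smooth (c 0 0 1).smooth hz,
    hw.smooth.covD_add (c 1 0 0).smooth (c 0 1 0).smooth hz, d, d, d]

/-- The energy density `|w_x|²` is conserved up to an exact term. -/
lemma exact_fderiv_energyOne :
    IsExactOn Ω τ (fun z => fderiv ℝ (fun z => metricAt h (w z) (jet h w 0 z) (jet h w 0 z)) z
      (0, 1)) := by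
  have hK := hw.symmetric.toIsKahler
  have x1 := hw.exact_inner (h := h) (hw.vel (0, 1)) (hw.jet (h := h) 0) (fun _ _ => rfl)
    (fun _ _ => rfl)
  have x2 := hw.exact_inner (h := h) (hw.jet (h := h) 1) (hw.jet (h := h) 1) (fun _ _ => rfl)
    (fun _ _ => rfl)
  have x3 := hw.exact_curvForm hw.symmetric (hw.jet (h := h) 0) (hw.jet (h := h) 0)
    (hw.jet (h := h) 0) (hw.jet (h := h) 0) (fun _ _ => rfl) (fun _ _ => rfl) (fun _ _ => rfl)
    (fun _ _ => rfl)
  -- From ∂_t|c|² = 2∂_x⟨w_t, c⟩ − 2⟨w_t, b⟩. In the last product the α-term is ⟨Jb, b⟩ = 0, the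
  -- term β⟨a, b⟩ is half the derivative of β|b|², and βS(c,c;c,b) is a quarter of that of
  -- βS(c,c;c,c).
  refine (((x1.smul 2).add (x2.smul (-β))).add (x3.smul (-(β / 2)))).congr fun z hz => ?_
  rw [hw.smooth.fderiv_inner (hw.jet 0).smooth (hw.jet 0).smooth hz, hw.covD_time_jet_zero hz]
  simp only [Pi.add_apply, Pi.smul_apply, smul_eq_mul]
  have e1 : covD h w (1, 0) (jet h w 0) z = jet h w 1 z := rfl
  have e2 : covD h w (1, 0) (jet h w 1) z = jet h w 2 z := rfl
  rw [hw.flow z hz, e1, e2]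
  simp only [lowerVel, map_add, map_smul, add_apply, smul_apply, Pi.add_apply, Pi.smul_apply,
    smul_eq_mul]
  have e3 : metricAt h (w z) (cubic h w z) (jet h w 1 z)
    = curvForm h (w z) (jet h w 0 z) (jet h w 0 z) (jet h w 0 z) (jet h w 1 z) := rfl
  rw [e3, metricAt_mulI_self hK, metricAt_symm (jet h w 0 z), metricAt_symm (jet h w 1 z),
    curvForm_pair hK _ (jet h w 1 z), curvForm_pair hK _ (jet h w 0 z) (jet h w 1 z),
    curvForm_swap_right hK _ _ _ (jet h w 1 z)]
  ring

end IsFlowOn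

end EnergyIdentity

/-! ### The derivative of E₄ modulo exact terms, and the cancellation of the |a|²|b||c| terms. -/

section EnergyFourIdentity

variable {E : Type*} [NormedAddCommGroup E] [NormedSpace ℂ E] [FiniteDimensional ℂ E]
variable {N : Type*} [TopologicalSpace N] [ChartedSpace E N] [IsManifold 𝓘(ℂ, E) ω N]
variable {h : Metric E N} {w : ℝ × ℝ → N} {Ω : Set (ℝ × ℝ)} {τ : ℝ × ℝ}

lemma curvForm_add (q : N) (X X' Y Z W : E) :
    (curvForm h q (X + X') Y Z W = curvForm h q X Y Z W + curvForm h q X' Y Z W) ∧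
    (curvForm h q Y (X + X') Z W = curvForm h q Y X Z W + curvForm h q Y X' Z W) ∧
    (curvForm h q Y Z (X + X') W = curvForm h q Y Z X W + curvForm h q Y Z X' W) ∧
    (curvForm h q Y Z W (X + X') = curvForm h q Y Z W X + curvForm h q Y Z W X') := by
  simp only [curvForm, curvSym_add_left, curvSym_add_mid, curvSym_add_right, map_add, add_apply,
    and_self]

lemma curvForm_smul (q : N) (c : ℝ) (X Y Z W : E) :
    (curvForm h q (c • X) Y Z W = c * curvForm h q X Y Z W) ∧
    (curvForm h q Y (c • X) Z W = c * curvForm h q Y X Z W) ∧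
    (curvForm h q Y Z (c • X) W = c * curvForm h q Y Z X W) ∧
    (curvForm h q Y Z W (c • X) = c * curvForm h q Y Z W X) := by
  simp only [curvForm, curvSym_smul_left, curvSym_smul_mid, curvSym_smul_right, map_smul,
    smul_apply, smul_eq_mul, and_self]

lemma metricAt_curvatureAt (hK : IsKahler h) (q : N) (X Y Z W : E) :
    metricAt h q (curvatureAt h q X Y Z) W = curvForm h q X Z Y W - curvForm h q Y Z X W := by
  rw [curvatureAt_eq_curvSym hK, map_sub, sub_apply, curvForm, curvForm]

/-- The density of the functional `E₄`. -/
def energyFourDensity (h : Metric E N) (w : ℝ × ℝ → N) (z : ℝ × ℝ) : ℝ :=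
  2 * metricAt h (w z) (jet h w 2 z) (jet h w 2 z)
  - 8 * curvForm h (w z) (jet h w 1 z) (jet h w 0 z) (jet h w 1 z) (jet h w 0 z)
  - 2 * curvForm h (w z) (jet h w 0 z) (jet h w 0 z) (jet h w 1 z) (jet h w 1 z)

open IsFlowOn in
/-- The terms of lower order in the derivative of `E₄`. -/
def energyFourRest (h : Metric E N) (α β : ℝ) (w : ℝ × ℝ → N) (z : ℝ × ℝ) : ℝ :=
  let S := curvForm h (w z)
  let c := jet h w 0 z
  let b := jet h w 1 z
  let a := jet h w 2 z
  let Ia := mulI E a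
  let q := lowerVel h α β w z
  let q' := dLowerVel h α β w z
  let r := curvVel h w z
  let F := covD h w (1, 0) (covD h w (1, 0) (cubic h w)) z
  4 * (6 * β * S b b b a + (S q' c c a + S q b c a + S q c b a - S b c q a - S c b q a - S c c q' a)
      + (S q b c a - S c b q a))
  - 8 * (2 * β * S b b b a - 2 * α * (S Ia b b c + S Ia c a c + S Ia c b b)
      + 2 * β * S F c b c + 2 * S r c b c + 2 * S b q' b c)
  - 2 * (2 * β * S b b b a - 2 * α * (2 * S b c b Ia + S c c a Ia)
      + 2 * β * S c c b F + 2 * S c c b r + 2 * S c q' b b)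

namespace IsFlowOn

variable {α β : ℝ} (hw : IsFlowOn h α β w Ω τ)
include hw

/-- The core of the proof. Give the density the form 2|a|² − pS(b,c;b,c) − sS(c,c;b,b). After all
terms with d or higher derivatives are integrated by parts, the terms quadratic in a and linear in b
and c are β(48 − 6p)S(a,b;a,c) + β(12 − 6s)S(b,c;a,a). The density of E₄ has p = 8 and s = 2, so
both vanish. Everything else is collected in `energyFourRest`. -/
lemma exact_energyFour_time_sub_rest :
    IsExactOn Ω τ (fun z =>
      (4 * metricAt h (w z) (covD h w (0, 1) (jet h w 2) z) (jet h w 2 z)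
        - 8 * (2 * curvForm h (w z) (covD h w (0, 1) (jet h w 1) z) (jet h w 0 z)
              (jet h w 1 z) (jet h w 0 z)
            + 2 * curvForm h (w z) (jet h w 1 z) (covD h w (0, 1) (jet h w 0) z)
              (jet h w 1 z) (jet h w 0 z))
        - 2 * (2 * curvForm h (w z) (jet h w 0 z) (jet h w 0 z)
              (jet h w 1 z) (covD h w (0, 1) (jet h w 1) z)
            + 2 * curvForm h (w z) (jet h w 0 z) (covD h w (0, 1) (jet h w 0) z)
              (jet h w 1 z) (jet h w 1 z)))
      - energyFourRest h α β w z) := by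
  have hN := hw.symmetric
  have hK := hN.toIsKahler
  have c := hw.jet (h := h) 0
  have b := hw.jet (h := h) 1
  have a := hw.jet (h := h) 2
  have d := hw.jet (h := h) 3
  have Ia := hw.toIsPeriodicMap.mulI a
  have q := hw.periodicField_lowerVel
  have v := hw.vel (0, 1)
  have Dc : ∀ z ∈ Ω, covD h w (1, 0) (jet h w 0) z = jet h w 1 z := fun _ _ => rfl
  have Db : ∀ z ∈ Ω, covD h w (1, 0) (jet h w 1) z = jet h w 2 z := fun _ _ => rfl
  have Da : ∀ z ∈ Ω, covD h w (1, 0) (jet h w 2) z = jet h w 3 z := fun _ _ => rfl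
  have Dd : ∀ z ∈ Ω, covD h w (1, 0) (jet h w 3) z = jet h w 4 z := fun _ _ => rfl
  have DIa : ∀ z ∈ Ω, covD h w (1, 0) (fun z => mulI E (jet h w 2 z)) z = mulI E (jet h w 3 z) :=
    fun z hz => hw.smooth.covD_mulI hK a.smooth hz _
  -- x1 to x6 treat ⟨∇_t a, a⟩: they shift derivatives until the fourth and fifth ones disappear and
  -- leave curvature terms paired with d.
  have x1 := hw.exact_inner (hw.covD (h := h) (hw.covD (h := h) v (1, 0)) (1, 0)) a
    (fun _ _ => rfl) Da
  have x2 := hw.exact_inner (hw.covD (h := h) v (1, 0)) d (fun _ _ => rfl) Dd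
  have x3 := hw.exact_inner hw.periodicField_curvVel a (fun _ _ => rfl) Da
  have x4 := hw.exact_inner Ia d DIa Dd
  have x5 := hw.exact_inner d d Dd Dd
  have x6 := hw.exact_inner (hw.covD (h := h) hw.periodicField_cubic (1, 0)) d
    (fun _ _ => rfl) Dd
  -- x7 to x12 remove the curvature terms linear in d. x13 to x16 lower the order of the terms with
  -- ∇_x d or Jd that come from the two curvature corrections.
  have x7 := hw.exact_curvForm hN c a c a Dc Da Dc Da
  have x8 := hw.exact_curvForm hN c c a a Dc Dc Da Da
  have x9 := hw.exact_curvForm hN b b c a Db Db Dc Da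
  have x10 := hw.exact_curvForm hN b c b a Db Dc Db Da
  have x11 := hw.exact_curvForm hN q c c a (fun z hz => hw.covD_lowerVel hz) Dc Dc Da
  have x12 := hw.exact_curvForm hN c c q a Dc Dc (fun z hz => hw.covD_lowerVel hz) Da
  have x13 := hw.exact_curvForm hN d c b c Dd Dc Db Dc
  have x14 := hw.exact_curvForm hN Ia c b c DIa Dc Db Dc
  have x15 := hw.exact_curvForm hN c c b d Dc Dc Db Dd
  have x16 := hw.exact_curvForm hN c c b Ia Dc Dc Db DIa
  refine (((((((((((((((((x1.smul 4).add (x2.smul (-4))).add (x3.smul 4)).add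
    (x4.smul (4 * α))).add (x5.smul (2 * β))).add (x6.smul (4 * β))).add (x7.smul (2 * β))).add
    (x8.smul (2 * β))).add (x9.smul (4 * β))).add (x10.smul (-8 * β))).add (x11.smul (-4))).add
    (x12.smul 4)).add (x13.smul (-16 * β))).add (x14.smul (-16 * α))).add
    (x15.smul (-4 * β))).add (x16.smul (-4 * α)))).congr fun z hz => ?_
  rw [hw.covD_time_jet_two hz, hw.covD_time_jet_one hz, hw.covD_time_jet_zero hz]
  simp only [Pi.add_apply, Pi.smul_apply, smul_eq_mul]
  rw [hw.covD_covD_vel hz, hw.covD_vel hz]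
  have er : metricAt h (w z) (curvVel h w z) (jet h w 3 z)
      = curvForm h (w z) (vel E w (0, 1) z) (jet h w 0 z) (jet h w 0 z) (jet h w 3 z)
      - curvForm h (w z) (jet h w 0 z) (jet h w 0 z) (vel E w (0, 1) z) (jet h w 3 z) :=
    metricAt_curvatureAt hK _ _ _ _ _
  have eF : metricAt h (w z) (covD h w (1, 0) (covD h w (1, 0) (cubic h w)) z) (jet h w 3 z) =
      (curvForm h (w z) (jet h w 2 z) (jet h w 0 z) (jet h w 0 z) (jet h w 3 z)
        + curvForm h (w z) (jet h w 1 z) (jet h w 1 z) (jet h w 0 z) (jet h w 3 z)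
        + curvForm h (w z) (jet h w 1 z) (jet h w 0 z) (jet h w 1 z) (jet h w 3 z))
      + (curvForm h (w z) (jet h w 1 z) (jet h w 1 z) (jet h w 0 z) (jet h w 3 z)
        + curvForm h (w z) (jet h w 0 z) (jet h w 2 z) (jet h w 0 z) (jet h w 3 z)
        + curvForm h (w z) (jet h w 0 z) (jet h w 1 z) (jet h w 1 z) (jet h w 3 z))
      + (curvForm h (w z) (jet h w 1 z) (jet h w 0 z) (jet h w 1 z) (jet h w 3 z)
        + curvForm h (w z) (jet h w 0 z) (jet h w 1 z) (jet h w 1 z) (jet h w 3 z)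
        + curvForm h (w z) (jet h w 0 z) (jet h w 0 z) (jet h w 2 z) (jet h w 3 z)) := by
    rw [hw.covD_covD_cubic hz]
    simp only [map_add, add_apply]
    rfl
  have eI := metricAt_mulI_self (q := w z) hK (jet h w 3 z)
  have eS := metricAt_symm (h := h) (q := w z)
  have ec : metricAt h (w z) (curvatureAt h (w z) (vel E w (0, 1) z) (jet h w 0 z) (jet h w 1 z))
      (jet h w 2 z)
      = curvForm h (w z) (β • jet h w 2 z + lowerVel h α β w z) (jet h w 1 z) (jet h w 0 z)
        (jet h w 2 z)
      - curvForm h (w z) (jet h w 0 z) (jet h w 1 z) (β • jet h w 2 z + lowerVel h α β w z)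
        (jet h w 2 z) := by
    rw [metricAt_curvatureAt hK, hw.flow z hz]
  rw [hw.flow z hz] at er
  have ed : metricAt h (w z) (dLowerVel h α β w z) (jet h w 4 z) =
      α * metricAt h (w z) (mulI E (jet h w 2 z)) (jet h w 4 z)
      + β * metricAt h (w z) (covD h w (1, 0) (cubic h w) z) (jet h w 4 z) := by
    simp only [dLowerVel, Pi.add_apply, Pi.smul_apply, map_add, add_apply, map_smul, smul_apply,
      smul_eq_mul]
  simp only [map_add, add_apply, map_smul, smul_apply, smul_eq_mul, (curvForm_add _ _ _ _ _ _).1,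
    (curvForm_add _ _ _ _ _ _).2.1, (curvForm_add _ _ _ _ _ _).2.2.1,
    (curvForm_add _ _ _ _ _ _).2.2.2, (curvForm_smul _ _ _ _ _ _).1,
    (curvForm_smul _ _ _ _ _ _).2.1, (curvForm_smul _ _ _ _ _ _).2.2.1,
    (curvForm_smul _ _ _ _ _ _).2.2.2, ed, eF, eI, er, ec, energyFourRest]
  have sl := curvForm_swap_left hK (w z)
  have sr := curvForm_swap_right hK (w z)
  have sp := curvForm_pair hK (w z)
  generalize jet h w 0 z = c at *
  generalize jet h w 1 z = b at *
  generalize jet h w 2 z = a at *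
  generalize jet h w 3 z = d at *
  generalize jet h w 4 z = f at *
  generalize lowerVel h α β w z = q at *
  generalize dLowerVel h α β w z = q' at *
  generalize curvVel h w z = r at *
  generalize covD h w (1, 0) (covD h w (1, 0) (cubic h w)) z = F at *
  generalize covD h w (1, 0) (cubic h w) z = F' at *
  generalize mulI E a = Ia at *
  generalize mulI E d = Id at *
  generalize curvForm h (w z) = S at *
  clear er ec eF ed eI
  rw [eS f d]
  -- The three symmetries of S, used as ordered rewriting, sort the arguments of every term; what
  -- remains is linear algebra in the values of S.
  simp only [sl, sr, sp]
  ring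

lemma contDiffAt_energyFourDensity {z : ℝ × ℝ} (hz : z ∈ Ω) :
    ContDiffAt ℝ ∞ (energyFourDensity h w) z := by
  have c := hw.jet (h := h) 0
  have b := hw.jet (h := h) 1
  have a := hw.jet (h := h) 2
  exact ((contDiffAt_const.mul (hw.smooth.contDiffAt_inner a.smooth a.smooth hz)).sub
    (contDiffAt_const.mul
      (hw.smooth.contDiffAt_inner (hw.toIsPeriodicMap.curvSym b c b).smooth c.smooth hz))).sub
    (contDiffAt_const.mul
      (hw.smooth.contDiffAt_inner (hw.toIsPeriodicMap.curvSym c c b).smooth b.smooth hz))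

/-- Up to an exact term, the derivative of the density of `E₄` along the flow is of lower order. -/
lemma exact_fderiv_energyFourDensity_sub_rest :
    IsExactOn Ω τ (fun z => fderiv ℝ (energyFourDensity h w) z (0, 1)
      - energyFourRest h α β w z) := by
  refine hw.exact_energyFour_time_sub_rest.congr fun z hz => ?_
  have hN := hw.symmetric
  have hK := hN.toIsKahler
  have c := hw.jet (h := h) 0
  have b := hw.jet (h := h) 1
  have a := hw.jet (h := h) 2
  have d1 := (hw.smooth.contDiffAt_inner (h := h) a.smooth a.smooth hz).differentiableAt (by simp)
  have d2 := (hw.smooth.contDiffAt_inner (h := h)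
    (hw.toIsPeriodicMap.curvSym (h := h) b c b).smooth c.smooth hz).differentiableAt (by simp)
  have d3 := (hw.smooth.contDiffAt_inner (h := h)
    (hw.toIsPeriodicMap.curvSym (h := h) c c b).smooth b.smooth hz).differentiableAt (by simp)
  have e1 := hw.smooth.fderiv_inner (h := h) a.smooth a.smooth hz (0, 1)
  have e2 := hw.fderiv_curvForm hN b c b c hz (0, 1)
  have e3 := hw.fderiv_curvForm hN c c b b hz (0, 1)
  have e : fderiv ℝ (energyFourDensity h w) z (0, 1) =
      2 * fderiv ℝ (fun z => metricAt h (w z) (jet h w 2 z) (jet h w 2 z)) z (0, 1)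
      - 8 * fderiv ℝ (fun z => curvForm h (w z) (jet h w 1 z) (jet h w 0 z) (jet h w 1 z)
        (jet h w 0 z)) z (0, 1)
      - 2 * fderiv ℝ (fun z => curvForm h (w z) (jet h w 0 z) (jet h w 0 z) (jet h w 1 z)
        (jet h w 1 z)) z (0, 1) := by
    have := ((d1.hasFDerivAt.const_mul 2).sub (d2.hasFDerivAt.const_mul 8)).sub
      (d3.hasFDerivAt.const_mul 2)
    exact congrArg (fun L : ℝ × ℝ →L[ℝ] ℝ => L (0, 1)) this.fderiv
  rw [e, e1, e2, e3]
  have eS := metricAt_symm (h := h) (q := w z)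
  have sl := curvForm_swap_left hK (w z)
  have sr := curvForm_swap_right hK (w z)
  have sp := curvForm_pair hK (w z)
  rw [eS (jet h w 2 z) (covD h w (0, 1) (jet h w 2) z)]
  simp only [sl, sr, sp]
  ring

end IsFlowOn

end EnergyFourIdentity

/-! ### Pointwise bounds for the lower-order fields, given |u_x| ≤ V. -/

section PointwiseEstimates

variable {E : Type*} [NormedAddCommGroup E] [NormedSpace ℂ E] [FiniteDimensional ℂ E]
variable {N : Type*} [TopologicalSpace N] [ChartedSpace E N] [IsManifold 𝓘(ℂ, E) ω N]
variable {h : Metric E N} {w : ℝ × ℝ → N} {Ω : Set (ℝ × ℝ)} {τ : ℝ × ℝ} {M : ℝ}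

lemma CurvatureBoundedBy.abs_curvForm_le (hM : CurvatureBoundedBy h M) (hK : IsKahler h) {q : N}
    {X Z Y W : E} {x z y v : ℝ} (hX : normAt h q X ≤ x) (hZ : normAt h q Z ≤ z)
    (hY : normAt h q Y ≤ y) (hW : normAt h q W ≤ v) :
    |curvForm h q X Z Y W| ≤ M * x * z * y * v := by
  have n := fun v => normAt_nonneg (h := h) (q := q) v
  have hM0 := hM.1
  have hx := (n X).trans hX
  have hz := (n Z).trans hZ
  have hy := (n Y).trans hY
  calc |curvForm h q X Z Y W| ≤ normAt h q (curvSym h q X Z Y) * normAt h q W :=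
        abs_metricAt_le _ _
    _ ≤ (M * normAt h q X * normAt h q Z * normAt h q Y) * normAt h q W :=
        mul_le_mul_of_nonneg_right (hM.curvSym_le hK X Z Y) (n W)
    _ ≤ M * x * z * y * v := by
        have := n X
        have := n Y
        have := n Z
        have := n W
        gcongr

namespace IsFlowOn

variable {α β V : ℝ}

lemma normAt_lowerVel_le (hM : CurvatureBoundedBy h M) (hK : IsKahler h) {z : ℝ × ℝ}
    (hV : normAt h (w z) (jet h w 0 z) ≤ V) :
    normAt h (w z) (lowerVel h α β w z) ≤
      (|α| + |β| * M * V ^ 3) * (normAt h (w z) (jet h w 1 z) + 1) := by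
  have n := fun v => normAt_nonneg (h := h) (q := w z) v
  have hM0 := hM.1
  have hV0 := (n _).trans hV
  have h1 : normAt h (w z) (cubic h w z) ≤ M * V * V * V := by
    refine (hM.curvSym_le hK _ _ _).trans ?_
    have := n (jet h w 0 z)
    gcongr
  have h2 : normAt h (w z) (lowerVel h α β w z) ≤
      |α| * normAt h (w z) (jet h w 1 z) + |β| * normAt h (w z) (cubic h w z) := by
    refine (normAt_add_le _ _).trans (le_of_eq ?_)
    simp only [Pi.smul_apply, normAt_smul, normAt_mulI hK]
  have h3 := mul_le_mul_of_nonneg_left h1 (abs_nonneg β)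
  have h4 := mul_nonneg (mul_nonneg (mul_nonneg (abs_nonneg β) hM0) (pow_nonneg hV0 3))
    (n (jet h w 1 z))
  have h5 := abs_nonneg α
  nlinarith

variable (hw : IsFlowOn h α β w Ω τ)
include hw

lemma normAt_dLowerVel_le (hM : CurvatureBoundedBy h M) {z : ℝ × ℝ} (hz : z ∈ Ω)
    (hV : normAt h (w z) (jet h w 0 z) ≤ V) :
    normAt h (w z) (dLowerVel h α β w z) ≤ (|α| + 3 * |β| * M * V ^ 2) *
      (normAt h (w z) (jet h w 2 z) + normAt h (w z) (jet h w 1 z)) := by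
  have hK := hw.symmetric.toIsKahler
  have n := fun v => normAt_nonneg (h := h) (q := w z) v
  have hM0 := hM.1
  have hV0 := (n _).trans hV
  have hc := n (jet h w 0 z)
  have hb := n (jet h w 1 z)
  have ha := n (jet h w 2 z)
  have b1 : normAt h (w z) (curvSym h (w z) (jet h w 1 z) (jet h w 0 z) (jet h w 0 z))
      ≤ M * normAt h (w z) (jet h w 1 z) * V * V :=
    (hM.curvSym_le hK _ _ _).trans (by gcongr)
  have b2 : normAt h (w z) (curvSym h (w z) (jet h w 0 z) (jet h w 1 z) (jet h w 0 z))
      ≤ M * V * normAt h (w z) (jet h w 1 z) * V :=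
    (hM.curvSym_le hK _ _ _).trans (by gcongr)
  have b3 : normAt h (w z) (curvSym h (w z) (jet h w 0 z) (jet h w 0 z) (jet h w 1 z))
      ≤ M * V * V * normAt h (w z) (jet h w 1 z) :=
    (hM.curvSym_le hK _ _ _).trans (by gcongr)
  have h1 : normAt h (w z) (covD h w (1, 0) (cubic h w) z) ≤
      3 * M * V ^ 2 * normAt h (w z) (jet h w 1 z) := by
    rw [hw.covD_cubic hz]
    refine (normAt_add_le _ _).trans ?_
    have := normAt_add_le (h := h) (q := w z)
      (curvSym h (w z) (jet h w 1 z) (jet h w 0 z) (jet h w 0 z))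
      (curvSym h (w z) (jet h w 0 z) (jet h w 1 z) (jet h w 0 z))
    linarith
  have h2 : normAt h (w z) (dLowerVel h α β w z) ≤ |α| * normAt h (w z) (jet h w 2 z)
      + |β| * normAt h (w z) (covD h w (1, 0) (cubic h w) z) := by
    refine (normAt_add_le _ _).trans (le_of_eq ?_)
    simp only [Pi.smul_apply, normAt_smul, normAt_mulI hK]
  have h3 := mul_le_mul_of_nonneg_left h1 (abs_nonneg β)
  have h4 := mul_nonneg (mul_nonneg (mul_nonneg (abs_nonneg β) hM0) (pow_nonneg hV0 2)) ha
  have h5 := mul_nonneg (abs_nonneg α) hb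
  linarith

lemma normAt_covD_covD_cubic_le (hM : CurvatureBoundedBy h M) {z : ℝ × ℝ} (hz : z ∈ Ω)
    (hV : normAt h (w z) (jet h w 0 z) ≤ V) :
    normAt h (w z) (covD h w (1, 0) (covD h w (1, 0) (cubic h w)) z) ≤
      (3 * M * V ^ 2 + 6 * M * V) *
      (normAt h (w z) (jet h w 2 z) + normAt h (w z) (jet h w 1 z) ^ 2) := by
  have hK := hw.symmetric.toIsKahler
  have n := fun v => normAt_nonneg (h := h) (q := w z) v
  have t := fun v v' => normAt_add_le (h := h) (q := w z) v v'
  have hM0 := hM.1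
  have hV0 := (n _).trans hV
  have hc := n (jet h w 0 z)
  have hb := n (jet h w 1 z)
  have ha := n (jet h w 2 z)
  have A : ∀ {i j k : ℕ} {x y v : ℝ}, normAt h (w z) (jet h w i z) ≤ x →
      normAt h (w z) (jet h w j z) ≤ y → normAt h (w z) (jet h w k z) ≤ v →
      normAt h (w z) (curvSym h (w z) (jet h w i z) (jet h w j z) (jet h w k z))
        ≤ M * x * y * v := by
    intro i j k x y v hx hy hv
    have hi := n (jet h w i z)
    have hj := n (jet h w j z)
    have hk := n (jet h w k z)
    have hx0 := hi.trans hx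
    have hy0 := hj.trans hy
    exact (hM.curvSym_le hK _ _ _).trans (by gcongr)
  have a0 := A (i := 2) le_rfl hV hV
  have a1 := A (j := 2) hV le_rfl hV
  have a2 := A (k := 2) hV hV le_rfl
  have b0 := A (i := 1) (j := 1) le_rfl le_rfl hV
  have b1 := A (i := 1) (k := 1) le_rfl hV le_rfl
  have b2 := A (j := 1) (k := 1) hV le_rfl le_rfl
  rw [hw.covD_covD_cubic hz]
  have h4 := mul_nonneg (mul_nonneg hM0 (pow_nonneg hV0 2))
    (sq_nonneg (normAt h (w z) (jet h w 1 z)))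
  have h5 := mul_nonneg (mul_nonneg hM0 hV0) ha
  calc _ ≤ _ := (t _ _).trans (add_le_add ((t _ _).trans (add_le_add
        ((t _ _).trans (add_le_add ((t _ _).trans (add_le_add a0 b0)) b1))
        ((t _ _).trans (add_le_add ((t _ _).trans (add_le_add b0 a1)) b2))))
        ((t _ _).trans (add_le_add ((t _ _).trans (add_le_add b1 b2)) a2)))
    _ ≤ _ := by linarith

lemma normAt_curvVel_le (hM : CurvatureBoundedBy h M) {z : ℝ × ℝ} (hz : z ∈ Ω)
    (hV : normAt h (w z) (jet h w 0 z) ≤ V) :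
    normAt h (w z) (curvVel h w z) ≤ (M * V ^ 2 * (|β| + (|α| + |β| * M * V ^ 3))) *
      (normAt h (w z) (jet h w 2 z) + normAt h (w z) (jet h w 1 z) + 1) := by
  have hK := hw.symmetric.toIsKahler
  have n := fun v => normAt_nonneg (h := h) (q := w z) v
  have hM0 := hM.1
  have hV0 := (n _).trans hV
  have hc := n (jet h w 0 z)
  have hb := n (jet h w 1 z)
  have ha := n (jet h w 2 z)
  have hq := normAt_lowerVel_le (α := α) (β := β) hM hK hV
  have hvel : normAt h (w z) (vel E w (0, 1) z) ≤ (|β| + (|α| + |β| * M * V ^ 3)) *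
      (normAt h (w z) (jet h w 2 z) + normAt h (w z) (jet h w 1 z) + 1) := by
    rw [hw.flow z hz]
    refine (normAt_add_le _ _).trans ?_
    rw [normAt_smul]
    have h1 : 0 ≤ |α| + |β| * M * V ^ 3 := by positivity
    have h2 := mul_nonneg h1 ha
    have h3 := mul_nonneg (abs_nonneg β) (add_nonneg hb zero_le_one)
    linarith
  calc _ ≤ M * normAt h (w z) (vel E w (0, 1) z) * normAt h (w z) (jet h w 0 z)
        * normAt h (w z) (jet h w 0 z) := hM.2 _ _ _ _
    _ ≤ M * ((|β| + (|α| + |β| * M * V ^ 3)) *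
      (normAt h (w z) (jet h w 2 z) + normAt h (w z) (jet h w 1 z) + 1)) * V * V := by
        have := n (vel E w (0, 1) z)
        gcongr
    _ = _ := by ring

end IsFlowOn

end PointwiseEstimates

/-! ### Pointwise bound for the remainder by 1 + |a|² + |b|⁴ + |a||b|³. -/

section RestEstimate

/-- Weighted monomials bounded by the leading terms in the derivative of `E₄`. -/
lemma monomials_le {x y : ℝ} (hx : 0 ≤ x) (hy : 0 ≤ y) :
    let Q := 1 + x ^ 2 + y ^ 4 + x * y ^ 3
    x * y ^ 3 ≤ 3 * Q ∧ (x + y) * x ≤ 3 * Q ∧ (y + 1) * y * x ≤ 3 * Q ∧ x * y ^ 2 ≤ 3 * Q ∧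
      x ^ 2 ≤ 3 * Q ∧ (x + y ^ 2) * y ≤ 3 * Q ∧ (x + y + 1) * y ≤ 3 * Q ∧
      (x + y) * y ^ 2 ≤ 3 * Q := by
  have xy3 : 0 ≤ x * y ^ 3 := by positivity
  have y2 : y ^ 2 ≤ (1 + y ^ 4) / 2 := by nlinarith [sq_nonneg (y ^ 2 - 1)]
  have y3 : y ^ 3 ≤ (y ^ 2 + y ^ 4) / 2 := by nlinarith [sq_nonneg (y ^ 2 - y)]
  have xy : x * y ≤ (x ^ 2 + y ^ 2) / 2 := by nlinarith [sq_nonneg (x - y)]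
  have xyy : x * y ^ 2 ≤ (x ^ 2 + y ^ 4) / 2 := by nlinarith [sq_nonneg (x - y ^ 2)]
  have y1 : y ≤ (1 + y ^ 2) / 2 := by nlinarith [sq_nonneg (y - 1)]
  have x0 := sq_nonneg x
  have y0 : 0 ≤ y ^ 4 := by positivity
  refine ⟨?_, ?_, ?_, ?_, ?_, ?_, ?_, ?_⟩ <;> linarith

variable {E : Type*} [NormedAddCommGroup E] [NormedSpace ℂ E] [FiniteDimensional ℂ E]
variable {N : Type*} [TopologicalSpace N] [ChartedSpace E N] [IsManifold 𝓘(ℂ, E) ω N]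
variable {h : Metric E N} {w : ℝ × ℝ → N} {Ω : Set (ℝ × ℝ)} {τ : ℝ × ℝ} {M : ℝ}

namespace IsFlowOn

set_option maxHeartbeats 2000000 in
-- With |c| ≤ V the auxiliary fields satisfy q ≲ |b| + 1, q' ≲ |a| + |b|, F ≲ |a| + |b|² and r ≲ |a|
-- + |b| + 1. Inserted in the remainder, each term becomes one of the products in `monomials_le`.
-- The constant is chosen before the solution, so it depends only on M, α, β and V.
lemma exists_abs_energyFourRest_le (hM : CurvatureBoundedBy h M) (α β V : ℝ) :
    ∃ C, 0 ≤ C ∧ ∀ {w : ℝ × ℝ → N} {Ω : Set (ℝ × ℝ)} {τ z : ℝ × ℝ}, IsFlowOn h α β w Ω τ →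
      z ∈ Ω → normAt h (w z) (jet h w 0 z) ≤ V →
      |energyFourRest h α β w z| ≤ C * (1 + normAt h (w z) (jet h w 2 z) ^ 2
        + normAt h (w z) (jet h w 1 z) ^ 4
        + normAt h (w z) (jet h w 2 z) * normAt h (w z) (jet h w 1 z) ^ 3) := by
  have hM0 := hM.1
  by_cases hV0 : 0 ≤ V
  swap
  · exact ⟨0, le_rfl, fun _ _ hV => absurd ((normAt_nonneg _).trans hV) hV0⟩
  obtain ⟨k₁, e₁⟩ : ∃ k, k = |α| + |β| * M * V ^ 3 := ⟨_, rfl⟩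
  obtain ⟨k₂, e₂⟩ : ∃ k, k = |α| + 3 * |β| * M * V ^ 2 := ⟨_, rfl⟩
  obtain ⟨k₃, e₃⟩ : ∃ k, k = M * V ^ 2 * (|β| + (|α| + |β| * M * V ^ 3)) := ⟨_, rfl⟩
  obtain ⟨k₄, e₄⟩ : ∃ k, k = 3 * M * V ^ 2 + 6 * M * V := ⟨_, rfl⟩
  have hk₁ : 0 ≤ k₁ := by rw [e₁]; positivity
  have hk₂ : 0 ≤ k₂ := by rw [e₂]; positivity
  have hk₃ : 0 ≤ k₃ := by rw [e₃]; positivity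
  have hk₄ : 0 ≤ k₄ := by rw [e₄]; positivity
  obtain ⟨κ, hκ⟩ : ∃ κ, κ = 1 + k₁ + k₂ + k₃ + k₄ := ⟨_, rfl⟩
  obtain ⟨D₀, eD⟩ : ∃ D, D = M * (1 + V) ^ 2 * κ * 3 := ⟨_, rfl⟩
  have hD₀ : 0 ≤ D₀ := by rw [eD, hκ]; positivity
  -- The absolute coefficients in `energyFourRest` add up to 72 for the plain terms, 60 for those
  -- with α and 64 for those with β; 100 covers each.
  refine ⟨(100 * (1 + |α| + |β|)) * D₀, by positivity, ?_⟩
  intro w Ω τ z hw hz hV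
  have hK := hw.symmetric.toIsKahler
  have n := fun v => normAt_nonneg (h := h) (q := w z) v
  have hq := normAt_lowerVel_le (α := α) (β := β) hM hK hV
  have hq' := hw.normAt_dLowerVel_le hM hz hV
  have hF := hw.normAt_covD_covD_cubic_le hM hz hV
  have hr := hw.normAt_curvVel_le hM hz hV
  have hI := normAt_mulI (q := w z) hK (jet h w 2 z)
  have hb := n (jet h w 1 z)
  have ha := n (jet h w 2 z)
  rw [← e₁] at hq
  rw [← e₂] at hq'
  rw [← e₃] at hr
  rw [← e₄] at hF
  obtain ⟨x, hx⟩ : ∃ x, x = normAt h (w z) (jet h w 2 z) := ⟨_, rfl⟩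
  obtain ⟨y, hy⟩ : ∃ y, y = normAt h (w z) (jet h w 1 z) := ⟨_, rfl⟩
  rw [← hx] at hq' hF hr hI ha ⊢
  rw [← hy] at hq hq' hF hr hb ⊢
  obtain ⟨Q, hQ⟩ : ∃ Q, Q = 1 + x ^ 2 + y ^ 4 + x * y ^ 3 := ⟨_, rfl⟩
  obtain ⟨p1, p2, p3, p4, p5, p6, p7, p8⟩ := monomials_le ha hb
  rw [← hQ] at p1 p2 p3 p4 p5 p6 p7 p8 ⊢
  have hQ0 : 0 ≤ Q := by rw [hQ]; positivity
  -- Every term below factors as M, times a power of V (1, V or V²), times 1 or one of the kᵢ, times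
  -- a monomial bounded by 3Q.
  have m : ∀ {s A B P : ℝ}, 0 ≤ A → 0 ≤ B → 0 ≤ P → A ≤ (1 + V) ^ 2 → B ≤ κ → P ≤ 3 * Q →
      s ≤ M * A * B * P → s ≤ D₀ * Q := by
    intro s A B P hA hB hP h1 h2 h3 h4
    have hκ0 : 0 ≤ κ := hB.trans h2
    calc s ≤ M * A * B * P := h4
      _ ≤ M * (1 + V) ^ 2 * κ * (3 * Q) := by gcongr
      _ = D₀ * Q := by rw [eD]; ring
  have V2 : V ^ 2 ≤ (1 + V) ^ 2 := by nlinarith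
  have V1 : V ≤ (1 + V) ^ 2 := by nlinarith
  have V0 : 1 ≤ (1 + V) ^ 2 := by nlinarith
  have K0 : 1 ≤ κ := by linarith
  have K1 : k₁ ≤ κ := by linarith
  have K2 : k₂ ≤ κ := by linarith
  have K3 : k₃ ≤ κ := by linarith
  have K4 : k₄ ≤ κ := by linarith
  have s0 : |curvForm h (w z) (jet h w 1 z) (jet h w 1 z) (jet h w 1 z) (jet h w 2 z)|
      ≤ D₀ * Q := m zero_le_one zero_le_one (by positivity) V0 K0 p1
    ((hM.abs_curvForm_le hK hy.ge hy.ge hy.ge hx.ge).trans_eq (by ring))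
  have s1 : |curvForm h (w z) (dLowerVel h α β w z) (jet h w 0 z) (jet h w 0 z) (jet h w 2 z)|
      ≤ D₀ * Q := m (sq_nonneg V) hk₂ (by positivity) V2 K2 p2
    ((hM.abs_curvForm_le hK hq' hV hV hx.ge).trans_eq (by ring))
  have s2 : |curvForm h (w z) (lowerVel h α β w z) (jet h w 1 z) (jet h w 0 z) (jet h w 2 z)|
      ≤ D₀ * Q := m hV0 hk₁ (by positivity) V1 K1 p3
    ((hM.abs_curvForm_le hK hq hy.ge hV hx.ge).trans_eq (by ring))
  have s3 : |curvForm h (w z) (lowerVel h α β w z) (jet h w 0 z) (jet h w 1 z) (jet h w 2 z)|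
      ≤ D₀ * Q := m hV0 hk₁ (by positivity) V1 K1 p3
    ((hM.abs_curvForm_le hK hq hV hy.ge hx.ge).trans_eq (by ring))
  have s4 : |curvForm h (w z) (jet h w 1 z) (jet h w 0 z) (lowerVel h α β w z) (jet h w 2 z)|
      ≤ D₀ * Q := m hV0 hk₁ (by positivity) V1 K1 p3
    ((hM.abs_curvForm_le hK hy.ge hV hq hx.ge).trans_eq (by ring))
  have s5 : |curvForm h (w z) (jet h w 0 z) (jet h w 1 z) (lowerVel h α β w z) (jet h w 2 z)|
      ≤ D₀ * Q := m hV0 hk₁ (by positivity) V1 K1 p3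
    ((hM.abs_curvForm_le hK hV hy.ge hq hx.ge).trans_eq (by ring))
  have s6 : |curvForm h (w z) (jet h w 0 z) (jet h w 0 z) (dLowerVel h α β w z) (jet h w 2 z)|
      ≤ D₀ * Q := m (sq_nonneg V) hk₂ (by positivity) V2 K2 p2
    ((hM.abs_curvForm_le hK hV hV hq' hx.ge).trans_eq (by ring))
  have s7 : |curvForm h (w z) (mulI E (jet h w 2 z)) (jet h w 1 z) (jet h w 1 z) (jet h w 0 z)|
      ≤ D₀ * Q := m hV0 zero_le_one (by positivity) V1 K0 p4
    ((hM.abs_curvForm_le hK hI.le hy.ge hy.ge hV).trans_eq (by ring))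
  have s8 : |curvForm h (w z) (mulI E (jet h w 2 z)) (jet h w 0 z) (jet h w 2 z) (jet h w 0 z)|
      ≤ D₀ * Q := m (sq_nonneg V) zero_le_one (by positivity) V2 K0 p5
    ((hM.abs_curvForm_le hK hI.le hV hx.ge hV).trans_eq (by ring))
  have s9 : |curvForm h (w z) (mulI E (jet h w 2 z)) (jet h w 0 z) (jet h w 1 z) (jet h w 1 z)|
      ≤ D₀ * Q := m hV0 zero_le_one (by positivity) V1 K0 p4
    ((hM.abs_curvForm_le hK hI.le hV hy.ge hy.ge).trans_eq (by ring))
  have s10 : |curvForm h (w z) (covD h w (1, 0) (covD h w (1, 0) (cubic h w)) z)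
      (jet h w 0 z) (jet h w 1 z) (jet h w 0 z)|
      ≤ D₀ * Q := m (sq_nonneg V) hk₄ (by positivity) V2 K4 p6
    ((hM.abs_curvForm_le hK hF hV hy.ge hV).trans_eq (by ring))
  have s11 : |curvForm h (w z) (curvVel h w z) (jet h w 0 z) (jet h w 1 z) (jet h w 0 z)|
      ≤ D₀ * Q := m (sq_nonneg V) hk₃ (by positivity) V2 K3 p7
    ((hM.abs_curvForm_le hK hr hV hy.ge hV).trans_eq (by ring))
  have s12 : |curvForm h (w z) (jet h w 1 z) (dLowerVel h α β w z) (jet h w 1 z) (jet h w 0 z)|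
      ≤ D₀ * Q := m hV0 hk₂ (by positivity) V1 K2 p8
    ((hM.abs_curvForm_le hK hy.ge hq' hy.ge hV).trans_eq (by ring))
  have s13 : |curvForm h (w z) (jet h w 1 z) (jet h w 0 z) (jet h w 1 z) (mulI E (jet h w 2 z))|
      ≤ D₀ * Q := m hV0 zero_le_one (by positivity) V1 K0 p4
    ((hM.abs_curvForm_le hK hy.ge hV hy.ge hI.le).trans_eq (by ring))
  have s14 : |curvForm h (w z) (jet h w 0 z) (jet h w 0 z) (jet h w 2 z) (mulI E (jet h w 2 z))|
      ≤ D₀ * Q := m (sq_nonneg V) zero_le_one (by positivity) V2 K0 p5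
    ((hM.abs_curvForm_le hK hV hV hx.ge hI.le).trans_eq (by ring))
  have s15 : |curvForm h (w z) (jet h w 0 z) (jet h w 0 z) (jet h w 1 z)
      (covD h w (1, 0) (covD h w (1, 0) (cubic h w)) z)|
      ≤ D₀ * Q := m (sq_nonneg V) hk₄ (by positivity) V2 K4 p6
    ((hM.abs_curvForm_le hK hV hV hy.ge hF).trans_eq (by ring))
  have s16 : |curvForm h (w z) (jet h w 0 z) (jet h w 0 z) (jet h w 1 z) (curvVel h w z)|
      ≤ D₀ * Q := m (sq_nonneg V) hk₃ (by positivity) V2 K3 p7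
    ((hM.abs_curvForm_le hK hV hV hy.ge hr).trans_eq (by ring))
  have s17 : |curvForm h (w z) (jet h w 0 z) (dLowerVel h α β w z) (jet h w 1 z) (jet h w 1 z)|
      ≤ D₀ * Q := m hV0 hk₂ (by positivity) V1 K2 p8
    ((hM.abs_curvForm_le hK hV hq' hy.ge hy.ge).trans_eq (by ring))
  have hα := abs_nonneg α
  have hβ := abs_nonneg β
  have hD : 0 ≤ D₀ * Q := by positivity
  have t : ∀ (c : ℝ) {s : ℝ}, |s| ≤ D₀ * Q → |c * s| ≤ |c| * (D₀ * Q) := fun c s hs => by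
    rw [abs_mul]; exact mul_le_mul_of_nonneg_left hs (abs_nonneg c)
  have u0 := abs_le.1 (t β s0)
  have u10 := abs_le.1 (t β s10)
  have u15 := abs_le.1 (t β s15)
  have u7 := abs_le.1 (t α s7)
  have u8 := abs_le.1 (t α s8)
  have u9 := abs_le.1 (t α s9)
  have u13 := abs_le.1 (t α s13)
  have u14 := abs_le.1 (t α s14)
  replace s1 := abs_le.1 s1
  replace s2 := abs_le.1 s2
  replace s3 := abs_le.1 s3
  replace s4 := abs_le.1 s4
  replace s5 := abs_le.1 s5
  replace s6 := abs_le.1 s6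
  replace s11 := abs_le.1 s11
  replace s12 := abs_le.1 s12
  replace s16 := abs_le.1 s16
  replace s17 := abs_le.1 s17
  have hαD := mul_nonneg hα hD
  have hβD := mul_nonneg hβ hD
  simp only [energyFourRest]
  rw [abs_le]
  constructor <;> linarith

end IsFlowOn

end RestEstimate

/-! ### One-dimensional interpolation, and differentiation of integrals over a period. -/

section Integrals

open MeasureTheory Real

lemma one_le_two_pi : (1 : ℝ) ≤ 2 * π := by linarith [two_le_pi]

/-- A nonnegative function on a period is bounded by its mean and its total variation. -/
lemma le_integral_add_integral {f f' g : ℝ → ℝ} (hf : ∀ x, HasDerivAt f (f' x) x)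
    (hf' : Continuous f') (hg : Continuous g) (hfg : ∀ x, |f' x| ≤ g x) (hf0 : ∀ x, 0 ≤ f x)
    {x : ℝ} (hx : x ∈ Icc 0 (2 * π)) :
    f x ≤ (∫ s in (0 : ℝ)..2 * π, f s) + ∫ s in (0 : ℝ)..2 * π, g s := by
  have hπ := one_le_two_pi
  have hc : Continuous f := continuous_iff_continuousAt.2 fun s => (hf s).continuousAt
  have hg0 : ∀ s, 0 ≤ g s := fun s => (abs_nonneg _).trans (hfg s)
  set G := ∫ s in (0 : ℝ)..2 * π, g s with hG
  have hG0 : 0 ≤ G := intervalIntegral.integral_nonneg (by positivity) fun s _ => hg0 s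
  have key : ∀ y ∈ Icc 0 (2 * π), f x ≤ f y + G := by
    intro y hy
    have h1 : ∫ s in y..x, f' s = f x - f y :=
      intervalIntegral.integral_eq_sub_of_hasDerivAt (fun s _ => hf s) (hf'.intervalIntegrable _ _)
    have h2 : |∫ s in y..x, f' s| ≤ G := by
      calc |∫ s in y..x, f' s| ≤ |∫ s in y..x, abs (f' s)| :=
            by simpa only [Real.norm_eq_abs] using
              intervalIntegral.norm_integral_le_abs_integral_norm (f := f') (μ := volume)
        _ ≤ ∫ s in (0 : ℝ)..2 * π, |f' s| := by
            have := intervalIntegral.abs_integral_mono_interval (f := fun s => |f' s|)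
              (μ := volume) (a := y) (b := x) (c := 0) (d := 2 * π) ?_ ?_
              (hf'.abs.intervalIntegrable _ _)
            · refine this.trans_eq (abs_of_nonneg ?_)
              exact intervalIntegral.integral_nonneg (by positivity) fun s _ => abs_nonneg _
            · rw [uIoc_of_le (show (0 : ℝ) ≤ 2 * π by positivity), uIoc]
              exact Ioc_subset_Ioc (le_min hy.1 hx.1) (max_le hy.2 hx.2)
            · exact Filter.Eventually.of_forall fun s => abs_nonneg _
        _ ≤ G := intervalIntegral.integral_mono_on (by positivity) (hf'.abs.intervalIntegrable _ _)
            (hg.intervalIntegrable _ _) fun s _ => hfg s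
    have h3 := (abs_le.1 h2).2
    linarith
  -- Averaging over y gives the mean of f plus G; the mean is at most the integral because 2π ≥ 1.
  have h1 : ∫ _ in (0 : ℝ)..2 * π, f x ≤ ∫ y in (0 : ℝ)..2 * π, (f y + G) :=
    intervalIntegral.integral_mono_on (by positivity) (by simp)
      ((hc.add continuous_const).intervalIntegrable _ _) key
  rw [intervalIntegral.integral_add (hc.intervalIntegrable _ _) (by simp),
    intervalIntegral.integral_const, intervalIntegral.integral_const, smul_eq_mul, smul_eq_mul,
    sub_zero] at h1
  have h2 : 0 ≤ ∫ s in (0 : ℝ)..2 * π, f s :=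
    intervalIntegral.integral_nonneg (by positivity) fun s _ => hf0 s
  nlinarith

/-- Here x stands for |a|, y for |b|, and Y = ∫x². The supremum of y² is O((1 + Y)^(1/2)). Hence ∫y⁴
is sublinear in Y, and ∫y⁶, which controls ∫xy³ together with ∫x², is at most linear. The exponent
is critical: the bound (sup y²)²∫y² is exactly linear in 1 + Y. -/
lemma integral_lowerOrder_le {x y y' : ℝ → ℝ} {b : ℝ} (hx : Continuous x) (hy : Continuous y)
    (hy0 : ∀ s, 0 ≤ y s) (hd : ∀ s, HasDerivAt (fun s => y s ^ 2) (y' s) s)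
    (hy' : Continuous y') (hxy : ∀ s, |y' s| ≤ 2 * (x s * y s))
    (hb : ∫ s in (0 : ℝ)..2 * π, y s ^ 2 ≤ b) :
    ∫ s in (0 : ℝ)..2 * π, (1 + x s ^ 2 + y s ^ 4 + x s * y s ^ 3)
      ≤ (9 + 4 * (1 + b) ^ 3) * (1 + ∫ s in (0 : ℝ)..2 * π, x s ^ 2) := by
  have hπ : (0 : ℝ) ≤ 2 * π := by positivity
  have I : ∀ {f : ℝ → ℝ}, Continuous f → IntervalIntegrable f volume 0 (2 * π) :=
    fun hf => hf.intervalIntegrable _ _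
  set Y := ∫ s in (0 : ℝ)..2 * π, x s ^ 2 with hY
  have hY0 : 0 ≤ Y := intervalIntegral.integral_nonneg hπ fun s _ => sq_nonneg _
  have hb0 : 0 ≤ b := (intervalIntegral.integral_nonneg hπ fun s _ => sq_nonneg _).trans hb
  -- The weight r = √(1 + Y) in 2xy ≤ x²/r + r y² balances the two integrals: Y/r ≤ r, and r∫y² ≤
  -- rb.
  obtain ⟨r, hr1, hr⟩ : ∃ r : ℝ, 1 ≤ r ∧ r ^ 2 = 1 + Y :=
    ⟨√(1 + Y), by rw [one_le_sqrt]; linarith, sq_sqrt (by linarith)⟩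
  have hr0 : 0 < r := by linarith
  have h1 : ∀ s, |y' s| ≤ r⁻¹ * x s ^ 2 + r * y s ^ 2 := by
    intro s
    refine (hxy s).trans ?_
    have h2 : r⁻¹ * x s ^ 2 + r * y s ^ 2 - 2 * (x s * y s) = r⁻¹ * (x s - r * y s) ^ 2 := by
      field_simp
      ring
    have h3 : 0 ≤ r⁻¹ * (x s - r * y s) ^ 2 := by positivity
    linarith
  have h2 : ∀ s ∈ Icc 0 (2 * π), y s ^ 2 ≤ 2 * r * (1 + b) := by
    intro s hs
    have h3 := le_integral_add_integral hd hy' (by fun_prop) h1 (fun s => sq_nonneg _) hs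
    rw [intervalIntegral.integral_add (I (by fun_prop)) (I (by fun_prop)),
      intervalIntegral.integral_const_mul, intervalIntegral.integral_const_mul, ← hY] at h3
    have h4 : r⁻¹ * Y ≤ r := by
      rw [inv_mul_le_iff₀ hr0]
      nlinarith
    have h5 := mul_le_mul_of_nonneg_left hb hr0.le
    nlinarith
  set m := 2 * r * (1 + b) with hm
  have hm0 : 0 ≤ m := by positivity
  have h3 : ∀ s ∈ Icc 0 (2 * π), 1 + x s ^ 2 + y s ^ 4 + x s * y s ^ 3 ≤
      1 + 2 * x s ^ 2 + (m + m ^ 2) * y s ^ 2 := by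
    intro s hs
    have h4 := h2 s hs
    have h5 : y s ^ 4 ≤ m * y s ^ 2 := by nlinarith [sq_nonneg (y s)]
    have h6 : y s ^ 6 ≤ m ^ 2 * y s ^ 2 := by
      have := mul_le_mul_of_nonneg_left h5 hm0
      nlinarith [mul_le_mul_of_nonneg_left h4 (pow_nonneg (hy0 s) 4)]
    nlinarith [sq_nonneg (x s - y s ^ 3), sq_nonneg (x s), sq_nonneg (y s ^ 3)]
  have h4 := intervalIntegral.integral_mono_on hπ (I (by fun_prop)) (I (by fun_prop)) h3
  refine h4.trans ?_
  rw [intervalIntegral.integral_add (I (by fun_prop)) (I (by fun_prop)),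
    intervalIntegral.integral_add (I (by fun_prop)) (I (by fun_prop)),
    intervalIntegral.integral_const_mul, intervalIntegral.integral_const_mul, ← hY,
    intervalIntegral.integral_const, smul_eq_mul, mul_one, sub_zero]
  have h5 := mul_le_mul_of_nonneg_left hb (by positivity : 0 ≤ m + m ^ 2)
  have h6 : m ^ 2 = 4 * (1 + b) ^ 2 * (1 + Y) := by rw [← hr, hm]; ring
  have h7 : m ≤ 2 * (1 + b) * (1 + Y) := by
    rw [hm, ← hr]
    nlinarith [mul_le_mul_of_nonneg_left hr1 hr0.le]
  -- In the final constant 9 absorbs 2π + 2Y against 1 + Y, and 4(1 + b)³ absorbs (m + m²)b.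
  have h8 := pi_lt_four
  have h9 : (m + m ^ 2) * b ≤ ((2 * (1 + b) + 4 * (1 + b) ^ 2) * b) * (1 + Y) := by
    have := mul_le_mul_of_nonneg_right h7 hb0
    rw [h6]
    nlinarith
  have h10 : (2 * (1 + b) + 4 * (1 + b) ^ 2) * b ≤ 4 * (1 + b) ^ 3 := by
    nlinarith [mul_nonneg hb0 hb0]
  have h11 := mul_le_mul_of_nonneg_right h10 (by linarith : 0 ≤ 1 + Y)
  nlinarith

variable {F : ℝ × ℝ → ℝ} {T t : ℝ}

lemma contDiffAt_fderiv_apply {z : ℝ × ℝ} (hF : ContDiffAt ℝ ∞ F z) (e : ℝ × ℝ) :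
    ContDiffAt ℝ ∞ (fun z => fderiv ℝ F z e) z :=
  (hF.fderiv_right (m := ∞) (by simp)).clm_apply contDiffAt_const

lemma continuous_slice (hF : ∀ z ∈ (univ : Set ℝ) ×ˢ Ioo 0 T, ContinuousAt F z)
    (ht : t ∈ Ioo 0 T) : Continuous (fun x => F (x, t)) :=
  continuous_iff_continuousAt.2 fun x =>
    (hF (x, t) ⟨trivial, ht⟩).comp (f := fun x => (x, t)) (by fun_prop)

lemma hasDerivAt_slice (hF : ∀ z ∈ (univ : Set ℝ) ×ˢ Ioo 0 T, ContDiffAt ℝ ∞ F z)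
    (ht : t ∈ Ioo 0 T) (x : ℝ) :
    HasDerivAt (fun x => F (x, t)) (fderiv ℝ F (x, t) (1, 0)) x :=
  ((hF (x, t) ⟨trivial, ht⟩).differentiableAt (by simp)).hasFDerivAt.comp_hasDerivAt x
    ((hasDerivAt_id x).prodMk (hasDerivAt_const x t))

lemma hasDerivAt_integral (hF : ∀ z ∈ (univ : Set ℝ) ×ˢ Ioo 0 T, ContDiffAt ℝ ∞ F z)
    (ht : t ∈ Ioo 0 T) :
    HasDerivAt (fun t => ∫ x in (0 : ℝ)..2 * π, F (x, t))
      (∫ x in (0 : ℝ)..2 * π, fderiv ℝ F (x, t) (0, 1)) t := by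
  obtain ⟨ε, hε, hball⟩ := Metric.nhds_basis_closedBall.mem_iff.1 (isOpen_Ioo.mem_nhds ht)
  have hc : ∀ z ∈ (univ : Set ℝ) ×ˢ Ioo 0 T, ContinuousAt F z := fun z hz => (hF z hz).continuousAt
  have hc' : ∀ z ∈ (univ : Set ℝ) ×ˢ Ioo 0 T, ContinuousAt (fun z => fderiv ℝ F z (0, 1)) z :=
    fun z hz => (contDiffAt_fderiv_apply (hF z hz) _).continuousAt
  have hcomp : IsCompact (Icc 0 (2 * π) ×ˢ Metric.closedBall t ε) :=
    isCompact_Icc.prod (isCompact_closedBall t ε)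
  obtain ⟨K, hK⟩ := hcomp.exists_bound_of_continuousOn (f := fun z => fderiv ℝ F z (0, 1))
    fun z hz => (hc' z ⟨trivial, hball hz.2⟩).continuousWithinAt
  refine (intervalIntegral.hasDerivAt_integral_of_dominated_loc_of_deriv_le
    (F := fun t x => F (x, t)) (F' := fun t x => fderiv ℝ F (x, t) (0, 1)) (bound := fun _ => K)
    (Metric.ball_mem_nhds t hε) ?_ ?_ ?_ ?_ ?_ ?_).2
  · filter_upwards [isOpen_Ioo.mem_nhds ht] with t' ht'
    exact (continuous_slice hc ht').aestronglyMeasurable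
  · exact (continuous_slice hc ht).intervalIntegrable _ _
  · exact (continuous_slice hc' ht).aestronglyMeasurable
  · refine Filter.Eventually.of_forall fun x hx t' ht' => hK (x, t')
      ⟨?_, Metric.ball_subset_closedBall ht'⟩
    rw [uIoc_of_le (by positivity)] at hx
    exact ⟨hx.1.le, hx.2⟩
  · simp
  · refine Filter.Eventually.of_forall fun x _ t' ht' => ?_
    have h1 := hF (x, t') ⟨trivial, hball (Metric.ball_subset_closedBall ht')⟩
    exact (h1.differentiableAt (by simp)).hasFDerivAt.comp_hasDerivAt t'
      ((hasDerivAt_const t' x).prodMk (hasDerivAt_id t'))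

lemma IsExactOn.integral_eq_zero {f : ℝ × ℝ → ℝ}
    (hf : IsExactOn (univ ×ˢ Ioo 0 T) (2 * π, 0) f) (ht : t ∈ Ioo 0 T) :
    ∫ x in (0 : ℝ)..2 * π, f (x, t) = 0 := by
  obtain ⟨Φ, h1, h2, h3⟩ := hf
  have h4 : (fun x => f (x, t)) = fun x => fderiv ℝ Φ (x, t) (1, 0) :=
    funext fun x => h3 (x, t) ⟨trivial, ht⟩
  have h5 := h2 (0, t)
  rw [h4, intervalIntegral.integral_eq_sub_of_hasDerivAt (fun x _ => hasDerivAt_slice h1 ht x)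
    ((continuous_slice (fun z hz => (contDiffAt_fderiv_apply (h1 z hz) (1, 0)).continuousAt)
      ht).intervalIntegrable _ _)]
  simp only [Prod.mk_add_mk, zero_add, add_zero] at h5
  rw [h5, sub_self]

end Integrals

/-! ### The differential inequality for E₄ along a flow on ℝ × (0, T). -/

section Growth

open MeasureTheory Real

variable {E : Type*} [NormedAddCommGroup E] [NormedSpace ℂ E] [FiniteDimensional ℂ E]
variable {N : Type*} [TopologicalSpace N] [ChartedSpace E N] [IsManifold 𝓘(ℂ, E) ω N]
variable {h : Metric E N} {w : ℝ × ℝ → N} {T t M : ℝ}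

lemma IsExactOn.continuous_slice {f : ℝ × ℝ → ℝ} {τ : ℝ × ℝ}
    (hf : IsExactOn (univ ×ˢ Ioo 0 T) τ f) (ht : t ∈ Ioo 0 T) :
    Continuous (fun x => f (x, t)) := by
  obtain ⟨Φ, h1, h2, h3⟩ := hf
  have h4 : (fun x => f (x, t)) = fun x => fderiv ℝ Φ (x, t) (1, 0) :=
    funext fun x => h3 (x, t) ⟨trivial, ht⟩
  rw [h4]
  exact SchrodingerAiry.continuous_slice
    (fun z hz => (contDiffAt_fderiv_apply (h1 z hz) (1, 0)).continuousAt) ht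

namespace IsFlowOn

variable {α β : ℝ}

section

variable (hw : IsFlowOn h α β w (univ ×ˢ Ioo 0 T) (2 * π, 0)) (ht : t ∈ Ioo 0 T)
include hw ht

lemma hasDerivAt_integral_energyOne :
    HasDerivAt (fun t => ∫ x in (0 : ℝ)..2 * π,
      metricAt h (w (x, t)) (jet h w 0 (x, t)) (jet h w 0 (x, t))) 0 t := by
  have h1 := hasDerivAt_integral
    (fun z hz => hw.smooth.contDiffAt_inner (h := h) (hw.jet (h := h) 0).smooth
      (hw.jet (h := h) 0).smooth hz) ht
  rwa [hw.exact_fderiv_energyOne.integral_eq_zero ht] at h1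

lemma continuous_inner_jet (i j : ℕ) :
    Continuous (fun x => metricAt h (w (x, t)) (jet h w i (x, t)) (jet h w j (x, t))) :=
  continuous_slice (fun _ hz => (hw.smooth.contDiffAt_inner (h := h) (hw.jet (h := h) i).smooth
    (hw.jet (h := h) j).smooth hz).continuousAt) ht

lemma continuous_normAt_jet (i : ℕ) :
    Continuous (fun x => normAt h (w (x, t)) (jet h w i (x, t))) :=
  continuous_sqrt.comp (hw.continuous_inner_jet ht i i)

lemma hasDerivAt_normAt_jet_sq (i : ℕ) (x : ℝ) :
    HasDerivAt (fun x => normAt h (w (x, t)) (jet h w i (x, t)) ^ 2)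
      (2 * metricAt h (w (x, t)) (jet h w (i + 1) (x, t)) (jet h w i (x, t))) x := by
  have h1 := hasDerivAt_slice
    (fun z hz => hw.smooth.contDiffAt_inner (h := h) (hw.jet (h := h) i).smooth
      (hw.jet (h := h) i).smooth hz) ht x
  rw [hw.smooth.fderiv_inner (hw.jet (h := h) i).smooth (hw.jet (h := h) i).smooth ⟨trivial, ht⟩,
    metricAt_symm (jet h w i (x, t)), ← two_mul] at h1
  simp only [normAt_sq]
  exact h1

/-- One-dimensional Sobolev inequality. The derivative of |c|² is at most 2|b||c| ≤ |b|² + |c|², so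
sup |c|² ≤ ∫|c|² + ∫(|b|² + |c|²), which explains 2a + b. -/
lemma normAt_jet_zero_le {a b : ℝ}
    (ha : ∫ x in (0 : ℝ)..2 * π, metricAt h (w (x, t)) (jet h w 0 (x, t)) (jet h w 0 (x, t)) ≤ a)
    (hb : ∫ x in (0 : ℝ)..2 * π, metricAt h (w (x, t)) (jet h w 1 (x, t)) (jet h w 1 (x, t)) ≤ b)
    {x : ℝ} (hx : x ∈ Icc 0 (2 * π)) :
    normAt h (w (x, t)) (jet h w 0 (x, t)) ≤ √(2 * a + b) := by
  have c0 := hw.continuous_inner_jet ht 0 0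
  have c1 := hw.continuous_inner_jet ht 1 1
  have h1 := le_integral_add_integral (hw.hasDerivAt_normAt_jet_sq ht 0)
    ((hw.continuous_inner_jet ht 1 0).const_mul 2)
    (g := fun x => metricAt h (w (x, t)) (jet h w 1 (x, t)) (jet h w 1 (x, t))
      + metricAt h (w (x, t)) (jet h w 0 (x, t)) (jet h w 0 (x, t)))
    (c1.add c0) (fun x => ?_) (fun x => sq_nonneg _) hx
  · simp only [normAt_sq] at h1
    rw [intervalIntegral.integral_add (c1.intervalIntegrable _ _) (c0.intervalIntegrable _ _)] at h1
    exact Real.sqrt_le_sqrt (by linarith)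
  · rw [abs_mul, abs_two, ← normAt_sq, ← normAt_sq]
    have h2 := abs_metricAt_le (h := h) (q := w (x, t)) (jet h w 1 (x, t)) (jet h w 0 (x, t))
    nlinarith [sq_nonneg (normAt h (w (x, t)) (jet h w 1 (x, t))
      - normAt h (w (x, t)) (jet h w 0 (x, t)))]

lemma hasDerivAt_integral_energyFourDensity :
    HasDerivAt (fun t => ∫ x in (0 : ℝ)..2 * π, energyFourDensity h w (x, t))
      (∫ x in (0 : ℝ)..2 * π, energyFourRest h α β w (x, t)) t := by
  have h1 := hasDerivAt_integral (fun z hz => hw.contDiffAt_energyFourDensity hz) ht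
  have h2 := hw.exact_fderiv_energyFourDensity_sub_rest
  have h3 := h2.integral_eq_zero ht
  have h4 := continuous_slice (fun z hz =>
    (contDiffAt_fderiv_apply (hw.contDiffAt_energyFourDensity hz) (0, 1)).continuousAt) ht
  have h5 : (fun x => energyFourRest h α β w (x, t)) = fun x =>
      fderiv ℝ (energyFourDensity h w) (x, t) (0, 1)
      - (fderiv ℝ (energyFourDensity h w) (x, t) (0, 1) - energyFourRest h α β w (x, t)) := by
    funext x
    ring
  rw [h5, intervalIntegral.integral_sub (h4.intervalIntegrable _ _)
    ((h2.continuous_slice ht).intervalIntegrable _ _), h3, sub_zero]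
  exact h1

/-- The remainder is a time derivative minus an exact density, and both are continuous; its many
terms need not be inspected. -/
lemma continuous_energyFourRest : Continuous (fun x => energyFourRest h α β w (x, t)) := by
  have h2 := hw.exact_fderiv_energyFourDensity_sub_rest
  have h4 := continuous_slice (fun z hz =>
    (contDiffAt_fderiv_apply (hw.contDiffAt_energyFourDensity hz) (0, 1)).continuousAt) ht
  exact (h4.sub (h2.continuous_slice ht)).congr fun x => by simp

/-- Coercivity: both curvature terms are quadratic in b and quadratic in c, and their weights 8 and
2 add up to 10. -/
lemma le_energyFourDensity (hM : CurvatureBoundedBy h M) {x V : ℝ}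
    (hV : normAt h (w (x, t)) (jet h w 0 (x, t)) ≤ V) :
    2 * metricAt h (w (x, t)) (jet h w 2 (x, t)) (jet h w 2 (x, t))
      - 10 * M * V ^ 2 * metricAt h (w (x, t)) (jet h w 1 (x, t)) (jet h w 1 (x, t))
      ≤ energyFourDensity h w (x, t) := by
  have hK := hw.symmetric.toIsKahler
  have h1 := abs_le.1 (hM.abs_curvForm_le hK le_rfl hV le_rfl hV
    (X := jet h w 1 (x, t)) (Y := jet h w 1 (x, t)))
  have h2 := abs_le.1 (hM.abs_curvForm_le hK hV hV le_rfl le_rfl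
    (Y := jet h w 1 (x, t)) (W := jet h w 1 (x, t)))
  rw [← normAt_sq (jet h w 1 (x, t)), energyFourDensity]
  nlinarith

end

lemma exists_energyFour_growth (hM : CurvatureBoundedBy h M) (α β a b : ℝ) (hb : 0 ≤ b) :
    ∃ C > 0, ∃ K > 0, ∀ {w : ℝ × ℝ → N} {T t : ℝ},
      IsFlowOn h α β w (univ ×ˢ Ioo 0 T) (2 * π, 0) → t ∈ Ioo 0 T →
      ∫ x in (0 : ℝ)..2 * π, metricAt h (w (x, t)) (jet h w 0 (x, t)) (jet h w 0 (x, t)) ≤ a →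
      ∫ x in (0 : ℝ)..2 * π, metricAt h (w (x, t)) (jet h w 1 (x, t)) (jet h w 1 (x, t)) ≤ b →
      ∫ x in (0 : ℝ)..2 * π, energyFourRest h α β w (x, t) ≤
        C * ((∫ x in (0 : ℝ)..2 * π, energyFourDensity h w (x, t)) + K) := by
  have hM0 := hM.1
  obtain ⟨V, hV⟩ : ∃ V, V = √(2 * a + b) := ⟨_, rfl⟩
  obtain ⟨C₁, hC₁, H⟩ := exists_abs_energyFourRest_le hM α β V
  -- Integrated coercivity gives 1 + ∫|a|² ≤ (E₄ + 10MV²b + 2)/2, whence K and the factor 1/2.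
  -- Replacing C₁ by C₁ + 1 makes C positive.
  refine ⟨(C₁ + 1) * (9 + 4 * (1 + b) ^ 3) / 2, by positivity, 10 * M * V ^ 2 * b + 2,
    by positivity, ?_⟩
  intro w T t hw ht h0 h1
  have hπ : (0 : ℝ) ≤ 2 * π := by positivity
  have I : ∀ {f : ℝ → ℝ}, Continuous f → IntervalIntegrable f volume 0 (2 * π) :=
    fun hf => hf.intervalIntegrable _ _
  have hc : ∀ x ∈ Icc 0 (2 * π), normAt h (w (x, t)) (jet h w 0 (x, t)) ≤ V := fun x hx =>
    (hw.normAt_jet_zero_le ht h0 h1 hx).trans_eq hV.symm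
  have c1 := hw.continuous_normAt_jet ht 1
  have c2 := hw.continuous_normAt_jet ht 2
  have cd := continuous_slice (fun z hz => (hw.contDiffAt_energyFourDensity hz).continuousAt) ht
  have h2 := integral_lowerOrder_le (b := b) c2 c1 (fun x => normAt_nonneg _)
    (hw.hasDerivAt_normAt_jet_sq ht 1) ((hw.continuous_inner_jet ht 2 1).const_mul 2)
    (fun x => by
      rw [abs_mul, abs_two]
      exact mul_le_mul_of_nonneg_left (abs_metricAt_le _ _) zero_le_two)
    (by simpa only [normAt_sq] using h1)
  have h3 : ∫ x in (0 : ℝ)..2 * π, energyFourRest h α β w (x, t) ≤ ∫ x in (0 : ℝ)..2 * π,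
      C₁ * (1 + normAt h (w (x, t)) (jet h w 2 (x, t)) ^ 2
        + normAt h (w (x, t)) (jet h w 1 (x, t)) ^ 4
        + normAt h (w (x, t)) (jet h w 2 (x, t)) * normAt h (w (x, t)) (jet h w 1 (x, t)) ^ 3) :=
    intervalIntegral.integral_mono_on hπ (I (hw.continuous_energyFourRest ht)) (I (by fun_prop))
      fun x hx => (le_abs_self _).trans (H hw ⟨trivial, ht⟩ (hc x hx))
  rw [intervalIntegral.integral_const_mul] at h3
  have h4 := intervalIntegral.integral_mono_on hπ
    (I (((hw.continuous_inner_jet ht 2 2).const_mul 2).sub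
      ((hw.continuous_inner_jet ht 1 1).const_mul (10 * M * V ^ 2)))) (I cd)
    fun x hx => hw.le_energyFourDensity ht hM (hc x hx)
  simp only [Pi.sub_apply] at h4
  rw [intervalIntegral.integral_sub (I ((hw.continuous_inner_jet ht 2 2).const_mul 2))
      (I ((hw.continuous_inner_jet ht 1 1).const_mul (10 * M * V ^ 2))),
    intervalIntegral.integral_const_mul, intervalIntegral.integral_const_mul] at h4
  simp only [normAt_sq (jet h w 2 _)] at h2
  have h5 := mul_le_mul_of_nonneg_left h1 (by positivity : 0 ≤ 10 * M * V ^ 2)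
  have h6 : 0 ≤ ∫ x in (0 : ℝ)..2 * π,
      metricAt h (w (x, t)) (jet h w 2 (x, t)) (jet h w 2 (x, t)) :=
    intervalIntegral.integral_nonneg hπ fun x _ => metricAt_nonneg _
  simp only [normAt_sq (jet h w 2 _)] at h3
  have h7 : 0 ≤ 9 + 4 * (1 + b) ^ 3 := by positivity
  calc _ ≤ C₁ * ((9 + 4 * (1 + b) ^ 3) * (1 + ∫ x in (0 : ℝ)..2 * π,
        metricAt h (w (x, t)) (jet h w 2 (x, t)) (jet h w 2 (x, t)))) :=
        h3.trans (mul_le_mul_of_nonneg_left h2 hC₁)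
    _ ≤ (C₁ + 1) * (9 + 4 * (1 + b) ^ 3) * (1 + ∫ x in (0 : ℝ)..2 * π,
        metricAt h (w (x, t)) (jet h w 2 (x, t)) (jet h w 2 (x, t))) := by
        rw [mul_assoc]
        gcongr
        linarith
    _ ≤ (C₁ + 1) * (9 + 4 * (1 + b) ^ 3) * (((∫ x in (0 : ℝ)..2 * π,
        energyFourDensity h w (x, t)) + (10 * M * V ^ 2 * b + 2)) / 2) := by
        gcongr
        linarith
    _ = _ := by ring

end IsFlowOn

end Growth

/-! ### Solutions on the circle as periodic maps of the angle and time. -/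

section Solutions

open MeasureTheory Real

variable {E : Type*} [NormedAddCommGroup E] [NormedSpace ℂ E]
variable {N : Type*} [TopologicalSpace N] [ChartedSpace E N] [IsManifold 𝓘(ℂ, E) ω N]

lemma hasDerivAt_rchart_comp {γ : ℝ → N} {s : ℝ} {p : N}
    (hγ : MDifferentiableAt 𝓘(ℝ, ℝ) 𝓘(ℝ, E) γ s) (hp : γ s ∈ (rchart E p).source) :
    HasDerivAt (fun σ => rchart E p (γ σ))
      (chartDeriv E p (γ s) (velocity (E := E) γ s)) s := by
  have h1 : MDifferentiableAt 𝓘(ℝ, E) 𝓘(ℝ, E) (rchart E p) (γ s) :=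
    mdifferentiableAt_extChartAt (by simpa using hp)
  let L : ℝ →L[ℝ] E := mfderiv 𝓘(ℝ, ℝ) 𝓘(ℝ, E) γ s
  have h2 : HasFDerivAt (fun σ => rchart E p (γ σ)) ((chartDeriv E p (γ s)).comp L) s :=
    (h1.hasMFDerivAt.comp s hγ.hasMFDerivAt).hasFDerivAt
  exact h2.hasDerivAt

lemma velocity_eq {γ : ℝ → N} {s : ℝ} {v : E} (hγ : MDifferentiableAt 𝓘(ℝ, ℝ) 𝓘(ℝ, E) γ s)
    (hv : HasDerivAt (fun σ => rchart E (γ s) (γ σ)) v s) : velocity (E := E) γ s = v := by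
  have h1 := hasDerivAt_rchart_comp hγ (mem_extChartAt_source (γ s))
  exact (chartDeriv_self (E := E) (γ s) _).symm.trans (h1.unique hv)

/-- A map `u : S¹ × ℝ → N` in the angular coordinate. -/
def angular (u : ℝ → Circle → N) (z : ℝ × ℝ) : N := u z.2 (Circle.exp z.1)

lemma angular_periodic (u : ℝ → Circle → N) (z : ℝ × ℝ) :
    angular u (z + (2 * π, 0)) = angular u z := by
  simp [angular, Circle.exp_add]

section Smooth

variable {u : ℝ → Circle → N} {T : ℝ}
  (hu : ContMDiffOn ((𝓡 1).prod 𝓘(ℝ, ℝ)) 𝓘(ℝ, E) ∞ (fun z : Circle × ℝ => u z.2 z.1)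
    (univ ×ˢ Ico 0 T))
include hu

lemma contMDiffOn_angular :
    ContMDiffOn 𝓘(ℝ, ℝ × ℝ) 𝓘(ℝ, E) ∞ (angular u) (univ ×ˢ Ico 0 T) := by
  have h1 : ContMDiff 𝓘(ℝ, ℝ × ℝ) ((𝓡 1).prod 𝓘(ℝ, ℝ)) ∞
      (fun z : ℝ × ℝ => (Circle.exp z.1, z.2)) :=
    (contMDiff_circleExp.comp contDiff_fst.contMDiff).prodMk contDiff_snd.contMDiff
  exact hu.comp h1.contMDiffOn fun z hz => ⟨trivial, hz.2⟩

lemma contDiffWithinAt_coordMap_angular {z : ℝ × ℝ} {p : N} (hz : z ∈ (univ : Set ℝ) ×ˢ Ico 0 T)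
    (hp : angular u z ∈ (rchart E p).source) :
    ContDiffWithinAt ℝ ∞ (coordMap E (angular u) p) (univ ×ˢ Ico 0 T) z :=
  ((contMDiffAt_extChartAt' (I := 𝓘(ℝ, E)) (by simpa using hp)).comp_contMDiffWithinAt z
    (contMDiffOn_angular hu z hz)).contDiffWithinAt

lemma isSmoothMapOn_angular : IsSmoothMapOn E (angular u) (univ ×ˢ Ioo 0 T) where
  isOpen := isOpen_univ.prod isOpen_Ioo
  continuousAt _ hz := ((contMDiffOn_angular hu).contMDiffAt
    (Filter.mem_of_superset ((isOpen_univ.prod isOpen_Ioo).mem_nhds hz)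
      (prod_mono_right Ioo_subset_Ico_self))).continuousAt
  contDiffAt _ hz := (contDiffWithinAt_coordMap_angular hu ⟨trivial, Ioo_subset_Ico_self hz.2⟩
    (mem_extChartAt_source _)).contDiffAt
    (Filter.mem_of_superset ((isOpen_univ.prod isOpen_Ioo).mem_nhds hz)
      (prod_mono_right Ioo_subset_Ico_self))

lemma mdifferentiableAt_lift {t : ℝ} (ht : t ∈ Ico 0 T) (x : ℝ) :
    MDifferentiableAt 𝓘(ℝ, ℝ) 𝓘(ℝ, E) (lift (u t)) x := by
  have h1 : ContMDiff 𝓘(ℝ, ℝ) 𝓘(ℝ, ℝ × ℝ) ∞ (fun x : ℝ => (x, t)) :=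
    (contDiff_id.prodMk contDiff_const).contMDiff
  have h2 : ContMDiff 𝓘(ℝ, ℝ) 𝓘(ℝ, E) ∞ (lift (u t)) := contMDiffOn_univ.1
    ((contMDiffOn_angular hu).comp h1.contMDiffOn fun x _ => ⟨trivial, ht⟩)
  exact (h2 x).mdifferentiableAt (by simp)

lemma mdifferentiableAt_time {t : ℝ} (ht : t ∈ Ioo 0 T) (x : ℝ) :
    MDifferentiableAt 𝓘(ℝ, ℝ) 𝓘(ℝ, E) (fun τ => u τ (Circle.exp x)) t := by
  have h1 : ContMDiff 𝓘(ℝ, ℝ) 𝓘(ℝ, ℝ × ℝ) ∞ (fun t : ℝ => (x, t)) :=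
    (contDiff_const.prodMk contDiff_id).contMDiff
  have h2 : ContMDiffOn 𝓘(ℝ, ℝ) 𝓘(ℝ, E) ∞ (fun τ => u τ (Circle.exp x)) (Ico 0 T) :=
    (contMDiffOn_angular hu).comp h1.contMDiffOn fun t ht => ⟨trivial, ht⟩
  exact (h2.contMDiffAt (Ico_mem_nhds ht.1 ht.2)).mdifferentiableAt (by simp)

/-- The velocity of `u(·, t)` in the chart at `p`. -/
lemma chartDeriv_dx {t x : ℝ} (ht : t ∈ Ico 0 T) {p : N}
    (hp : angular u (x, t) ∈ (rchart E p).source) :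
    chartDeriv E p (angular u (x, t)) (dx (E := E) (u t) x) =
      fderivWithin ℝ (coordMap E (angular u) p) (univ ×ˢ Ico 0 T) (x, t) (1, 0) := by
  have h1 := hasDerivAt_rchart_comp (mdifferentiableAt_lift hu ht x) hp
  have h2 := ((contDiffWithinAt_coordMap_angular hu (z := (x, t)) ⟨trivial, ht⟩
    hp).differentiableWithinAt (by simp)).hasFDerivWithinAt
  have h3 : HasDerivWithinAt (fun x : ℝ => (x, t)) (1, 0) univ x :=
    ((hasDerivAt_id x).prodMk (hasDerivAt_const x t)).hasDerivWithinAt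
  have h4 := h2.comp_hasDerivWithinAt x h3 fun y _ =>
    (⟨trivial, ht⟩ : (y, t) ∈ (univ : Set ℝ) ×ˢ Ico 0 T)
  exact h1.unique (hasDerivWithinAt_univ.1 h4)

lemma dx_eq {t : ℝ} (ht : t ∈ Ioo 0 T) (x : ℝ) :
    dx (E := E) (u t) x = vel E (angular u) (1, 0) (x, t) := by
  have h1 := (((isSmoothMapOn_angular hu).contDiffAt (x, t) ⟨trivial, ht⟩).differentiableAt
    (by simp)).hasFDerivAt
  have h2 := h1.comp_hasDerivAt x ((hasDerivAt_id x).prodMk (hasDerivAt_const x t))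
  exact velocity_eq (mdifferentiableAt_lift hu (Ioo_subset_Ico_self ht) x) h2

lemma velocity_time_eq {t : ℝ} (ht : t ∈ Ioo 0 T) (x : ℝ) :
    velocity (E := E) (fun τ => u τ (Circle.exp x)) t = vel E (angular u) (0, 1) (x, t) := by
  have h1 := (((isSmoothMapOn_angular hu).contDiffAt (x, t) ⟨trivial, ht⟩).differentiableAt
    (by simp)).hasFDerivAt
  have h2 := h1.comp_hasDerivAt t ((hasDerivAt_const t x).prodMk (hasDerivAt_id t))
  exact velocity_eq (mdifferentiableAt_time hu ht x) h2

variable [FiniteDimensional ℂ E] {h : Metric E N}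

/-- Both sides are computed in the chart at the same point, so the derivative along the curve is the
partial derivative in the direction (1, 0). -/
lemma covDeriv_eq {X : ℝ × ℝ → E} (hX : IsSmoothFieldOn (angular u) X (univ ×ˢ Ioo 0 T))
    {t : ℝ} (ht : t ∈ Ioo 0 T) (x : ℝ) :
    covDeriv h (lift (u t)) (fun x => (X (x, t) : E)) x = covD h (angular u) (1, 0) X (x, t) := by
  have h1 := ((hX (x, t) ⟨trivial, ht⟩).differentiableAt (by simp)).hasFDerivAt.comp_hasDerivAt x
    ((hasDerivAt_id x).prodMk (hasDerivAt_const x t))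
  have h2 : deriv (fun σ => coordField (angular u) X (angular u (x, t)) (σ, t)) x
      = fderiv ℝ (coordField (angular u) X (angular u (x, t))) (x, t) (1, 0) := h1.deriv
  have h3 : (velocity (lift (u t)) x : E) = vel E (angular u) (1, 0) (x, t) := dx_eq hu ht x
  change deriv (fun σ => coordField (angular u) X (angular u (x, t)) (σ, t)) x
    + christoffel h (angular u (x, t)) (rchart E (angular u (x, t)) (angular u (x, t)))
      (velocity (lift (u t)) x : E) (X (x, t)) = _
  rw [h2, h3, covD, cov, IsSmoothMapOn.coordField_self]
  rfl

lemma dx_eq_jet {t : ℝ} (ht : t ∈ Ioo 0 T) :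
    dx (E := E) (u t) = fun x => (jet h (angular u) 0 (x, t) : E) := funext fun x => dx_eq hu ht x

lemma isPeriodicMap_angular : IsPeriodicMap E (angular u) (univ ×ˢ Ioo 0 T) (2 * π, 0) :=
  ⟨isSmoothMapOn_angular hu, angular_periodic u⟩

lemma dxx_eq_jet {t : ℝ} (ht : t ∈ Ioo 0 T) :
    dxx h (u t) = fun x => (jet h (angular u) 1 (x, t) : E) := by
  funext x
  rw [dxx, dx_eq_jet hu ht (h := h)]
  exact covDeriv_eq hu ((isPeriodicMap_angular hu).jet 0).smooth ht x

lemma dxxx_eq_jet {t : ℝ} (ht : t ∈ Ioo 0 T) :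
    dxxx h (u t) = fun x => (jet h (angular u) 2 (x, t) : E) := by
  funext x
  rw [dxxx, dxx_eq_jet hu ht]
  exact covDeriv_eq hu ((isPeriodicMap_angular hu).jet 1).smooth ht x

lemma energyOne_eq {t : ℝ} (ht : t ∈ Ioo 0 T) :
    energyOne h (u t) = (1 / 2) * ∫ x in (0 : ℝ)..2 * π,
      metricAt h (angular u (x, t)) (jet h (angular u) 0 (x, t)) (jet h (angular u) 0 (x, t)) := by
  rw [energyOne, dx_eq_jet hu ht (h := h)]
  rfl

lemma normDxx_eq {t : ℝ} (ht : t ∈ Ioo 0 T) :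
    normDxx h (u t) = √(∫ x in (0 : ℝ)..2 * π,
      metricAt h (angular u (x, t)) (jet h (angular u) 1 (x, t))
        (jet h (angular u) 1 (x, t))) := by
  rw [normDxx, dxx_eq_jet hu ht (h := h)]
  rfl

/-- With P = S(b,c;b,c) and Q = S(c,c;b,b) the two curvature integrands are P − Q and P + Q, and
−3(P − Q) − 5(P + Q) = −8P − 2Q. -/
lemma energyFour_eq (hK : IsKahler h) {t : ℝ} (ht : t ∈ Ioo 0 T) :
    energyFour h (u t) = ∫ x in (0 : ℝ)..2 * π, energyFourDensity h (angular u) (x, t) := by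
  have hw := isPeriodicMap_angular hu
  have c := hw.jet (h := h) 0
  have b := hw.jet (h := h) 1
  have a := hw.jet (h := h) 2
  have Jc := hw.mulI c
  have I : ∀ {X Y : ℝ × ℝ → E}, IsPeriodicField (angular u) (univ ×ˢ Ioo 0 T) (2 * π, 0) X →
      IsPeriodicField (angular u) (univ ×ˢ Ioo 0 T) (2 * π, 0) Y →
      IntervalIntegrable (fun x => metricAt h (angular u (x, t)) (X (x, t)) (Y (x, t))) volume 0
        (2 * π) := fun {X Y} hX hY =>
    (continuous_slice (F := fun z => metricAt h (angular u z) (X z) (Y z)) (fun z hz =>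
      (hw.smooth.contDiffAt_inner hX.smooth hY.smooth hz).continuousAt) ht).intervalIntegrable _ _
  have I1 := I a a
  have I2 := I b (hw.curvature (h := h) b c c)
  have I3 := I b (hw.curvature (h := h) b Jc Jc)
  have e : energyFour h (u t) =
      2 * (∫ x in (0 : ℝ)..2 * π, metricAt h (angular u (x, t)) (jet h (angular u) 2 (x, t))
        (jet h (angular u) 2 (x, t)))
      - 3 * (∫ x in (0 : ℝ)..2 * π, metricAt h (angular u (x, t)) (jet h (angular u) 1 (x, t))
        (curvatureAt h (angular u (x, t)) (jet h (angular u) 1 (x, t))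
          (jet h (angular u) 0 (x, t)) (jet h (angular u) 0 (x, t))))
      - 5 * (∫ x in (0 : ℝ)..2 * π, metricAt h (angular u (x, t)) (jet h (angular u) 1 (x, t))
        (curvatureAt h (angular u (x, t)) (jet h (angular u) 1 (x, t))
          (mulI E (jet h (angular u) 0 (x, t))) (mulI E (jet h (angular u) 0 (x, t))))) := by
    rw [energyFour, dxxx_eq_jet hu ht (h := h), dxx_eq_jet hu ht (h := h),
      dx_eq_jet hu ht (h := h)]
    rfl
  rw [e, ← intervalIntegral.integral_const_mul, ← intervalIntegral.integral_const_mul,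
    ← intervalIntegral.integral_const_mul,
    ← intervalIntegral.integral_sub (I1.const_mul 2) (I2.const_mul 3),
    ← intervalIntegral.integral_sub ((I1.const_mul 2).sub (I2.const_mul 3)) (I3.const_mul 5)]
  refine intervalIntegral.integral_congr fun x _ => ?_
  have eS := metricAt_symm (h := h) (q := angular u (x, t))
  simp only [energyFourDensity]
  rw [eS (jet h (angular u) 1 (x, t)) (curvatureAt h _ _ _ _),
    eS (jet h (angular u) 1 (x, t)) (curvatureAt h _ _ _ _), metricAt_curvatureAt hK,
    curvatureAt_mulI_eq_curvSym hK]
  simp only [map_add, add_apply]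
  have e3 : ∀ X Y Z W : E, metricAt h (angular u (x, t)) (curvSym h (angular u (x, t)) X Y Z) W
    = curvForm h (angular u (x, t)) X Y Z W := fun _ _ _ _ => rfl
  rw [e3, e3, curvForm_swap_right hK _ (jet h (angular u) 1 (x, t)) _ _
    (jet h (angular u) 1 (x, t))]
  ring

end Smooth

end Solutions

/-! ### Conservation of E₁ down to the initial time. -/

section Conservation

open MeasureTheory Real

variable {E : Type*} [NormedAddCommGroup E] [NormedSpace ℂ E] [FiniteDimensional ℂ E]
variable {N : Type*} [TopologicalSpace N] [ChartedSpace E N] [IsManifold 𝓘(ℂ, E) ω N]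
variable {h : Metric E N} {u : ℝ → Circle → N} {u₀ : Circle → N} {α β T : ℝ}

/-- The equation holds only for t > 0, while the hypothesis on the energy concerns t = 0. Continuity
up to the boundary comes from derivatives within ℝ × [0, T), as u is not controlled for negative
times. -/
lemma continuousOn_energyOneDensity
    (hu : ContMDiffOn ((𝓡 1).prod 𝓘(ℝ, ℝ)) 𝓘(ℝ, E) ∞ (fun z : Circle × ℝ => u z.2 z.1)
      (univ ×ˢ Ico 0 T)) :
    ContinuousOn (fun z : ℝ × ℝ => metricAt h (angular u z) (dx (E := E) (u z.2) z.1)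
      (dx (E := E) (u z.2) z.1)) (univ ×ˢ Ico 0 T) := by
  have : FiniteDimensional ℝ E := FiniteDimensional.complexToReal E
  intro z₀ hz₀
  set S : Set (ℝ × ℝ) := univ ×ˢ Ico 0 T with hS
  set p := angular u z₀ with hp
  have hU : UniqueDiffOn ℝ S := uniqueDiffOn_univ.prod (uniqueDiffOn_Ico 0 T)
  have hs : p ∈ (rchart E p).source := mem_extChartAt_source p
  have h1 := contDiffWithinAt_coordMap_angular hu hz₀ hs
  have h2 := (h1.fderivWithin_right (m := ∞) hU (by simp) hz₀).continuousWithinAt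
  have h3 : ContinuousWithinAt (fun z => fderivWithin ℝ (coordMap E (angular u) p) S z (1, 0))
      S z₀ := h2.clm_apply continuousWithinAt_const
  have h4 : ContinuousWithinAt (fun z => metricCoeff h p (coordMap E (angular u) p z)) S z₀ :=
    ContinuousAt.comp_continuousWithinAt (f := coordMap E (angular u) p)
      ((isMetricOn_metricCoeff h p).contDiffAt ((rchart E p).map_source hs)).continuousAt
      h1.continuousWithinAt
  refine ((h4.clm_apply h3).clm_apply h3).congr_of_eventuallyEq_of_mem ?_ hz₀
  have h5 : ∀ᶠ z in 𝓝[S] z₀, angular u z ∈ (rchart E p).source :=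
    (contMDiffOn_angular hu z₀ hz₀).continuousWithinAt
      ((isOpen_extChartAt_source (I := 𝓘(ℝ, E)) p).mem_nhds hs)
  filter_upwards [h5, self_mem_nhdsWithin] with z hz hzS
  have h6 := chartDeriv_dx hu (t := z.2) (x := z.1) hzS.2 hz
  refine (inner_eq_metricCoeff h hz (dx (E := E) (u z.2) z.1 : E)
    (dx (E := E) (u z.2) z.1 : E)).trans ?_
  exact congrArg (fun v : E => metricCoeff h p (rchart E p (angular u z)) v v) h6

lemma continuousOn_integral {F : ℝ × ℝ → ℝ} {s : ℝ}
    (hF : ContinuousOn F (univ ×ˢ Icc 0 s)) :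
    ContinuousOn (fun t => ∫ x in (0 : ℝ)..2 * π, F (x, t)) (Icc 0 s) := by
  obtain ⟨K, hK⟩ := (isCompact_Icc.prod isCompact_Icc).exists_bound_of_continuousOn
    (hF.mono (prod_mono_left (subset_univ (Icc 0 (2 * π)))))
  intro t ht
  refine intervalIntegral.continuousWithinAt_of_dominated_interval (bound := fun _ => K)
    (F := fun t x => F (x, t)) ?_ ?_ (by simp) ?_
  · filter_upwards [self_mem_nhdsWithin] with t' ht'
    have h1 : Continuous (fun x => F (x, t')) :=
      hF.comp_continuous (f := fun x => (x, t')) (by fun_prop) fun x => ⟨trivial, ht'⟩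
    exact h1.aestronglyMeasurable
  · filter_upwards [self_mem_nhdsWithin] with t' ht'
    refine Filter.Eventually.of_forall fun x hx => hK (x, t') ⟨?_, ht'⟩
    rw [uIoc_of_le (by positivity)] at hx
    exact ⟨hx.1.le, hx.2⟩
  · refine Filter.Eventually.of_forall fun x _ => ?_
    exact (hF (x, t) ⟨trivial, ht⟩).comp (f := fun t => (x, t)) (by fun_prop)
      fun t' ht' => ⟨trivial, ht'⟩

lemma IsSmoothSolution.isFlowOn (hN : IsLocallyHermitianSymmetric h)
    (hu : IsSmoothSolution h α β T u₀ u) :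
    IsFlowOn h α β (angular u) (univ ×ˢ Ioo 0 T) (2 * π, 0) where
  toIsPeriodicMap := isPeriodicMap_angular hu.smooth
  symmetric := hN
  flow z hz := by
    obtain ⟨x, t⟩ := z
    have h1 := hu.flow t hz.2 x
    rw [dxx_eq_jet hu.smooth hz.2, dxxx_eq_jet hu.smooth hz.2,
      dx_eq_jet hu.smooth hz.2 (h := h)] at h1
    have h2 := velocity_time_eq hu.smooth hz.2 x
    have h3 : vel E (angular u) (0, 1) (x, t) = α • mulI E (jet h (angular u) 1 (x, t))
        + β • (jet h (angular u) 2 (x, t) + (1 / 2 : ℝ) • curvatureAt h (angular u (x, t))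
          (jet h (angular u) 0 (x, t)) (mulI E (jet h (angular u) 0 (x, t)))
          (mulI E (jet h (angular u) 0 (x, t)))) := h2.symm.trans h1
    rw [h3]
    -- As R(u_x, u_x)u_x = 0, the symmetric operator on three copies of u_x reduces to ½R(u_x,
    -- Ju_x)Ju_x.
    simp only [lowerVel, cubic, curvSym, curvatureAt_self, zero_add, Pi.add_apply, Pi.smul_apply,
      smul_add]
    abel

/-- E₁ has zero derivative at positive times and is continuous at 0; the mean value theorem on [0,
t] joins the two. -/
lemma IsSmoothSolution.energyOne_eq (hN : IsLocallyHermitianSymmetric h)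
    (hu : IsSmoothSolution h α β T u₀ u) {t : ℝ} (ht : t ∈ Ioo 0 T) :
    energyOne h (u t) = energyOne h u₀ := by
  have hw := hu.isFlowOn hN
  have e : ∀ t, energyOne h (u t) = (1 / 2) * ∫ x in (0 : ℝ)..2 * π,
      metricAt h (angular u (x, t)) (dx (E := E) (u t) x) (dx (E := E) (u t) x) := fun _ => rfl
  have hc : ContinuousOn (fun t => energyOne h (u t)) (Icc 0 t) := by
    simp only [e]
    exact continuousOn_const.mul (continuousOn_integral ((continuousOn_energyOneDensity
      hu.smooth).mono (prod_mono_right (Icc_subset_Ico_right ht.2))))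
  have hd : ∀ s ∈ Ioo 0 t, HasDerivAt (fun t => energyOne h (u t)) 0 s := by
    intro s hs
    have hs' : s ∈ Ioo 0 T := ⟨hs.1, hs.2.trans ht.2⟩
    have h1 := (hw.hasDerivAt_integral_energyOne hs').const_mul (1 / 2 : ℝ)
    rw [mul_zero] at h1
    refine h1.congr_of_eventuallyEq ?_
    filter_upwards [isOpen_Ioo.mem_nhds hs'] with r hr
    exact SchrodingerAiry.energyOne_eq hu.smooth hr
  obtain ⟨c, -, h2⟩ := exists_hasDerivAt_eq_slope (fun t => energyOne h (u t)) (fun _ => 0) ht.1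
    hc hd
  have h3 : t - 0 ≠ 0 := by linarith [ht.1]
  field_simp at h2
  rw [hu.initial] at h2
  linarith

end Conservation

end SchrodingerAiry

end

theorem lemma3p6 {E : Type*} [NormedAddCommGroup E] [NormedSpace ℂ E] [FiniteDimensional ℂ E]
    {N : Type*} [TopologicalSpace N] [T2Space N] [SecondCountableTopology N] [ConnectedSpace N]
    [ChartedSpace E N] [IsManifold 𝓘(ℂ, E) ω N]
    (h : SchrodingerAiry.Metric E N) (hN : SchrodingerAiry.IsLocallyHermitianSymmetric h)
    (α β : ℝ) (A B : ℝ) :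
    ∃ C > 0, ∃ K > 0, ∀ (T : ℝ) (u₀ : Circle → N) (u : ℝ → Circle → N),
      SchrodingerAiry.IsSmoothSolution h α β T u₀ u →
      SchrodingerAiry.energyOne h u₀ ≤ A →
      ∀ t ∈ Set.Ioo 0 T, SchrodingerAiry.normDxx h (u t) ≤ B →
        DifferentiableAt ℝ (fun τ => SchrodingerAiry.energyFour h (u τ)) t ∧
        deriv (fun τ => SchrodingerAiry.energyFour h (u τ)) t
          ≤ C * (SchrodingerAiry.energyFour h (u t) + K) := by
  obtain ⟨M, hM⟩ := SchrodingerAiry.exists_curvatureBoundedBy hN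
  -- The bound 2A compensates the factor ½ in E₁, and B² bounds the integral under the square root
  -- in the L² norm.
  obtain ⟨C, hC, K, hK, H⟩ := SchrodingerAiry.IsFlowOn.exists_energyFour_growth hM α β (2 * A)
    (B ^ 2) (sq_nonneg B)
  refine ⟨C, hC, K, hK, fun T u₀ u hu hA t ht hB => ?_⟩
  have hw := hu.isFlowOn hN
  have h1 : HasDerivAt (fun τ => SchrodingerAiry.energyFour h (u τ)) _ t :=
    (hw.hasDerivAt_integral_energyFourDensity ht).congr_of_eventuallyEq (by
      filter_upwards [isOpen_Ioo.mem_nhds ht] with s hs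
      exact SchrodingerAiry.energyFour_eq hu.smooth hN.toIsKahler hs)
  refine ⟨h1.differentiableAt, ?_⟩
  rw [h1.deriv, SchrodingerAiry.energyFour_eq hu.smooth hN.toIsKahler ht]
  refine H hw ht ?_ ?_
  · rw [← hu.energyOne_eq hN ht, SchrodingerAiry.energyOne_eq hu.smooth ht] at hA
    linarith
  · rw [SchrodingerAiry.normDxx_eq hu.smooth ht] at hB
    -- A time at which the norm is at most B forces B ≥ 0, so the inequality may be squared.
    exact (Real.sqrt_le_left ((Real.sqrt_nonneg _).trans hB)).1 hB
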